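/- A (non-flat) \emph{convex polyhedron} is the convex hull of finitely many points of $\mathbb{R}^3$ with nonempty interior. We say that a convex polyhedron $P$ is \emph{obtained by gluing regular hexagons edge-to-edge} if there are finitely many copies of the regular hexagon of side length $1$ and a pairing of all their edges, each edge being paired with a different edge and glued to it along its whole length by an orientation-compatible isometry, such that each hexagon can be folded along finitely many straight creases (that is, it is divided into finitely many convex polygons, each of which is mapped isometrically into $\mathbb{R}^3$) so that the images of the hexagons together are exactly the boundary of $P$, and two points of the hexagons have the same image if and only if the gluing identifies them. For each of the following six combinatorial types there is a convex polyhedron of this type that is obtained by gluing regular hexagons edge-to-edge: (i) the tetrahedron; (ii) the triangular bipyramid, with $5$ vertices (three of degree $4$, two of degree $3$) and $6$ triangular faces; (iii) the square pyramid, with $5$ vertices (one of degree $4$, four of degree $3$), one quadrilateral and $4$ triangular faces; moreover, the polyhedron can be chosen to be a right pyramid over a rectangle; (iv) the octahedron, with $6$ vertices of degree $4$ and $8$ triangular faces; moreover, the polyhedron can be chosen to be a regular octahedron; (v) the triangular bipyramid with a further vertex stacked on one of its faces, with $6$ vertices (two of degree $5$, two of degree $4$, two of degree $3$) and $8$ triangular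 faces; (vi) the triangular prism, with $6$ vertices of degree $3$, two triangular and three quadrilateral faces; moreover, the polyhedron can be chosen to be a geometric prism, spanned by a triangle and a translate of it. These include all simplicial types with at most $6$ vertices: every convex polyhedron with at most $6$ vertices all of whose faces are triangles has one of the combinatorial types (i), (ii), (iv), (v). -/

import Mathlib

namespace HexGlue

/-- Euclidean 3-space. -/
abbrev E3 : Type := EuclideanSpace ℝ (Fin 3)

/-! ### Convex polyhedra and their combinatorial types -/

/-- A non-flat convex polyhedron: the convex hull of finitely many points of 3-space,
with nonempty interior. -/
def IsConvexPolyhedron (P : Set E3) : Prop :=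
  (∃ s : Set E3, s.Finite ∧ P = convexHull ℝ s) ∧ (interior P).Nonempty

/-- `F` is a `d`-dimensional face of `P`. For `d = 1` these are the edges of a convex polyhedron,
for `d = 2` its faces in the everyday sense. -/
def IsFaceOfDim (P : Set E3) (d : ℕ) (F : Set E3) : Prop :=
  F.Nonempty ∧ IsExposed ℝ P F ∧ Module.finrank ℝ (vectorSpan ℝ F) = d

/-- All 2-dimensional faces of `P` are triangles. -/
def IsSimplicial (P : Set E3) : Prop :=
  ∀ F : Set E3, IsFaceOfDim P 2 F → (F.extremePoints ℝ).ncard = 3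

/-- A combinatorial type with vertices `0, …, n - 1`: the vertex sets of its edges and of its
2-dimensional faces. -/
structure CombType (n : ℕ) where
  edges : Finset (Finset (Fin n))
  faces : Finset (Finset (Fin n))

/-- `P` has combinatorial type `T`: the vertices of `P` can be labelled by `0, …, n - 1` so that the
edges and the 2-dimensional faces of `P` are spanned exactly by the sets listed in `T`. -/
def HasType {n : ℕ} (P : Set E3) (T : CombType n) : Prop :=
  ∃ v : Fin n → E3, Function.Injective v ∧ Set.range v = P.extremePoints ℝ ∧
    (∀ S : Finset (Fin n), S ∈ T.edges ↔ IsFaceOfDim P 1 (convexHull ℝ (v '' (S : Set (Fin n))))) ∧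
    (∀ S : Finset (Fin n), S ∈ T.faces ↔ IsFaceOfDim P 2 (convexHull ℝ (v '' (S : Set (Fin n)))))

/-- Tetrahedron. -/
def tetrahedron : CombType 4 where
  edges := {{0, 1}, {0, 2}, {0, 3}, {1, 2}, {1, 3}, {2, 3}}
  faces := {{0, 1, 2}, {0, 1, 3}, {0, 2, 3}, {1, 2, 3}}

/-- Triangular bipyramid with apices `0`, `1` (degree 3) and equator `2, 3, 4` (degree 4). -/
def triangularBipyramid : CombType 5 where
  edges := {{0, 2}, {0, 3}, {0, 4}, {1, 2}, {1, 3}, {1, 4}, {2, 3}, {2, 4}, {3, 4}}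
  faces := {{0, 2, 3}, {0, 2, 4}, {0, 3, 4}, {1, 2, 3}, {1, 2, 4}, {1, 3, 4}}

/-- Pyramid with apex `0` (degree 4) over the quadrilateral `1, 2, 3, 4` (degree 3). -/
def squarePyramid : CombType 5 where
  edges := {{0, 1}, {0, 2}, {0, 3}, {0, 4}, {1, 2}, {2, 3}, {3, 4}, {1, 4}}
  faces := {{1, 2, 3, 4}, {0, 1, 2}, {0, 2, 3}, {0, 3, 4}, {0, 1, 4}}

/-- Octahedron: the pairs of opposite vertices are `0, 1` and `2, 3` and `4, 5`. -/
def octahedron : CombType 6 where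
  edges := {{0, 2}, {0, 3}, {0, 4}, {0, 5}, {1, 2}, {1, 3}, {1, 4}, {1, 5},
    {2, 4}, {2, 5}, {3, 4}, {3, 5}}
  faces := {{0, 2, 4}, {0, 2, 5}, {0, 3, 4}, {0, 3, 5}, {1, 2, 4}, {1, 2, 5}, {1, 3, 4}, {1, 3, 5}}

/-- The other type with 6 vertices and 8 triangles: the triangular bipyramid with the new vertex `5`
stacked on its face `0, 2, 3`. The vertices `2, 3` have degree 5, `0, 4` degree 4, `1, 5` degree
3. -/
def stackedBipyramid : CombType 6 where
  edges := {{0, 2}, {0, 3}, {0, 4}, {1, 2}, {1, 3}, {1, 4}, {2, 3}, {2, 4}, {3, 4},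
    {0, 5}, {2, 5}, {3, 5}}
  faces := {{0, 2, 5}, {0, 3, 5}, {2, 3, 5}, {0, 2, 4}, {0, 3, 4}, {1, 2, 3}, {1, 2, 4}, {1, 3, 4}}

/-- Triangular prism with triangles `0, 1, 2` and `3, 4, 5`; all vertices have degree 3. -/
def triangularPrism : CombType 6 where
  edges := {{0, 1}, {0, 2}, {1, 2}, {3, 4}, {3, 5}, {4, 5}, {0, 3}, {1, 4}, {2, 5}}
  faces := {{0, 1, 2}, {3, 4, 5}, {0, 1, 3, 4}, {0, 2, 3, 5}, {1, 2, 4, 5}}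

/-! ### Special shapes -/

/-- Right pyramid over a rectangle: up to congruence, the rectangle has side lengths `2 * a`, `2 * b`
and the apex is at height `h` above its centre. -/
def IsRightRectangularPyramid (P : Set E3) : Prop :=
  ∃ (φ : E3 ≃ᵢ E3) (a b h : ℝ), 0 < a ∧ 0 < b ∧ 0 < h ∧
    P = φ '' convexHull ℝ {!₂[a, b, 0], !₂[a, -b, 0], !₂[-a, b, 0], !₂[-a, -b, 0], !₂[0, 0, h]}

/-- Regular octahedron, up to congruence with vertices at distance `r` from the origin on the
coordinate axes. -/
def IsRegularOctahedron (P : Set E3) : Prop :=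
  ∃ (φ : E3 ≃ᵢ E3) (r : ℝ), 0 < r ∧
    P = φ '' convexHull ℝ {!₂[r, 0, 0], !₂[-r, 0, 0], !₂[0, r, 0], !₂[0, -r, 0],
      !₂[0, 0, r], !₂[0, 0, -r]}

/-- Geometric triangular prism: spanned by a triangle and a translate of it that does not lie in the
plane of the triangle. -/
def IsTriangularPrism (P : Set E3) : Prop :=
  ∃ a b c w : E3, AffineIndependent ℝ ![a, b, c, a + w] ∧
    P = convexHull ℝ {a, b, c, a + w, b + w, c + w}

/-! ### Gluing regular hexagons edge to edge -/

/-- The vertices of the regular hexagon of side length 1, in counterclockwise order. -/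
noncomputable def hexVertex (k : Fin 6) : ℂ :=
  Complex.exp ((k : ℕ) * (Real.pi / 3) * Complex.I)

/-- The (closed, solid) regular hexagon of side length 1. -/
def hexagon : Set ℂ := convexHull ℝ (Set.range hexVertex)

/-- The point with parameter `t` on the `k`-th edge of the hexagon, traversed counterclockwise. -/
noncomputable def edgePoint (k : Fin 6) (t : ℝ) : ℂ :=
  AffineMap.lineMap (hexVertex k) (hexVertex (k + 1)) t

/-- An edge-to-edge gluing rule for `n` copies of the hexagon: every edge (a pair of the number of
the hexagon and the number of the edge in it) is paired with another edge. -/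
structure HexGluing (n : ℕ) where
  partner : Fin n × Fin 6 → Fin n × Fin 6
  partner_partner : ∀ e, partner (partner e) = e
  partner_ne : ∀ e, partner e ≠ e

/-- The point with parameter `t` of an edge is glued to the point with parameter `1 - t` of its
partner (so that the orientations of the hexagons match along the edge). -/
def HexGluing.Step {n : ℕ} (g : HexGluing n) (p q : Fin n × ℂ) : Prop :=
  ∃ (e : Fin n × Fin 6) (t : ℝ), t ∈ Set.Icc (0 : ℝ) 1 ∧
    p = (e.1, edgePoint e.2 t) ∧ q = ((g.partner e).1, edgePoint (g.partner e).2 (1 - t))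

/-- Two points of the disjoint union of the hexagons are identified by the gluing. -/
def HexGluing.Glued {n : ℕ} (g : HexGluing n) : Fin n × ℂ → Fin n × ℂ → Prop :=
  Relation.EqvGen g.Step

/-- `f` folds the paper hexagon into space: the hexagon is cut by straight creases into finitely many
convex polygons, and `f` is distance preserving on each of them. (`f` is then continuous on the
hexagon and preserves the lengths of curves in it.) -/
def IsFolding (f : ℂ → E3) : Prop :=
  ∃ pieces : Set (Set ℂ), pieces.Finite ∧ ⋃₀ pieces = hexagon ∧
    ∀ A ∈ pieces, (∃ s : Set ℂ, s.Finite ∧ A = convexHull ℝ s) ∧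
      ∀ x ∈ A, ∀ y ∈ A, dist (f x) (f y) = dist x y

/-- The gluing `g` folds to the surface of `P`: the hexagons can be folded so that together they cover
exactly the boundary of `P`, and two points of them come to lie on each other precisely when `g`
identifies them. -/
def HexGluing.Yields {n : ℕ} (g : HexGluing n) (P : Set E3) : Prop :=
  ∃ f : Fin n → ℂ → E3, (∀ i, IsFolding (f i)) ∧
    (⋃ i, f i '' hexagon) = frontier P ∧
    ∀ i j, ∀ z ∈ hexagon, ∀ w ∈ hexagon, f i z = f j w ↔ g.Glued (i, z) (j, w)

/-- `P` is a non-flat convex polyhedron obtained by gluing finitely many regular hexagons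
edge to edge. -/
def IsHexGlued (P : Set E3) : Prop :=
  IsConvexPolyhedron P ∧ ∃ (n : ℕ) (g : HexGluing n), g.Yields P

end HexGlue

/-!
Lay a hexagon flat in the plane of a facet of the polyhedron. Where it overshoots an edge of the
polyhedron, turn the overshooting part about that edge onto the neighbouring facet, and repeat:
this folds the hexagon, and two placements of it agree where they meet because they differ by a
multiple of the affine functional that defines the crease. In the plane of each facet the hexagons
laid there belong to one honeycomb, so they cover the facet as soon as the other hexagons of that
honeycomb miss it, and the sides shared in the honeycomb are the ones glued. In a basis of the
Eisenstein lattice for the hexagons and suitable orthogonal coordinates for space all data are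
integral, so each of the six polyhedra is verified by finitely many integer inequalities.

For the classification, let `n ≤ 6` points be the vertices of a simplicial polytope. A set of them
spans a face exactly when the vectors of a Gale dual that belong to the complement are positively
dependent. The Gale dual has dimension `n - 4 ≤ 2`, and there positive dependence only depends on
the order of the vectors by slope and on their signs, which leaves finitely many sign patterns.
-/

namespace HexGlue

/-! ### Slicing convex hulls -/

section ConvexHull

variable {E : Type*} [AddCommGroup E] [Module ℝ E]

lemma mem_convexHull_setOf_eq_zero {χ : E →ᵃ[ℝ] ℝ} {s : Set E} (hs : ∀ y ∈ s, 0 ≤ χ y) {x : E}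
    (hx : x ∈ convexHull ℝ s) (hχ : χ x = 0) : x ∈ convexHull ℝ {y ∈ s | χ y = 0} := by
  set Z := {y ∈ s | χ y = 0}
  have hconv : Convex ℝ {y | 0 < χ y ∨ χ y = 0 ∧ y ∈ convexHull ℝ Z} := by
    refine convex_iff_forall_pos.2 fun y hy z hz u w hu hw huw => ?_
    have hχ' : χ (u • y + w • z) = u * χ y + w * χ z := Convex.combo_affine_apply huw
    simp only [Set.mem_ofPred_eq, hχ']
    rcases hy with hy | ⟨hy, hyZ⟩ <;> rcases hz with hz | ⟨hz, hzZ⟩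
    · exact Or.inl (by positivity)
    · exact Or.inl (by rw [hz]; positivity)
    · exact Or.inl (by rw [hy]; positivity)
    · exact Or.inr ⟨by rw [hy, hz]; ring, convex_convexHull ℝ Z hyZ hzZ hu.le hw.le huw⟩
  have hsub := convexHull_min (fun y hy => ?_) hconv hx
  · exact (hsub.resolve_left hχ.not_gt).2
  · exact (hs y hy).lt_or_eq.imp_right fun h => ⟨h.symm, subset_convexHull ℝ Z ⟨hy, h.symm⟩⟩

/-- The point where the line through `a` and `b` meets the hyperplane `φ = 0`; it is `a` when
`φ a = φ b`. -/
noncomputable def crossing (φ : E →ᵃ[ℝ] ℝ) (a b : E) : E :=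
  AffineMap.lineMap a b (φ a / (φ a - φ b))

variable (φ : E →ᵃ[ℝ] ℝ)

lemma map_crossing (ψ : E →ᵃ[ℝ] ℝ) {a b : E} (h : φ b < φ a) :
    ψ (crossing φ a b) = (ψ b * φ a - ψ a * φ b) / (φ a - φ b) := by
  have : φ a - φ b ≠ 0 := (sub_pos.2 h).ne'
  rw [crossing, AffineMap.apply_lineMap, AffineMap.lineMap_apply_ring']
  field_simp
  ring

lemma map_crossing_self {a b : E} (h : φ b < φ a) : φ (crossing φ a b) = 0 := by
  rw [map_crossing φ φ h, mul_comm, sub_self, zero_div]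

lemma crossing_of_eq_zero {a : E} (h : φ a = 0) (b : E) : crossing φ a b = a := by
  rw [crossing, h, zero_div, AffineMap.lineMap_apply_zero]

lemma crossing_neg_swap {a b : E} (h : φ b < φ a) : crossing (-φ) b a = crossing φ a b := by
  have h' : φ a - φ b ≠ 0 := (sub_pos.2 h).ne'
  rw [crossing, crossing, ← AffineMap.lineMap_apply_one_sub]
  congr 1
  rw [AffineMap.coe_neg, Pi.neg_apply, Pi.neg_apply, neg_sub_neg]
  field_simp
  ring

lemma crossing_mem_segment {a b : E} (ha : 0 ≤ φ a) (hb : φ b < 0) :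
    crossing φ a b ∈ segment ℝ a b := by
  have h : 0 < φ a - φ b := by linarith
  rw [crossing, segment_eq_image_lineMap]
  exact ⟨_, ⟨div_nonneg ha h.le, (div_le_one h).2 (by linarith)⟩, rfl⟩

lemma convex_setOf_crossing_mem (a : E) {C : Set E} (hC : Convex ℝ C) :
    Convex ℝ {b | φ b < φ a ∧ crossing φ a b ∈ C} := by
  refine convex_iff_forall_pos.2 fun b ⟨hb, hbC⟩ c ⟨hc, hcC⟩ u w hu hw huw => ?_
  have hφ : φ (u • b + w • c) = u * φ b + w * φ c := Convex.combo_affine_apply huw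
  have hb' : 0 < φ a - φ b := sub_pos.2 hb
  have hc' : 0 < φ a - φ c := sub_pos.2 hc
  have hsum : φ a - (u * φ b + w * φ c) = u * (φ a - φ b) + w * (φ a - φ c) := by
    linear_combination (-φ a) * huw
  have hpos : 0 < u * (φ a - φ b) + w * (φ a - φ c) := by positivity
  refine ⟨by rw [hφ]; linarith, ?_⟩
  have hmem := hC hbC hcC (a := u * (φ a - φ b) / (u * (φ a - φ b) + w * (φ a - φ c)))
    (b := w * (φ a - φ c) / (u * (φ a - φ b) + w * (φ a - φ c))) (by positivity) (by positivity)
    (by field_simp)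
  convert hmem using 1
  simp only [crossing, AffineMap.lineMap_apply_module', hφ, hsum]
  obtain rfl : w = 1 - u := by linarith
  match_scalars <;> field_simp
  ring

lemma crossing_mem_of_mem_convexHull {A B C : Set E} (hA : ∀ a ∈ A, 0 ≤ φ a)
    (hB : ∀ b ∈ B, φ b < 0) (hC : Convex ℝ C) (hAB : ∀ a ∈ A, ∀ b ∈ B, crossing φ a b ∈ C)
    {a b : E} (ha : a ∈ convexHull ℝ A) (hb : b ∈ convexHull ℝ B) : crossing φ a b ∈ C := by
  have hleft : ∀ b ∈ B, crossing φ a b ∈ C := fun b hb => by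
    have hsub := convexHull_min (s := A) (fun a' ha' => ?_)
      (convex_setOf_crossing_mem (-φ) b hC) ha
    · have hlt : φ b < φ a := neg_lt_neg_iff.1 hsub.1
      exact crossing_neg_swap φ hlt ▸ hsub.2
    · have hlt : φ b < φ a' := (hB b hb).trans_le (hA a' ha')
      exact ⟨neg_lt_neg hlt, (crossing_neg_swap φ hlt).symm ▸ hAB a' ha' b hb⟩
  have hφa : 0 ≤ φ a := convexHull_min hA ((convex_Ici (0 : ℝ)).affine_preimage φ) ha
  have hsub : B ⊆ {b | φ b < φ a ∧ crossing φ a b ∈ C} :=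
    fun b hb => ⟨(hB b hb).trans_le hφa, hleft b hb⟩
  exact (convexHull_min hsub (convex_setOf_crossing_mem φ a hC) hb).2

lemma mem_segment_crossing {a b x : E} (hb : φ b < 0) (ha : 0 ≤ φ a)
    (hx : x ∈ segment ℝ a b) (hφx : 0 ≤ φ x) : x ∈ segment ℝ a (crossing φ a b) := by
  rw [segment_eq_image_lineMap] at hx ⊢
  obtain ⟨t, ⟨ht, -⟩, rfl⟩ := hx
  rw [AffineMap.apply_lineMap, AffineMap.lineMap_apply_ring'] at hφx
  rcases ha.eq_or_lt with h | h
  · have : t = 0 := le_antisymm (by nlinarith) ht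
    exact ⟨0, by simp, by simp [this]⟩
  · have hd : 0 < φ a - φ b := by linarith
    refine ⟨t * (φ a - φ b) / φ a, ⟨by positivity, (div_le_one h).2 (by linarith)⟩, ?_⟩
    rw [crossing, AffineMap.lineMap_lineMap_right]
    congr 1
    field_simp

/-- The generators of the part of `convexHull ℝ s` that lies in the half-space `0 ≤ φ`: the points
of `s` there, and the points where the segments between points of `s` leave it. -/
def sliceGenerators (s : Set E) : Set E :=
  {x ∈ s | 0 ≤ φ x} ∪ Set.image2 (crossing φ) {x ∈ s | 0 ≤ φ x} {x ∈ s | φ x < 0}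

lemma convexHull_sliceGenerators (s : Set E) :
    convexHull ℝ (sliceGenerators φ s) = convexHull ℝ s ∩ {x | 0 ≤ φ x} := by
  set A := {x ∈ s | 0 ≤ φ x} with hA
  set B := {x ∈ s | φ x < 0} with hB
  have hpos : Convex ℝ {x | 0 ≤ φ x} := (convex_Ici (0 : ℝ)).affine_preimage φ
  have hneg : Convex ℝ {x | φ x < 0} := (convex_Iio (0 : ℝ)).affine_preimage φ
  refine Set.Subset.antisymm (convexHull_min ?_ ((convex_convexHull ℝ s).inter hpos)) ?_
  · rintro x (hx | ⟨a, ha, b, hb, rfl⟩)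
    · exact ⟨subset_convexHull ℝ s hx.1, hx.2⟩
    · exact ⟨segment_subset_convexHull ha.1 hb.1 (crossing_mem_segment φ ha.2 hb.2),
        (map_crossing_self φ (hb.2.trans_le ha.2)).ge⟩
  · rintro x ⟨hx, hφx : 0 ≤ φ x⟩
    have hsAB : s = A ∪ B := by
      rw [hA, hB, ← Set.sep_or]
      exact (Set.sep_eq_self_iff_mem_true.2 fun y _ => le_or_gt 0 (φ y)).symm
    have hAslice : convexHull ℝ A ⊆ convexHull ℝ (sliceGenerators φ s) :=
      convexHull_mono Set.subset_union_left
    have hBneg : convexHull ℝ B ⊆ {x | φ x < 0} := convexHull_min (fun x hx => hx.2) hneg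
    rcases A.eq_empty_or_nonempty with hAe | hAn
    · rw [hsAB, hAe, Set.empty_union] at hx
      exact absurd (hBneg hx) hφx.not_gt
    rcases B.eq_empty_or_nonempty with hBe | hBn
    · rw [hsAB, hBe, Set.union_empty] at hx
      exact hAslice hx
    rw [hsAB, convexHull_union hAn hBn, mem_convexJoin] at hx
    obtain ⟨a, ha, b, hb, hx⟩ := hx
    have hφa : 0 ≤ φ a := convexHull_min (fun x hx => hx.2) hpos ha
    refine (convex_convexHull ℝ _).segment_subset (hAslice ha) ?_
      (mem_segment_crossing φ (hBneg hb) hφa hx hφx)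
    exact crossing_mem_of_mem_convexHull φ (fun x hx => hx.2) (fun x hx => hx.2)
      (convex_convexHull ℝ _)
      (fun a ha b hb => subset_convexHull ℝ _ (Or.inr ⟨a, ha, b, hb, rfl⟩)) ha hb

lemma exists_finite_convexHull_inter_halfSpaces {ι : Type*} (φ : ι → E →ᵃ[ℝ] ℝ) {s : Set E}
    (hs : s.Finite) (I : Finset ι) :
    ∃ t : Set E, t.Finite ∧ convexHull ℝ s ∩ {x | ∀ i ∈ I, 0 ≤ φ i x} = convexHull ℝ t := by
  classical
  induction I using Finset.induction_on with
  | empty => exact ⟨s, hs, by simp⟩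
  | insert i I _ ih =>
    obtain ⟨t, ht, e⟩ := ih
    refine ⟨sliceGenerators (φ i) t, (ht.sep _).union ((ht.sep _).image2 _ (ht.sep _)), ?_⟩
    rw [convexHull_sliceGenerators, ← e]
    ext x
    simp only [Finset.forall_mem_insert, Set.mem_inter_iff, Set.mem_ofPred_eq]
    tauto

variable {ι : Type*} {v : ι → E} {a b : ι → ℤ}

/-- An integral criterion for `0 ≤ ψ → 0 ≤ φ` to hold on the convex hull of points `v e`, where
`a e` and `b e` are the values of the affine functions `φ` and `ψ` at `v e`. -/
def Dominates (a b : ι → ℤ) : Prop :=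
  (∀ e, 0 ≤ b e → 0 ≤ a e) ∧ ∀ e e', 0 ≤ b e → b e' < 0 → a e * b e' ≤ a e' * b e

instance [Fintype ι] (a b : ι → ℤ) : Decidable (Dominates a b) := by
  unfold Dominates; infer_instance

/-- An integral criterion for `φ = 0 ∧ 0 ≤ ψ` to hold on the convex hull of points `v e` at most at
one of these points, where `a e` and `b e` are the values of the affine functions `φ` and `ψ` at
`v e`. -/
def MeetsInCorner (a b : ι → ℤ) : Prop :=
  (∀ e e', 0 < a e → a e' < 0 → b e' * a e < b e * a e') ∧ (∀ e, a e = 0 → b e ≤ 0) ∧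
    ∀ e e', a e = 0 → b e = 0 → a e' = 0 → b e' = 0 → e = e'

instance [Fintype ι] [DecidableEq ι] (a b : ι → ℤ) : Decidable (MeetsInCorner a b) := by
  unfold MeetsInCorner; infer_instance

lemma Dominates.nonneg (h : Dominates a b) {φ ψ : E →ᵃ[ℝ] ℝ} (hφ : ∀ e, φ (v e) = a e)
    (hψ : ∀ e, ψ (v e) = b e) {x : E} (hx : x ∈ convexHull ℝ (Set.range v)) (hψx : 0 ≤ ψ x) :
    0 ≤ φ x := by
  have hmem : x ∈ convexHull ℝ (sliceGenerators ψ (Set.range v)) := by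
    rw [convexHull_sliceGenerators]
    exact ⟨hx, hψx⟩
  refine convexHull_min ?_ ((convex_Ici (0 : ℝ)).affine_preimage φ) hmem
  rintro _ (⟨⟨e, rfl⟩, he⟩ | ⟨_, ⟨⟨e, rfl⟩, he⟩, _, ⟨⟨e', rfl⟩, he'⟩, rfl⟩)
  · rw [hψ] at he
    rw [Set.mem_preimage, Set.mem_Ici, hφ]
    exact_mod_cast h.1 e (by exact_mod_cast he)
  · rw [Set.mem_preimage, map_crossing ψ φ (he'.trans_le he), hφ, hφ]
    rw [hψ] at he he'
    rw [hψ, hψ]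
    have hle : (a e * b e' : ℝ) ≤ a e' * b e := by
      exact_mod_cast h.2 e e' (by exact_mod_cast he) (by exact_mod_cast he')
    exact div_nonneg (sub_nonneg.2 hle) (by linarith)

lemma MeetsInCorner.exists_eq_or_neg (h : MeetsInCorner a b) {φ ψ : E →ᵃ[ℝ] ℝ}
    (hφ : ∀ e, φ (v e) = a e) (hψ : ∀ e, ψ (v e) = b e) {y : E}
    (hy : y ∈ sliceGenerators φ (Set.range v)) (hφy : φ y = 0) :
    (∃ e, a e = 0 ∧ y = v e) ∨ ψ y < 0 := by
  obtain ⟨⟨e, rfl⟩, -⟩ | ⟨_, ⟨⟨e, rfl⟩, he⟩, _, ⟨⟨e', rfl⟩, he'⟩, rfl⟩ := hy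
  · exact Or.inl ⟨e, by exact_mod_cast (hφ e).symm.trans hφy, rfl⟩
  rcases he.eq_or_lt with h0 | hpos
  · exact Or.inl ⟨e, by exact_mod_cast (h0.trans (hφ e)).symm, crossing_of_eq_zero φ h0.symm _⟩
  · rw [map_crossing φ ψ (he'.trans_le he), hφ, hφ, hψ, hψ]
    rw [hφ] at hpos he'
    have hlt : (b e' * a e : ℝ) < b e * a e' := by
      exact_mod_cast h.1 e e' (by exact_mod_cast hpos) (by exact_mod_cast he')
    exact Or.inr (div_neg_of_neg_of_pos (sub_neg.2 hlt) (by linarith))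

lemma MeetsInCorner.exists_eq (h : MeetsInCorner a b) {φ ψ : E →ᵃ[ℝ] ℝ} (hφ : ∀ e, φ (v e) = a e)
    (hψ : ∀ e, ψ (v e) = b e) {x : E} (hx : x ∈ convexHull ℝ (Set.range v)) (hφx : φ x = 0)
    (hψx : 0 ≤ ψ x) : ∃ e, x = v e := by
  set S := {y ∈ sliceGenerators φ (Set.range v) | φ y = 0}
  have hS : ∀ y ∈ S, (∃ e, a e = 0 ∧ y = v e) ∨ ψ y < 0 :=
    fun y hy => h.exists_eq_or_neg hφ hψ hy.1 hy.2
  have hSneg : ∀ y ∈ S, 0 ≤ (-ψ) y := fun y hy => neg_nonneg.2 <| by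
    rcases hS y hy with ⟨e, he, rfl⟩ | hlt
    · rw [hψ]
      exact_mod_cast h.2.1 e he
    · exact hlt.le
  have hxS : x ∈ convexHull ℝ S := by
    refine mem_convexHull_setOf_eq_zero (fun y hy => ?_) ?_ hφx
    · exact ((convexHull_sliceGenerators φ _).subset (subset_convexHull ℝ _ hy)).2
    · rw [convexHull_sliceGenerators]
      exact ⟨hx, hφx.ge⟩
  have hψ0 : (-ψ) x = 0 := le_antisymm (neg_nonpos.2 hψx)
    (convexHull_min hSneg ((convex_Ici (0 : ℝ)).affine_preimage _) hxS)
  have hx0 := mem_convexHull_setOf_eq_zero hSneg hxS hψ0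
  have hvertex : ∀ y ∈ {y ∈ S | (-ψ) y = 0}, ∃ e, a e = 0 ∧ b e = 0 ∧ y = v e := by
    rintro y ⟨hy, hy0⟩
    rcases hS y hy with ⟨e, he, rfl⟩ | hlt
    · exact ⟨e, he, by exact_mod_cast (hψ e).symm.trans (neg_eq_zero.1 hy0), rfl⟩
    · exact absurd (neg_eq_zero.1 hy0) hlt.ne
  obtain ⟨y, hy⟩ := convexHull_nonempty_iff.1 ⟨x, hx0⟩
  have hsub : {y ∈ S | (-ψ) y = 0}.Subsingleton := fun y hy z hz => by
    obtain ⟨e, he, he', rfl⟩ := hvertex y hy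
    obtain ⟨f, hf, hf', rfl⟩ := hvertex z hz
    rw [h.2.2 e f he he' hf hf']
  rw [hsub.eq_singleton_of_mem hy, convexHull_singleton] at hx0
  obtain ⟨e, -, -, rfl⟩ := hvertex y hy
  exact ⟨e, hx0⟩

end ConvexHull

/-! ### The hexagon in Eisenstein coordinates -/

/-- The primitive sixth root of unity spanning, together with `1`, the Eisenstein lattice. -/
noncomputable def rho : ℂ := Complex.exp ((Real.pi / 3 : ℝ) * Complex.I)

lemma rho_eq : rho = ⟨1 / 2, √3 / 2⟩ := by
  rw [rho, Complex.exp_mul_I, ← Complex.ofReal_cos, ← Complex.ofReal_sin,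
    Real.cos_pi_div_three, Real.sin_pi_div_three]
  apply Complex.ext <;> simp

lemma rho_sq : rho ^ 2 = rho - 1 := by
  have h3 : √3 * √3 = (3 : ℝ) := Real.mul_self_sqrt (by norm_num)
  rw [rho_eq, pow_two]
  apply Complex.ext
  · simp only [Complex.mul_re, Complex.sub_re, Complex.one_re]
    linarith
  · simp only [Complex.mul_im, Complex.sub_im, Complex.one_im]
    ring

lemma rho_pow_three : rho ^ 3 = -1 := by linear_combination (rho + 1) * rho_sq

lemma rho_pow_six : rho ^ 6 = 1 := by linear_combination (rho ^ 3 - 1) * rho_pow_three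

lemma hexVertex_eq_pow (k : Fin 6) : hexVertex k = rho ^ (k : ℕ) := by
  rw [hexVertex, rho, ← Complex.exp_nat_mul]
  congr 1
  push_cast
  ring

lemma hexVertex_add (k r : Fin 6) : hexVertex (k + r) = hexVertex k * hexVertex r := by
  rw [hexVertex_eq_pow, hexVertex_eq_pow, hexVertex_eq_pow, ← pow_add, Fin.val_add,
    ← pow_eq_pow_mod _ rho_pow_six]

lemma hexVertex_zero : hexVertex 0 = 1 := by simp [hexVertex]

lemma hexVertex_add_three (k : Fin 6) : hexVertex (k + 3) = -hexVertex k := by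
  rw [hexVertex_add, hexVertex_eq_pow 3, show ((3 : Fin 6) : ℕ) = 3 from rfl, rho_pow_three,
    mul_neg_one]

lemma hexVertex_ne_zero (k : Fin 6) : hexVertex k ≠ 0 := Complex.exp_ne_zero _

lemma norm_hexVertex (k : Fin 6) : ‖hexVertex k‖ = 1 := by
  rw [hexVertex_eq_pow, norm_pow, rho, Complex.norm_exp_ofReal_mul_I, one_pow]

/-- The coordinate of `1` in the basis `1, rho` of the plane. -/
noncomputable def xCoord : ℂ →ₗ[ℝ] ℝ := Complex.reLm - (√3)⁻¹ • Complex.imLm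

/-- The coordinate of `rho` in the basis `1, rho` of the plane. -/
noncomputable def yCoord : ℂ →ₗ[ℝ] ℝ := (2 * (√3)⁻¹) • Complex.imLm

lemma xCoord_apply (z : ℂ) : xCoord z = z.re - (√3)⁻¹ * z.im := by simp [xCoord]

lemma yCoord_apply (z : ℂ) : yCoord z = 2 * (√3)⁻¹ * z.im := by simp [yCoord]

lemma xCoord_add_yCoord_mul_rho (z : ℂ) : xCoord z + yCoord z * rho = z := by
  have h3 : √3 ≠ 0 := by positivity
  rw [xCoord_apply, yCoord_apply, rho_eq]
  apply Complex.ext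
  · simp only [Complex.add_re, Complex.ofReal_re, Complex.re_ofReal_mul]
    ring
  · simp only [Complex.add_im, Complex.ofReal_im, Complex.im_ofReal_mul]
    field_simp
    ring

lemma ext_coords {z w : ℂ} (hx : xCoord z = xCoord w) (hy : yCoord z = yCoord w) : z = w := by
  rw [← xCoord_add_yCoord_mul_rho z, ← xCoord_add_yCoord_mul_rho w, hx, hy]

lemma norm_sq_eq_coords (z : ℂ) :
    ‖z‖ ^ 2 = xCoord z ^ 2 + xCoord z * yCoord z + yCoord z ^ 2 := by
  have hs : (√3)⁻¹ ^ 2 = (1 / 3 : ℝ) := by rw [inv_pow, Real.sq_sqrt (by norm_num), one_div]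
  rw [← Complex.normSq_eq_norm_sq, Complex.normSq_apply, xCoord_apply, yCoord_apply]
  linear_combination (-3 * z.im ^ 2) * hs

/-- The embedding of the Eisenstein lattice with basis `1, rho` in the plane. -/
noncomputable def eisenstein : ℤ × ℤ →+ ℂ where
  toFun p := p.1 + p.2 * rho
  map_zero' := by simp
  map_add' p q := by
    push_cast [Prod.fst_add, Prod.snd_add]
    ring

lemma xCoord_eisenstein (p : ℤ × ℤ) : xCoord (eisenstein p) = p.1 := by
  change xCoord (p.1 + p.2 * rho) = p.1
  rw [xCoord_apply, rho_eq]
  simp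
  field_simp
  ring

lemma yCoord_eisenstein (p : ℤ × ℤ) : yCoord (eisenstein p) = p.2 := by
  change yCoord (p.1 + p.2 * rho) = p.2
  rw [yCoord_apply, rho_eq]
  simp
  field_simp

/-- The coordinates of the vertices of the hexagon in the Eisenstein lattice. -/
def corner : Fin 6 → ℤ × ℤ := ![(1, 0), (0, 1), (-1, 1), (-1, 0), (0, -1), (1, -1)]

lemma eisenstein_corner (k : Fin 6) : eisenstein (corner k) = hexVertex k := by
  have h := rho_sq
  rw [hexVertex_eq_pow]
  change ((corner k).1 : ℂ) + (corner k).2 * rho = rho ^ (k : ℕ)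
  fin_cases k <;> simp [corner]
  · linear_combination -h
  · linear_combination -(rho + 1) * h
  · linear_combination -(rho ^ 2 + rho) * h
  · linear_combination -(rho ^ 3 + rho ^ 2 - 1) * h

lemma xCoord_hexVertex (k : Fin 6) : xCoord (hexVertex k) = (corner k).1 := by
  rw [← eisenstein_corner, xCoord_eisenstein]

lemma yCoord_hexVertex (k : Fin 6) : yCoord (hexVertex k) = (corner k).2 := by
  rw [← eisenstein_corner, yCoord_eisenstein]

lemma edgePoint_eq (k : Fin 6) (t : ℝ) :
    edgePoint k t = (1 - t : ℝ) * hexVertex k + t * hexVertex (k + 1) := by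
  rw [edgePoint, AffineMap.lineMap_apply_module, Complex.real_smul, Complex.real_smul]

lemma edgePoint_zero (k : Fin 6) : edgePoint k 0 = hexVertex k := by simp [edgePoint]

lemma edgePoint_one (k : Fin 6) : edgePoint k 1 = hexVertex (k + 1) := by simp [edgePoint]

lemma edgePoint_add (k r : Fin 6) (t : ℝ) :
    edgePoint (k + r) t = hexVertex r * edgePoint k t := by
  rw [edgePoint_eq, edgePoint_eq, add_right_comm, hexVertex_add k, hexVertex_add (k + 1)]
  ring

lemma convex_hexagon : Convex ℝ hexagon := convex_convexHull ℝ _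

lemma isCompact_hexagon : IsCompact hexagon :=
  (Set.finite_range hexVertex).isCompact_convexHull (𝕜 := ℝ)

lemma hexVertex_mem_hexagon (k : Fin 6) : hexVertex k ∈ hexagon :=
  subset_convexHull ℝ _ ⟨k, rfl⟩

lemma edgePoint_mem_hexagon (k : Fin 6) {t : ℝ} (ht : t ∈ Set.Icc (0 : ℝ) 1) :
    edgePoint k t ∈ hexagon :=
  convex_hexagon.lineMap_mem (hexVertex_mem_hexagon _) (hexVertex_mem_hexagon _) ht

lemma hexVertex_mul_mem_hexagon (r : Fin 6) {w : ℂ} (hw : w ∈ hexagon) :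
    hexVertex r * w ∈ hexagon := by
  refine convexHull_min ?_ (convex_hexagon.linear_preimage (LinearMap.mulLeft ℝ (hexVertex r))) hw
  rintro _ ⟨k, rfl⟩
  rw [Set.mem_preimage, LinearMap.mulLeft_apply, ← hexVertex_add]
  exact hexVertex_mem_hexagon _

lemma zero_mem_hexagon : (0 : ℂ) ∈ hexagon := by
  have h := convex_hexagon.midpoint_mem (hexVertex_mem_hexagon 0) (hexVertex_mem_hexagon (0 + 3))
  rwa [hexVertex_add_three, midpoint_self_neg] at h

lemma exists_eq_smul_hexVertex_add (w : ℂ) : ∃ (k : Fin 6) (a b : ℝ), 0 ≤ a ∧ 0 ≤ b ∧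
    w = a • hexVertex k + b • hexVertex (k + 1) := by
  set x := xCoord w with hx
  set y := yCoord w with hy
  suffices h : ∃ (k : Fin 6) (a b : ℝ), 0 ≤ a ∧ 0 ≤ b ∧
      x = a * (corner k).1 + b * (corner (k + 1)).1 ∧
      y = a * (corner k).2 + b * (corner (k + 1)).2 by
    obtain ⟨k, a, b, ha, hb, hx', hy'⟩ := h
    refine ⟨k, a, b, ha, hb, ext_coords ?_ ?_⟩
    · rw [← hx, hx', map_add, map_smul, map_smul, xCoord_hexVertex, xCoord_hexVertex]; rfl
    · rw [← hy, hy', map_add, map_smul, map_smul, yCoord_hexVertex, yCoord_hexVertex]; rfl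
  rcases le_total 0 x with h1 | h1 <;> rcases le_total 0 y with h2 | h2
  · exact ⟨0, x, y, h1, h2, by simp [corner]⟩
  · rcases le_total 0 (x + y) with h3 | h3
    · exact ⟨5, -y, x + y, by linarith, h3, by simp [corner]⟩
    · exact ⟨4, -(x + y), x, by linarith, h1, by simp [corner]⟩
  · rcases le_total 0 (x + y) with h3 | h3
    · exact ⟨1, x + y, -x, h3, by linarith, by simp [corner]⟩
    · exact ⟨2, y, -(x + y), h2, by linarith, by simp [corner]⟩
  · exact ⟨3, -x, -y, by linarith, by linarith, by simp [corner]⟩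

lemma smul_hexVertex_add_mem_hexagon (k : Fin 6) {a b : ℝ} (ha : 0 ≤ a) (hb : 0 ≤ b)
    (hab : a + b ≤ 1) : a • hexVertex k + b • hexVertex (k + 1) ∈ hexagon := by
  rcases (add_nonneg ha hb).eq_or_lt with h0 | hpos
  · obtain rfl : a = 0 := by linarith
    obtain rfl : b = 0 := by linarith
    simpa using zero_mem_hexagon
  · have hmem := convex_hexagon (hexVertex_mem_hexagon k) (hexVertex_mem_hexagon (k + 1))
      (a := a / (a + b)) (b := b / (a + b)) (by positivity) (by positivity) (by field_simp)
    convert convex_hexagon.smul_mem_of_zero_mem zero_mem_hexagon hmem ⟨hpos.le, hab⟩ using 1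
    match_scalars <;> field_simp

lemma mem_hexagon_iff {w : ℂ} :
    w ∈ hexagon ↔ |xCoord w| ≤ 1 ∧ |yCoord w| ≤ 1 ∧ |xCoord w + yCoord w| ≤ 1 := by
  have hconv (l : ℂ →ₗ[ℝ] ℝ) : Convex ℝ {w | |l w| ≤ 1} := by
    have h : {w | |l w| ≤ 1} = l ⁻¹' Set.Icc (-1) 1 := Set.ext fun w => abs_le (a := l w)
    rw [h]
    exact (convex_Icc (-1 : ℝ) 1).linear_preimage l
  refine ⟨fun hw => ?_, fun ⟨hx, hy, hs⟩ => ?_⟩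
  · refine convexHull_min ?_
      ((hconv xCoord).inter ((hconv yCoord).inter (hconv (xCoord + yCoord)))) hw
    rintro _ ⟨k, rfl⟩
    simp only [Set.mem_inter_iff, Set.mem_ofPred_eq, LinearMap.add_apply, xCoord_hexVertex,
      yCoord_hexVertex]
    norm_cast
    revert k
    decide
  · obtain ⟨k, a, b, ha, hb, rfl⟩ := exists_eq_smul_hexVertex_add w
    refine smul_hexVertex_add_mem_hexagon k ha hb ?_
    simp only [map_add, map_smul, xCoord_hexVertex, yCoord_hexVertex, smul_eq_mul, abs_le]
      at hx hy hs
    have hk : k = 0 ∨ k = 1 ∨ k = 2 ∨ k = 3 ∨ k = 4 ∨ k = 5 := by lia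
    rcases hk with rfl | rfl | rfl | rfl | rfl | rfl <;> simp [corner] at hx hy hs <;> linarith

/-! ### The honeycomb -/

/-- The translation taking the hexagon to its neighbour across the `d`-th edge. -/
def offset (d : Fin 6) : ℤ × ℤ := corner d + corner (d + 1)

lemma eisenstein_offset (d : Fin 6) : eisenstein (offset d) = hexVertex d + hexVertex (d + 1) := by
  rw [offset, map_add, eisenstein_corner, eisenstein_corner]

lemma edgePoint_add_three (d : Fin 6) (t : ℝ) :
    edgePoint (d + 3) (1 - t) = edgePoint d t - eisenstein (offset d) := by
  rw [edgePoint_eq, edgePoint_eq, eisenstein_offset, add_right_comm, hexVertex_add_three,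
    hexVertex_add_three]
  push_cast
  ring

lemma exists_eq_edgePoint_of_sub_offset_mem {w : ℂ} {d : Fin 6} (hw : w ∈ hexagon)
    (hw' : w - eisenstein (offset d) ∈ hexagon) : ∃ t ∈ Set.Icc (0 : ℝ) 1, w = edgePoint d t := by
  have hrot : hexVertex d * hexVertex (-d) = 1 := by
    rw [← hexVertex_add, add_neg_cancel, hexVertex_zero]
  set u := hexVertex (-d) * w
  have hu : u ∈ hexagon := hexVertex_mul_mem_hexagon _ hw
  have hu' : u - eisenstein (offset 0) ∈ hexagon := by
    convert hexVertex_mul_mem_hexagon (-d) hw' using 1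
    rw [eisenstein_offset, eisenstein_offset, hexVertex_zero, hexVertex_add d, zero_add]
    linear_combination (1 + hexVertex 1) * hrot
  rw [mem_hexagon_iff, map_sub, map_sub, xCoord_eisenstein, yCoord_eisenstein] at hu'
  simp only [mem_hexagon_iff, abs_le, offset, corner] at hu hu'
  norm_num at hu'
  refine ⟨yCoord u, ⟨by linarith, by linarith⟩, ?_⟩
  have hw_eq : w = hexVertex d * u := by linear_combination -w * hrot
  have hu_eq : u = edgePoint 0 (yCoord u) := by
    apply ext_coords <;>
      rw [edgePoint, AffineMap.lineMap_apply_module, map_add, map_smul, map_smul] <;>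
      simp [xCoord_hexVertex, yCoord_hexVertex, corner]
    linarith
  rw [hw_eq, hu_eq, ← edgePoint_add, zero_add, ← hu_eq]

/-- The translations that preserve the honeycomb of unit hexagons centred at `0`, as a sublattice of
the Eisenstein lattice. -/
def IsHoneycombPeriod (p : ℤ × ℤ) : Prop := 3 ∣ p.1 - p.2

instance : DecidablePred IsHoneycombPeriod := fun p =>
  inferInstanceAs (Decidable (3 ∣ p.1 - p.2))

lemma IsHoneycombPeriod.sub {p q : ℤ × ℤ} (hp : IsHoneycombPeriod p) (hq : IsHoneycombPeriod q) :
    IsHoneycombPeriod (p - q) := by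
  simpa only [IsHoneycombPeriod, Prod.fst_sub, Prod.snd_sub, sub_sub_sub_comm] using dvd_sub hp hq

lemma eq_zero_or_exists_eq_offset {p : ℤ × ℤ} (h3 : IsHoneycombPeriod p) (hx : |p.1| ≤ 2)
    (hy : |p.2| ≤ 2) (hs : |p.1 + p.2| ≤ 2) : p = 0 ∨ ∃ d, p = offset d := by
  obtain ⟨x, y⟩ := p
  simp only [IsHoneycombPeriod, abs_le] at h3 hx hy hs
  obtain ⟨x1, x2⟩ := hx
  obtain ⟨y1, y2⟩ := hy
  interval_cases x <;> interval_cases y <;> first | omega | decide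

/-- The unit hexagon centred at a point of the Eisenstein lattice. -/
def tile (c : ℤ × ℤ) : Set ℂ := {z | z - eisenstein c ∈ hexagon}

lemma isClosed_tile (c : ℤ × ℤ) : IsClosed (tile c) :=
  isCompact_hexagon.isClosed.preimage (continuous_id.sub continuous_const)

lemma locallyFinite_tile : LocallyFinite tile := by
  intro z
  have hcont (l : ℂ →ₗ[ℝ] ℝ) : Continuous l := l.continuous_of_finiteDimensional
  refine ⟨{w | xCoord w ∈ Set.Ioo (xCoord z - 1) (xCoord z + 1)} ∩
    {w | yCoord w ∈ Set.Ioo (yCoord z - 1) (yCoord z + 1)},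
    ((isOpen_Ioo.preimage (hcont xCoord)).inter (isOpen_Ioo.preimage (hcont yCoord))).mem_nhds
      ⟨⟨by linarith, by linarith⟩, by linarith, by linarith⟩,
    ((Set.finite_Icc ⌈xCoord z - 2⌉ ⌊xCoord z + 2⌋).prod
      (Set.finite_Icc ⌈yCoord z - 2⌉ ⌊yCoord z + 2⌋)).subset ?_⟩
  rintro c ⟨w, hwc, ⟨hx1, hx2⟩, hy1, hy2⟩
  obtain ⟨hx, hy, -⟩ := mem_hexagon_iff.1 hwc
  rw [map_sub, xCoord_eisenstein, abs_le] at hx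
  rw [map_sub, yCoord_eisenstein, abs_le] at hy
  exact ⟨⟨Int.ceil_le.2 (by linarith), Int.le_floor.2 (by linarith)⟩,
    Int.ceil_le.2 (by linarith), Int.le_floor.2 (by linarith)⟩

lemma eq_or_exists_edgePoint_of_mem_tile {z : ℂ} {a b : ℤ × ℤ} (hab : IsHoneycombPeriod (b - a))
    (ha : z ∈ tile a) (hb : z ∈ tile b) : b = a ∨
      ∃ d, b = a + offset d ∧ ∃ t ∈ Set.Icc (0 : ℝ) 1, z - eisenstein a = edgePoint d t := by
  have hx : xCoord z - xCoord (eisenstein a) - (xCoord z - xCoord (eisenstein b)) =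
      ((b - a).1 : ℝ) := by rw [xCoord_eisenstein, xCoord_eisenstein, Prod.fst_sub]; push_cast; ring
  have hy : yCoord z - yCoord (eisenstein a) - (yCoord z - yCoord (eisenstein b)) =
      ((b - a).2 : ℝ) := by rw [yCoord_eisenstein, yCoord_eisenstein, Prod.snd_sub]; push_cast; ring
  have ⟨hax, hay, has⟩ := mem_hexagon_iff.1 ha
  have ⟨hbx, hby, hbs⟩ := mem_hexagon_iff.1 hb
  simp only [map_sub, abs_le] at hax hay has hbx hby hbs
  have hbound {n : ℤ} (h1 : (-2 : ℝ) ≤ n) (h2 : (n : ℝ) ≤ 2) : |n| ≤ 2 :=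
    abs_le.2 ⟨by exact_mod_cast h1, by exact_mod_cast h2⟩
  rcases eq_zero_or_exists_eq_offset hab (hbound (by linarith) (by linarith))
    (hbound (by linarith) (by linarith))
    (hbound (by push_cast; linarith) (by push_cast; linarith)) with h | ⟨d, h⟩
  · exact Or.inl (sub_eq_zero.1 h)
  · obtain rfl := eq_add_of_sub_eq' h
    refine Or.inr ⟨d, rfl, exists_eq_edgePoint_of_sub_offset_mem ha ?_⟩
    rwa [sub_sub, ← map_add]

lemma exists_unitSquare_translate {a b : ℝ} (ha : a ∈ Set.Icc (0 : ℝ) 1)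
    (hb : b ∈ Set.Icc (0 : ℝ) 1) : ∃ i j : ℤ, |(a - i) + 2 * (b - j)| ≤ 1 ∧
      |(a - i) - (b - j)| ≤ 1 ∧ |2 * (a - i) + (b - j)| ≤ 1 := by
  obtain ⟨a0, a1⟩ := ha
  obtain ⟨b0, b1⟩ := hb
  simp only [abs_le]
  by_cases h0 : a + 2 * b ≤ 1 ∧ 2 * a + b ≤ 1
  · refine ⟨0, 0, ?_⟩
    norm_num
    refine ⟨⟨?_, ?_⟩, ⟨?_, ?_⟩, ?_, ?_⟩ <;> linarith
  by_cases h1 : 2 ≤ a + 2 * b ∧ 2 ≤ 2 * a + b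
  · refine ⟨1, 1, ?_⟩
    norm_num
    refine ⟨⟨?_, ?_⟩, ⟨?_, ?_⟩, ?_, ?_⟩ <;> linarith
  rw [not_and_or, not_le, not_le] at h0 h1
  rcases le_total a b with hab | hab
  · refine ⟨0, 1, ?_⟩
    norm_num
    refine ⟨⟨?_, ?_⟩, ⟨?_, ?_⟩, ?_, ?_⟩ <;> rcases h0 with h0 | h0 <;> rcases h1 with h1 | h1 <;>
      linarith
  · refine ⟨1, 0, ?_⟩
    norm_num
    refine ⟨⟨?_, ?_⟩, ⟨?_, ?_⟩, ?_, ?_⟩ <;> rcases h0 with h0 | h0 <;> rcases h1 with h1 | h1 <;>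
      linarith

lemma exists_isHoneycombPeriod_mem_tile (z : ℂ) :
    ∃ p : ℤ × ℤ, IsHoneycombPeriod p ∧ z ∈ tile p := by
  set a := (xCoord z + 2 * yCoord z) / 3 with ha
  set b := (xCoord z - yCoord z) / 3 with hb
  obtain ⟨i, j, h1, h2, h3⟩ := exists_unitSquare_translate
    (a := Int.fract a) (b := Int.fract b) ⟨Int.fract_nonneg _, (Int.fract_lt_one _).le⟩
    ⟨Int.fract_nonneg _, (Int.fract_lt_one _).le⟩
  set m := ⌊a⌋ + i with hm
  set n := ⌊b⌋ + j with hn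
  refine ⟨(m + 2 * n, m - n), ⟨n, by ring⟩, mem_hexagon_iff.2 ?_⟩
  rw [map_sub, map_sub, xCoord_eisenstein, yCoord_eisenstein]
  have hfa : Int.fract a - i = a - m := by rw [Int.fract, hm]; push_cast; ring
  have hfb : Int.fract b - j = b - n := by rw [Int.fract, hn]; push_cast; ring
  rw [hfa, hfb] at h1 h2 h3
  push_cast
  refine ⟨?_, ?_, ?_⟩
  · convert h1 using 2; rw [ha, hb]; ring
  · convert h2 using 2; rw [ha, hb]; ring
  · convert h3 using 2; rw [ha, hb]; ring

/-! ### Folding plans -/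

/-- A hexagon of the honeycomb in the plane of a facet: the facet, the hexagon that is laid there,
its position (rotation by `rot` sixths of a full turn, then translation by `center`), and the
placement of the same hexagon from which this one is reached by folding over an edge of the
polyhedron. A placement that is its own parent is the starting point of the folding of its
hexagon. -/
structure Placement (nf nh np : ℕ) where
  face : Fin nf
  hex : Fin nh
  rot : Fin 6
  center : ℤ × ℤ
  parent : Fin np

/-- Integer data describing how `nh` hexagons are wrapped around a polyhedron with `nf` facets. The
polyhedron lives in integer coordinates with the quadratic form `∑ t, weight t / den * x t ^ 2`; the
facet `k` lies in the zero set of the affine functional with coefficients `facet k`, which is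
nonnegative on the polyhedron, and `(x, y) ↦ base k + x * dirX k + y * dirY k` is a chart from the
Eisenstein lattice to its plane. The placement `home i e` shows the corner `e` of the hexagon `i` on
the polyhedron, and `innerPoint k` is a placement on the facet `k` with weights on its corners whose
barycentre is an interior point of the facet. -/
structure HexPlan (nf nh np : ℕ) where
  weight : Fin 3 → ℤ
  den : ℤ
  facet : Fin nf → Fin 4 → ℤ
  base : Fin nf → Fin 3 → ℤ
  dirX : Fin nf → Fin 3 → ℤ
  dirY : Fin nf → Fin 3 → ℤ
  partner : Fin nh × Fin 6 → Fin nh × Fin 6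
  placement : Fin np → Placement nf nh np
  home : Fin nh → Fin 6 → Fin np
  innerPoint : Fin nf → Fin np × (Fin 6 → ℤ)

/-- The linear part of an integral affine functional, whose coefficient `0` is the constant one. -/
def evalLinear (c : Fin 4 → ℤ) (x : Fin 3 → ℤ) : ℤ := c 1 * x 0 + c 2 * x 1 + c 3 * x 2

/-- The value of an integral affine functional. -/
def evalAffine (c : Fin 4 → ℤ) (x : Fin 3 → ℤ) : ℤ := c 0 + evalLinear c x

namespace HexPlan

variable {nf nh np : ℕ} (D : HexPlan nf nh np)

/-- The bilinear form of the metric, multiplied by `den`. -/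
def form (x y : Fin 3 → ℤ) : ℤ :=
  D.weight 0 * x 0 * y 0 + D.weight 1 * x 1 * y 1 + D.weight 2 * x 2 * y 2

/-- The coordinates of the corner `e` of a placed hexagon. -/
def cornerPos (p : Fin np) (e : Fin 6) (t : Fin 3) : ℤ :=
  D.base (D.placement p).face t +
    ((D.placement p).center.1 + (corner (e + (D.placement p).rot)).1) *
      D.dirX (D.placement p).face t +
    ((D.placement p).center.2 + (corner (e + (D.placement p).rot)).2) *
      D.dirY (D.placement p).face t

/-- The value of the functional of the facet `m` at the corner `e` of a placed hexagon. -/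
def cornerValue (p : Fin np) (m : Fin nf) (e : Fin 6) : ℤ :=
  evalAffine (D.facet m) (D.cornerPos p e)

/-- The corner values of the functional that is negative on the part of the hexagon which is folded
over the edge between the parent of `q` and `q`. -/
def creaseValue (q : Fin np) : Fin 6 → ℤ :=
  D.cornerValue (D.placement q).parent (D.placement q).face

/-- The difference of the placements `q` and `p` is a multiple of the functional of the facet `l` on
`p`, so that they agree where `p` meets the plane of this facet. -/
def AgreeOn (p q : Fin np) (l : Fin nf) : Prop :=
  ∃ e₀, D.cornerValue p l e₀ ≠ 0 ∧
    ∀ e t, (D.cornerPos q e t - D.cornerPos p e t) * D.cornerValue p l e₀ =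
      (D.cornerPos q e₀ t - D.cornerPos p e₀ t) * D.cornerValue p l e

instance (p q : Fin np) (l : Fin nf) : Decidable (D.AgreeOn p q l) := by
  unfold AgreeOn; infer_instance

/-- The placement `q` is the neighbour in the honeycomb of `p` across its edge `e`. -/
def IsAcross (p : Fin np) (e : Fin 6) (q : Fin np) : Prop :=
  (D.placement q).face = (D.placement p).face ∧
    (D.placement q).center = (D.placement p).center + offset (e + (D.placement p).rot)

instance (p : Fin np) (e : Fin 6) (q : Fin np) : Decidable (D.IsAcross p e q) := by
  unfold IsAcross; infer_instance

/-- The edge of the neighbour `q` of `p` across the edge `e` that is shared with `p`. -/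
def sharedEdge (p : Fin np) (e : Fin 6) (q : Fin np) : Fin 6 :=
  e + (D.placement p).rot + 3 - (D.placement q).rot

/-- A facet separates the edge `e` of the placement `p`, except perhaps one of its endpoints, from
the polyhedron. -/
def EdgeOutside (p : Fin np) (e : Fin 6) : Prop :=
  ∃ m, D.cornerValue p m e ≤ 0 ∧ D.cornerValue p m (e + 1) ≤ 0 ∧
    (D.cornerValue p m e < 0 ∨ D.cornerValue p m (e + 1) < 0)

instance (p : Fin np) (e : Fin 6) : Decidable (D.EdgeOutside p e) := by
  unfold EdgeOutside; infer_instance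

/-- The corner glued to the start of an edge by the gluing of that edge. Edges are glued with
reversed direction, so this is the end of the partner. -/
def nextCorner (x : Fin nh × Fin 6) : Fin nh × Fin 6 := ((D.partner x).1, (D.partner x).2 + 1)

/-- The combinatorial conditions under which a plan wraps its hexagons around a polyhedron. All of
them can be decided by evaluation. -/
structure Valid : Prop where
  den_pos : 0 < D.den
  weight_pos : ∀ t, 0 < D.weight t
  normal_ne_zero : ∀ k, D.facet k 1 ≠ 0 ∨ D.facet k 2 ≠ 0 ∨ D.facet k 3 ≠ 0
  isometric : ∀ k, D.form (D.dirX k) (D.dirX k) = D.den ∧ D.form (D.dirY k) (D.dirY k) = D.den ∧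
    2 * D.form (D.dirX k) (D.dirY k) = D.den
  planar : ∀ k, evalAffine (D.facet k) (D.base k) = 0 ∧
    evalLinear (D.facet k) (D.dirX k) = 0 ∧ evalLinear (D.facet k) (D.dirY k) = 0
  partner_partner : ∀ e, D.partner (D.partner e) = e
  partner_ne : ∀ e, D.partner e ≠ e
  honeycomb : ∀ p q, (D.placement p).face = (D.placement q).face →
    IsHoneycombPeriod ((D.placement q).center - (D.placement p).center)
  eq_of_center_eq : ∀ p q, (D.placement p).face = (D.placement q).face →
    (D.placement p).center = (D.placement q).center → p = q
  edge : ∀ p e, (∃ q, D.IsAcross p e q ∧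
    D.partner ((D.placement p).hex, e) = ((D.placement q).hex, D.sharedEdge p e q)) ∨
      D.EdgeOutside p e
  /-- Where a placement runs into another facet, the hexagon continues on that facet, unless this
  happens only at a corner. -/
  transfer : ∀ p l, l ≠ (D.placement p).face →
    (∃ q, (D.placement q).face = l ∧ (D.placement q).hex = (D.placement p).hex ∧
      D.AgreeOn p q l) ∨
    ∃ m, MeetsInCorner (D.cornerValue p l) (D.cornerValue p m)
  parent : ∀ q, (D.placement q).parent ≠ q → (D.placement q).parent < q ∧
    (D.placement (D.placement q).parent).hex = (D.placement q).hex ∧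
    D.AgreeOn (D.placement q).parent q (D.placement q).face
  /-- The part of a placement on the polyhedron lies beyond the crease that led to it. -/
  beyond_crease : ∀ q, (D.placement q).parent ≠ q →
    ∃ m, Dominates (-D.creaseValue q) (D.cornerValue q m)
  /-- The part of a placement on the polyhedron lies before the creases that led to later ones. -/
  before_crease : ∀ p q, p < q → (D.placement p).hex = (D.placement q).hex →
    (D.placement q).parent ≠ q ∧ ∃ m, Dominates (D.creaseValue q) (D.cornerValue p m)
  root : ∀ i, ∃ p, (D.placement p).hex = i ∧ (D.placement p).parent = p
  /-- The part of a placement between the crease that led to it and those that lead to further ones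
  lies on the polyhedron. -/
  cover : ∀ p m, (∀ e, 0 ≤ D.cornerValue p m e) ∨
    ((D.placement p).parent ≠ p ∧ Dominates (D.cornerValue p m) (-D.creaseValue p)) ∨
    ∃ q, (D.placement q).parent = p ∧ q ≠ p ∧ Dominates (D.cornerValue p m) (D.creaseValue q)
  home : ∀ i e, (D.placement (D.home i e)).hex = i ∧ ∀ m, 0 ≤ D.cornerValue (D.home i e) m e
  /-- The corners at a point follow each other by `nextCorner`, and at most three angles of `120°`
  fit around it. -/
  corners : ∀ i e i' e',
    (∀ t, D.cornerPos (D.home i e) e t = D.cornerPos (D.home i' e') e' t) →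
    (i', e') = (i, e) ∨ (i', e') = D.nextCorner (i, e) ∨
      (i', e') = D.nextCorner (D.nextCorner (i, e))
  nextCorner : ∀ x, ∀ t, D.cornerPos (D.home x.1 x.2) x.2 t =
    D.cornerPos (D.home (D.nextCorner x).1 (D.nextCorner x).2) (D.nextCorner x).2 t
  innerPoint_pos : ∀ k, (D.placement (D.innerPoint k).1).face = k ∧
    (∀ e, 0 ≤ (D.innerPoint k).2 e) ∧ 0 < ∑ e, (D.innerPoint k).2 e ∧
    ∀ m, m ≠ k → 0 < ∑ e, (D.innerPoint k).2 e * D.cornerValue (D.innerPoint k).1 m e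

/-! ### The geometry of a plan -/

/-- The length of the coordinate vector `t`. -/
noncomputable def len (t : Fin 3) : ℝ := √(D.weight t / D.den)

/-- The point of space with given coordinates. -/
noncomputable def pos : (Fin 3 → ℝ) →ₗ[ℝ] E3 where
  toFun x := WithLp.toLp 2 fun t => D.len t * x t
  map_add' x y := by ext t; simp [mul_add]
  map_smul' c x := by ext t; simp [mul_left_comm]

/-- The point of space with given integer coordinates. -/
noncomputable def latticePos (x : Fin 3 → ℤ) : E3 := D.pos fun t => (x t : ℝ)

/-- The linear part of `height m`. -/
noncomputable def slope (m : Fin nf) : E3 →ₗ[ℝ] ℝ :=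
  ∑ t : Fin 3, (D.facet m t.succ / D.len t) • (EuclideanSpace.proj t : E3 →L[ℝ] ℝ).toLinearMap

/-- The functional of the facet `m`, as an affine function on space. -/
noncomputable def height (m : Fin nf) : E3 →ᵃ[ℝ] ℝ :=
  (D.slope m).toAffineMap + AffineMap.const ℝ E3 (D.facet m 0 : ℝ)

/-- The polyhedron cut out by the facets. -/
def solid : Set E3 := {x | ∀ m, 0 ≤ D.height m x}

/-- The chart of the plane of a facet. -/
noncomputable def chart (k : Fin nf) : ℂ →ᵃ[ℝ] E3 :=
  (xCoord.smulRight (D.latticePos (D.dirX k)) +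
      yCoord.smulRight (D.latticePos (D.dirY k))).toAffineMap +
    AffineMap.const ℝ ℂ (D.latticePos (D.base k))

/-- The motion of the plane that takes the standard hexagon to the position of a placement. -/
noncomputable def motion (p : Fin np) : ℂ →ᵃ[ℝ] ℂ :=
  (LinearMap.mulLeft ℝ (hexVertex (D.placement p).rot)).toAffineMap +
    AffineMap.const ℝ ℂ (eisenstein (D.placement p).center)

/-- A placement, as a map from the plane to space. -/
noncomputable def place (p : Fin np) : ℂ →ᵃ[ℝ] E3 :=
  (D.chart (D.placement p).face).comp (D.motion p)

/-- The functional of the facet `m` on a placed hexagon. -/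
noncomputable def heightOn (p : Fin np) (m : Fin nf) : ℂ →ᵃ[ℝ] ℝ := (D.height m).comp (D.place p)

/-- The functional of the facet of `q` on the parent of `q`, which is negative on the part of the
hexagon that is folded over to `q`. -/
noncomputable def crease (q : Fin np) : ℂ →ᵃ[ℝ] ℝ :=
  D.heightOn (D.placement q).parent (D.placement q).face

variable {D}

lemma pos_apply (x : Fin 3 → ℝ) (t : Fin 3) : D.pos x t = D.len t * x t := rfl

lemma height_apply (m : Fin nf) (x : E3) : D.height m x = D.slope m x + D.facet m 0 := rfl

lemma slope_apply (m : Fin nf) (x : E3) :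
    D.slope m x = ∑ t : Fin 3, D.facet m t.succ / D.len t * x t := by
  simp [slope]

lemma chart_apply (k : Fin nf) (z : ℂ) : D.chart k z =
    xCoord z • D.latticePos (D.dirX k) + yCoord z • D.latticePos (D.dirY k) +
      D.latticePos (D.base k) := rfl

lemma motion_apply (p : Fin np) (w : ℂ) : D.motion p w =
    hexVertex (D.placement p).rot * w + eisenstein (D.placement p).center := rfl

lemma place_apply (p : Fin np) (w : ℂ) :
    D.place p w = D.chart (D.placement p).face (D.motion p w) := rfl

lemma heightOn_apply (p : Fin np) (m : Fin nf) (w : ℂ) :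
    D.heightOn p m w = D.height m (D.place p w) := rfl

lemma place_mem_solid {p : Fin np} {w : ℂ} : D.place p w ∈ D.solid ↔ ∀ m, 0 ≤ D.heightOn p m w :=
  Iff.rfl

lemma motion_hexVertex (p : Fin np) (e : Fin 6) : D.motion p (hexVertex e) =
    eisenstein ((D.placement p).center + corner (e + (D.placement p).rot)) := by
  rw [motion_apply, map_add, eisenstein_corner, hexVertex_add, mul_comm, add_comm]

lemma place_hexVertex (p : Fin np) (e : Fin 6) :
    D.place p (hexVertex e) = D.latticePos (D.cornerPos p e) := by
  rw [place_apply, motion_hexVertex, chart_apply, xCoord_eisenstein, yCoord_eisenstein]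
  simp only [latticePos, ← map_smul, ← map_add]
  congr 1
  ext t
  simp only [Pi.add_apply, Pi.smul_apply, smul_eq_mul, cornerPos, Prod.fst_add, Prod.snd_add]
  push_cast
  ring

lemma motion_mem_tile (p : Fin np) {w : ℂ} (hw : w ∈ hexagon) :
    D.motion p w ∈ tile (D.placement p).center := by
  rw [tile, Set.mem_ofPred_eq, motion_apply, add_sub_cancel_right]
  exact hexVertex_mul_mem_hexagon _ hw

lemma exists_motion_eq (p : Fin np) {z : ℂ} (hz : z ∈ tile (D.placement p).center) :
    ∃ w ∈ hexagon, D.motion p w = z :=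
  ⟨_, hexVertex_mul_mem_hexagon (-(D.placement p).rot) hz, by
    rw [motion_apply, ← mul_assoc, ← hexVertex_add, add_neg_cancel, hexVertex_zero, one_mul,
      sub_add_cancel]⟩

lemma motion_injective (p : Fin np) : Function.Injective (D.motion p) := fun _ _ h =>
  mul_left_cancel₀ (hexVertex_ne_zero _) (add_right_cancel h)

lemma motion_edgePoint (p : Fin np) (e : Fin 6) (t : ℝ) : D.motion p (edgePoint e t) =
    edgePoint (e + (D.placement p).rot) t + eisenstein (D.placement p).center := by
  rw [motion_apply, edgePoint_add]

lemma IsAcross.motion_sharedEdge {p q : Fin np} {e : Fin 6} (h : D.IsAcross p e q) (t : ℝ) :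
    D.motion q (edgePoint (D.sharedEdge p e q) (1 - t)) = D.motion p (edgePoint e t) := by
  rw [motion_edgePoint, motion_edgePoint, sharedEdge, sub_add_cancel, edgePoint_add_three, h.2,
    map_add]
  ring

lemma IsAcross.place_sharedEdge {p q : Fin np} {e : Fin 6} (h : D.IsAcross p e q) (t : ℝ) :
    D.place q (edgePoint (D.sharedEdge p e q) (1 - t)) = D.place p (edgePoint e t) := by
  rw [place_apply, place_apply, h.1, h.motion_sharedEdge]

namespace Valid

lemma weight_div_den_pos (hD : D.Valid) (t : Fin 3) : (0 : ℝ) < D.weight t / D.den :=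
  div_pos (by exact_mod_cast hD.weight_pos t) (by exact_mod_cast hD.den_pos)

lemma len_pos (hD : D.Valid) (t : Fin 3) : 0 < D.len t :=
  Real.sqrt_pos.2 (hD.weight_div_den_pos t)

lemma len_mul_self (hD : D.Valid) (t : Fin 3) : D.len t * D.len t = D.weight t / D.den :=
  Real.mul_self_sqrt (hD.weight_div_den_pos t).le

lemma latticePos_injective (hD : D.Valid) : Function.Injective D.latticePos := by
  intro x y h
  ext t
  have ht : (x t : ℝ) = y t :=
    mul_left_cancel₀ (hD.len_pos t).ne' (congrArg (fun v : E3 => v t) h)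
  exact_mod_cast ht

lemma slope_pos (hD : D.Valid) (m : Fin nf) (x : Fin 3 → ℝ) :
    D.slope m (D.pos x) = ∑ t : Fin 3, D.facet m t.succ * x t := by
  rw [slope_apply]
  refine Finset.sum_congr rfl fun t _ => ?_
  rw [pos_apply, ← mul_assoc, div_mul_cancel₀ _ (hD.len_pos t).ne']

lemma slope_latticePos (hD : D.Valid) (m : Fin nf) (x : Fin 3 → ℤ) :
    D.slope m (D.latticePos x) = evalLinear (D.facet m) x := by
  rw [latticePos, hD.slope_pos, Fin.sum_univ_three, evalLinear]
  push_cast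
  rfl

lemma height_latticePos (hD : D.Valid) (m : Fin nf) (x : Fin 3 → ℤ) :
    D.height m (D.latticePos x) = evalAffine (D.facet m) x := by
  rw [height_apply, hD.slope_latticePos, evalAffine, add_comm, Int.cast_add]

lemma heightOn_hexVertex (hD : D.Valid) (p : Fin np) (m : Fin nf) (e : Fin 6) :
    D.heightOn p m (hexVertex e) = D.cornerValue p m e := by
  rw [heightOn_apply, place_hexVertex, hD.height_latticePos, cornerValue]

lemma crease_hexVertex (hD : D.Valid) (q : Fin np) (e : Fin 6) :
    D.crease q (hexVertex e) = D.creaseValue q e := hD.heightOn_hexVertex _ _ e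

lemma neg_crease_hexVertex (hD : D.Valid) (q : Fin np) (e : Fin 6) :
    (-D.crease q) (hexVertex e) = ((-D.creaseValue q) e : ℤ) := by
  rw [Pi.neg_apply, Int.cast_neg, ← hD.crease_hexVertex]
  rfl

lemma height_chart_self (hD : D.Valid) (k : Fin nf) (z : ℂ) : D.height k (D.chart k z) = 0 := by
  obtain ⟨hbase, hX, hY⟩ := hD.planar k
  have h : D.height k (D.latticePos (D.base k)) = 0 := by
    rw [hD.height_latticePos, hbase, Int.cast_zero]
  rw [height_apply] at h
  rw [chart_apply, height_apply, map_add, map_add, map_smul, map_smul, hD.slope_latticePos,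
    hD.slope_latticePos, hX, hY, add_assoc, h]
  simp

lemma heightOn_self (hD : D.Valid) (p : Fin np) (w : ℂ) :
    D.heightOn p (D.placement p).face w = 0 := hD.height_chart_self _ _

lemma inner_latticePos (hD : D.Valid) (x y : Fin 3 → ℤ) :
    inner ℝ (D.latticePos x) (D.latticePos y) = (D.form x y : ℝ) / D.den := by
  have hcoord (t : Fin 3) : inner ℝ (D.latticePos x t) (D.latticePos y t) =
      (D.weight t * x t * y t : ℝ) / D.den := by
    rw [latticePos, latticePos, pos_apply, pos_apply, RCLike.inner_apply, conj_trivial,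
      mul_mul_mul_comm, hD.len_mul_self]
    ring
  rw [PiLp.inner_apply, Fin.sum_univ_three, hcoord, hcoord, hcoord, form]
  push_cast
  ring

lemma norm_chart_sub (hD : D.Valid) (k : Fin nf) (z w : ℂ) :
    ‖D.chart k z - D.chart k w‖ = ‖z - w‖ := by
  have hden : (D.den : ℝ) ≠ 0 := by exact_mod_cast hD.den_pos.ne'
  obtain ⟨hX, hY, hXY⟩ := hD.isometric k
  have nX : ‖D.latticePos (D.dirX k)‖ ^ 2 = 1 := by
    rw [← real_inner_self_eq_norm_sq, hD.inner_latticePos, hX, div_self hden]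
  have nY : ‖D.latticePos (D.dirY k)‖ ^ 2 = 1 := by
    rw [← real_inner_self_eq_norm_sq, hD.inner_latticePos, hY, div_self hden]
  have iXY : inner ℝ (D.latticePos (D.dirX k)) (D.latticePos (D.dirY k)) = (1 / 2 : ℝ) := by
    rw [hD.inner_latticePos, div_eq_div_iff hden two_ne_zero, mul_comm, one_mul]
    exact_mod_cast hXY
  have hsub : D.chart k z - D.chart k w = xCoord (z - w) • D.latticePos (D.dirX k) +
      yCoord (z - w) • D.latticePos (D.dirY k) := by
    rw [chart_apply, chart_apply, map_sub, map_sub]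
    module
  refine (sq_eq_sq₀ (norm_nonneg _) (norm_nonneg _)).1 ?_
  rw [norm_sq_eq_coords, hsub, norm_add_sq_real, norm_smul, norm_smul, mul_pow, mul_pow, nX, nY,
    real_inner_smul_left, real_inner_smul_right, iXY, Real.norm_eq_abs, Real.norm_eq_abs, sq_abs,
    sq_abs]
  ring

lemma isometry_chart (hD : D.Valid) (k : Fin nf) : Isometry (D.chart k) :=
  Isometry.of_dist_eq fun z w => by rw [dist_eq_norm, dist_eq_norm, hD.norm_chart_sub]

lemma dist_place (hD : D.Valid) (p : Fin np) (z w : ℂ) :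
    dist (D.place p z) (D.place p w) = dist z w := by
  rw [place_apply, place_apply, (hD.isometry_chart _).dist_eq, motion_apply, motion_apply,
    dist_add_right, dist_eq_norm, ← mul_sub, norm_mul, norm_hexVertex, one_mul, dist_eq_norm]

/-! ### Folding a hexagon -/

lemma place_eq_of_agreeOn (hD : D.Valid) {p q : Fin np} {l : Fin nf} (h : D.AgreeOn p q l) {w : ℂ}
    (hw : w ∈ hexagon) (hl : D.heightOn p l w = 0) : D.place q w = D.place p w := by
  obtain ⟨e₀, hne, h⟩ := h
  let displacement : ℂ →ᵃ[ℝ] E3 := (D.cornerValue p l e₀ : ℝ) • (D.place q - D.place p)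
  let multiple : ℂ →ᵃ[ℝ] E3 := (LinearMap.toSpanSingleton ℝ E3
    (D.place q (hexVertex e₀) - D.place p (hexVertex e₀))).toAffineMap.comp (D.heightOn p l)
  have heq : Set.EqOn displacement multiple (Set.range hexVertex) := by
    rintro _ ⟨e, rfl⟩
    change (D.cornerValue p l e₀ : ℝ) • (D.place q (hexVertex e) - D.place p (hexVertex e)) =
      D.heightOn p l (hexVertex e) • (D.place q (hexVertex e₀) - D.place p (hexVertex e₀))
    rw [hD.heightOn_hexVertex]
    simp only [place_hexVertex, latticePos, ← map_sub, ← map_smul]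
    congr 1
    ext t
    have ht : ((D.cornerPos q e t - D.cornerPos p e t : ℝ) * D.cornerValue p l e₀) =
        (D.cornerPos q e₀ t - D.cornerPos p e₀ t) * D.cornerValue p l e := by exact_mod_cast h e t
    simpa only [Pi.smul_apply, Pi.sub_apply, smul_eq_mul, mul_comm] using ht
  have hzero : (D.cornerValue p l e₀ : ℝ) • (D.place q w - D.place p w) =
      D.heightOn p l w • (D.place q (hexVertex e₀) - D.place p (hexVertex e₀)) :=
    AffineMap.eqOn_affineSpan heq (convexHull_subset_affineSpan _ hw)
  rw [hl, zero_smul] at hzero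
  exact sub_eq_zero.1 ((smul_eq_zero.1 hzero).resolve_left (by exact_mod_cast hne))

lemma place_eq_place_parent (hD : D.Valid) {p q : Fin np} (hpq : p < q)
    (hhex : (D.placement p).hex = (D.placement q).hex) {w : ℂ} (hw : w ∈ hexagon)
    (hp : D.place p w ∈ D.solid) (hq : D.place q w ∈ D.solid) :
    D.place q w = D.place (D.placement q).parent w := by
  obtain ⟨hne, m, hm⟩ := hD.before_crease p q hpq hhex
  obtain ⟨m', hm'⟩ := hD.beyond_crease q hne
  have hbefore : 0 ≤ D.crease q w :=
    hm.nonneg (hD.crease_hexVertex q) (hD.heightOn_hexVertex p m) hw (hp m)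
  have hbeyond : 0 ≤ (-D.crease q) w :=
    hm'.nonneg (hD.neg_crease_hexVertex q) (hD.heightOn_hexVertex q m') hw (hq m')
  exact hD.place_eq_of_agreeOn (hD.parent q hne).2.2 hw
    (le_antisymm (neg_nonneg.1 hbeyond) hbefore)

lemma place_eq_place (hD : D.Valid) {w : ℂ} (hw : w ∈ hexagon) (p q : Fin np)
    (hhex : (D.placement p).hex = (D.placement q).hex) (hp : D.place p w ∈ D.solid)
    (hq : D.place q w ∈ D.solid) : D.place p w = D.place q w := by
  induction hN : (p : ℕ) + q using Nat.strong_induction_on generalizing p q with | _ N ih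
  wlog hlt : p < q generalizing p q
  · obtain rfl | hlt' := (not_lt.1 hlt).eq_or_lt
    · rfl
    · exact (this q p hhex.symm hq hp (by rw [add_comm, hN]) hlt').symm
  obtain ⟨hparent, hhex', -⟩ := hD.parent q (hD.before_crease p q hlt hhex).1
  have hfold := hD.place_eq_place_parent hlt hhex hw hp hq
  rw [hfold]
  exact ih _ (hN ▸ Nat.add_lt_add_left hparent _) p _ (hhex.trans hhex'.symm) hp (hfold ▸ hq) rfl

lemma exists_crease_neg (hD : D.Valid) {p : Fin np} {w : ℂ} (hw : w ∈ hexagon)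
    (hreach : (D.placement p).parent = p ∨ D.crease p w < 0) (hp : D.place p w ∉ D.solid) :
    ∃ q, (D.placement q).parent = p ∧ q ≠ p ∧ D.crease q w < 0 := by
  obtain ⟨m, hm⟩ := not_forall.1 hp
  rcases hD.cover p m with hpos | ⟨hne, hdom⟩ | ⟨q, hq, hqp, hdom⟩
  · refine (hm ?_).elim
    refine convexHull_min ?_ ((convex_Ici (0 : ℝ)).affine_preimage (D.heightOn p m)) hw
    rintro _ ⟨e, rfl⟩
    rw [Set.mem_preimage, Set.mem_Ici, hD.heightOn_hexVertex]
    exact_mod_cast hpos e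
  · exact (hm (hdom.nonneg (hD.heightOn_hexVertex p m) (hD.neg_crease_hexVertex p) hw
      (neg_nonneg.2 (hreach.resolve_left hne).le))).elim
  · exact ⟨q, hq, hqp, lt_of_not_ge fun hnonneg => hm
      (hdom.nonneg (hD.heightOn_hexVertex p m) (hD.crease_hexVertex q) hw hnonneg)⟩

lemma exists_place_mem_solid (hD : D.Valid) (i : Fin nh) {w : ℂ} (hw : w ∈ hexagon) :
    ∃ p, (D.placement p).hex = i ∧ D.place p w ∈ D.solid := by
  let reached : Set (Fin np) :=
    {p | (D.placement p).hex = i ∧ ((D.placement p).parent = p ∨ D.crease p w < 0)}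
  obtain ⟨r, hr, hroot⟩ := hD.root i
  obtain ⟨p, ⟨hi, hreach⟩, hmax⟩ :=
    reached.exists_max_image id reached.toFinite ⟨r, hr, Or.inl hroot⟩
  refine ⟨p, hi, by_contra fun hp => ?_⟩
  obtain ⟨q, rfl, hne, hneg⟩ := hD.exists_crease_neg hw hreach hp
  obtain ⟨hlt, hhex, -⟩ := hD.parent q hne.symm
  exact hlt.not_ge (hmax q ⟨hhex.symm.trans hi, Or.inr hneg⟩)

end Valid

variable (D) in
open Classical in
/-- The folding of the hexagon `i`: a point goes where any placement puts it on the polyhedron. -/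
noncomputable def fold (i : Fin nh) (w : ℂ) : E3 :=
  if h : ∃ p, (D.placement p).hex = i ∧ D.place p w ∈ D.solid then D.place h.choose w else 0

namespace Valid

lemma fold_eq (hD : D.Valid) {w : ℂ} (hw : w ∈ hexagon) {p : Fin np}
    (hp : D.place p w ∈ D.solid) : D.fold (D.placement p).hex w = D.place p w := by
  have h : ∃ q, (D.placement q).hex = (D.placement p).hex ∧ D.place q w ∈ D.solid := ⟨p, rfl, hp⟩
  rw [fold, dif_pos h]
  exact hD.place_eq_place hw _ _ h.choose_spec.1 h.choose_spec.2 hp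

lemma isFolding_fold (hD : D.Valid) (i : Fin nh) : IsFolding (D.fold i) := by
  refine ⟨(fun p => {w ∈ hexagon | D.place p w ∈ D.solid}) '' {p | (D.placement p).hex = i},
    (Set.toFinite _).image _, Set.Subset.antisymm ?_ fun w hw => ?_, ?_⟩
  · rintro w ⟨_, ⟨p, -, rfl⟩, hw⟩
    exact hw.1
  · obtain ⟨p, hp, hpw⟩ := hD.exists_place_mem_solid i hw
    exact ⟨_, ⟨p, hp, rfl⟩, hw, hpw⟩
  · rintro _ ⟨p, rfl, rfl⟩
    refine ⟨?_, ?_⟩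
    · obtain ⟨t, ht, heq⟩ := exists_finite_convexHull_inter_halfSpaces (D.heightOn p)
        (Set.finite_range hexVertex) Finset.univ
      refine ⟨t, ht, heq ▸ ?_⟩
      ext w
      simp [hexagon, place_mem_solid]
    · rintro x ⟨hx, hxs⟩ y ⟨hy, hys⟩
      rw [hD.fold_eq hx hxs, hD.fold_eq hy hys, hD.dist_place]

/-! ### Gluing the hexagons -/

end Valid

variable (D) in
/-- The gluing of the hexagons described by a plan. -/
def gluing (hD : D.Valid) : HexGluing nh where
  partner := D.partner
  partner_partner := hD.partner_partner
  partner_ne := hD.partner_ne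

namespace Valid

lemma glued_nextCorner (hD : D.Valid) (x : Fin nh × Fin 6) : (D.gluing hD).Glued
    (x.1, hexVertex x.2) ((D.nextCorner x).1, hexVertex (D.nextCorner x).2) := by
  refine Relation.EqvGen.rel _ _ ⟨x, 0, ⟨le_rfl, zero_le_one⟩, ?_, ?_⟩
  · rw [edgePoint_zero]
  · rw [sub_zero, edgePoint_one]
    rfl

lemma fold_hexVertex (hD : D.Valid) (i : Fin nh) (e : Fin 6) :
    D.fold i (hexVertex e) = D.latticePos (D.cornerPos (D.home i e) e) := by
  obtain ⟨hi, hpos⟩ := hD.home i e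
  have hmem : D.place (D.home i e) (hexVertex e) ∈ D.solid := place_mem_solid.2 fun m => by
    rw [hD.heightOn_hexVertex]
    exact_mod_cast hpos m
  have hfold := hD.fold_eq (hexVertex_mem_hexagon e) hmem
  rwa [hi, place_hexVertex] at hfold

lemma glued_of_fold_hexVertex_eq (hD : D.Valid) {i i' : Fin nh} {e e' : Fin 6}
    (h : D.fold i (hexVertex e) = D.fold i' (hexVertex e')) :
    (D.gluing hD).Glued (i, hexVertex e) (i', hexVertex e') := by
  rw [hD.fold_hexVertex, hD.fold_hexVertex] at h
  have hnext := hD.glued_nextCorner (i, e)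
  have hnext' := hD.glued_nextCorner (D.nextCorner (i, e))
  rcases hD.corners i e i' e' (congrFun (hD.latticePos_injective h)) with hx | hx | hx
  · obtain ⟨rfl, rfl⟩ := Prod.mk.inj hx
    exact Relation.EqvGen.refl _
  · rwa [← hx] at hnext
  · rw [← hx] at hnext'
    exact hnext.trans _ _ _ hnext'

lemma fold_nextCorner (hD : D.Valid) (x : Fin nh × Fin 6) :
    D.fold x.1 (hexVertex x.2) = D.fold (D.nextCorner x).1 (hexVertex (D.nextCorner x).2) := by
  rw [hD.fold_hexVertex, hD.fold_hexVertex]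
  congr 1
  ext t
  exact hD.nextCorner x t

lemma heightOn_edgePoint (hD : D.Valid) (p : Fin np) (m : Fin nf) (e : Fin 6) (t : ℝ) :
    D.heightOn p m (edgePoint e t) =
      (1 - t) * D.cornerValue p m e + t * D.cornerValue p m (e + 1) := by
  rw [edgePoint, AffineMap.apply_lineMap, AffineMap.lineMap_apply_module, hD.heightOn_hexVertex,
    hD.heightOn_hexVertex, smul_eq_mul, smul_eq_mul]

lemma eq_zero_or_eq_one_of_edgeOutside (hD : D.Valid) {p : Fin np} {e : Fin 6}
    (hout : D.EdgeOutside p e) {t : ℝ} (ht : t ∈ Set.Icc (0 : ℝ) 1)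
    (hs : D.place p (edgePoint e t) ∈ D.solid) : t = 0 ∨ t = 1 := by
  obtain ⟨m, hstart, hend, hneg⟩ := hout
  by_contra! hne
  have ht0 : 0 < t := ht.1.lt_of_ne' hne.1
  have ht1 : 0 < 1 - t := sub_pos.2 (ht.2.lt_of_ne hne.2)
  have hstart' : (D.cornerValue p m e : ℝ) ≤ 0 := by exact_mod_cast hstart
  have hend' : (D.cornerValue p m (e + 1) : ℝ) ≤ 0 := by exact_mod_cast hend
  have hpos := place_mem_solid.1 hs m
  rw [hD.heightOn_edgePoint] at hpos
  rcases hneg with hneg | hneg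
  · have hneg' : (D.cornerValue p m e : ℝ) < 0 := by exact_mod_cast hneg
    nlinarith
  · have hneg' : (D.cornerValue p m (e + 1) : ℝ) < 0 := by exact_mod_cast hneg
    nlinarith

lemma fold_eq_of_step (hD : D.Valid) {x y : Fin nh × ℂ} (h : (D.gluing hD).Step x y) :
    D.fold x.1 x.2 = D.fold y.1 y.2 := by
  obtain ⟨⟨i, e⟩, t, ht, rfl, rfl⟩ := h
  have ht' : 1 - t ∈ Set.Icc (0 : ℝ) 1 := ⟨by linarith [ht.2], by linarith [ht.1]⟩
  obtain ⟨p, rfl, hp⟩ := hD.exists_place_mem_solid i (edgePoint_mem_hexagon e ht)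
  change D.fold _ (edgePoint e t) = D.fold (D.partner ((D.placement p).hex, e)).1
    (edgePoint (D.partner ((D.placement p).hex, e)).2 (1 - t))
  rcases hD.edge p e with ⟨q, hacross, hpartner⟩ | hout
  · have hplace := hacross.place_sharedEdge t
    rw [hpartner, hD.fold_eq (edgePoint_mem_hexagon e ht) hp,
      hD.fold_eq (edgePoint_mem_hexagon _ ht') (hplace ▸ hp), hplace]
  rcases hD.eq_zero_or_eq_one_of_edgeOutside hout ht hp with rfl | rfl
  · rw [edgePoint_zero, sub_zero, edgePoint_one]
    exact hD.fold_nextCorner ((D.placement p).hex, e)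
  · rw [edgePoint_one, sub_self, edgePoint_zero]
    have hnext := hD.fold_nextCorner (D.partner ((D.placement p).hex, e))
    rw [HexPlan.nextCorner, hD.partner_partner] at hnext
    exact hnext.symm

lemma fold_eq_of_glued (hD : D.Valid) {x y : Fin nh × ℂ} (h : (D.gluing hD).Glued x y) :
    D.fold x.1 x.2 = D.fold y.1 y.2 := by
  induction h with
  | rel _ _ hstep => exact hD.fold_eq_of_step hstep
  | refl => rfl
  | symm _ _ _ ih => exact ih.symm
  | trans _ _ _ _ _ ih ih' => exact ih.trans ih'

lemma eq_or_exists_edgePoint_of_place_eq (hD : D.Valid) {p q : Fin np}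
    (hface : (D.placement p).face = (D.placement q).face) {w w' : ℂ} (hw : w ∈ hexagon)
    (hw' : w' ∈ hexagon) (h : D.place p w = D.place q w') :
    p = q ∧ w = w' ∨ ∃ e, D.IsAcross p e q ∧ ∃ t ∈ Set.Icc (0 : ℝ) 1,
      w = edgePoint e t ∧ w' = edgePoint (D.sharedEdge p e q) (1 - t) := by
  rw [place_apply, place_apply, ← hface] at h
  have hmotion : D.motion p w = D.motion q w' := (hD.isometry_chart _).injective h
  rcases eq_or_exists_edgePoint_of_mem_tile (hD.honeycomb p q hface) (motion_mem_tile p hw)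
    (hmotion ▸ motion_mem_tile q hw') with hcenter | ⟨d, hcenter, t, ht, hedge⟩
  · obtain rfl := hD.eq_of_center_eq p q hface hcenter.symm
    exact Or.inl ⟨rfl, motion_injective p hmotion⟩
  · have hacross : D.IsAcross p (d - (D.placement p).rot) q :=
      ⟨hface.symm, by rw [sub_add_cancel, hcenter]⟩
    have hwt : w = edgePoint (d - (D.placement p).rot) t := motion_injective p <| by
      rw [motion_edgePoint, sub_add_cancel, ← hedge, sub_add_cancel]
    refine Or.inr ⟨_, hacross, t, ht, hwt, motion_injective (D := D) q ?_⟩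
    rw [hacross.motion_sharedEdge, ← hwt, hmotion]

lemma glued_of_isAcross (hD : D.Valid) {p q : Fin np} {e : Fin 6} (hacross : D.IsAcross p e q)
    {t : ℝ} (ht : t ∈ Set.Icc (0 : ℝ) 1) (hp : D.place p (edgePoint e t) ∈ D.solid) :
    (D.gluing hD).Glued ((D.placement p).hex, edgePoint e t)
      ((D.placement q).hex, edgePoint (D.sharedEdge p e q) (1 - t)) := by
  have ht' : 1 - t ∈ Set.Icc (0 : ℝ) 1 := ⟨by linarith [ht.2], by linarith [ht.1]⟩
  rcases hD.edge p e with ⟨q', hacross', hpartner⟩ | hout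
  · obtain rfl : q' = q := hD.eq_of_center_eq q' q (hacross'.1.trans hacross.1.symm)
      (hacross'.2.trans hacross.2.symm)
    refine Relation.EqvGen.rel _ _ ⟨((D.placement p).hex, e), t, ht, rfl, ?_⟩
    change _ = ((D.partner _).1, edgePoint (D.partner _).2 (1 - t))
    rw [hpartner]
  · have hplace := hacross.place_sharedEdge t
    have hfold : D.fold (D.placement p).hex (edgePoint e t) =
        D.fold (D.placement q).hex (edgePoint (D.sharedEdge p e q) (1 - t)) := by
      rw [hD.fold_eq (edgePoint_mem_hexagon e ht) hp,
        hD.fold_eq (edgePoint_mem_hexagon _ ht') (hplace ▸ hp), hplace]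
    rcases hD.eq_zero_or_eq_one_of_edgeOutside hout ht hp with rfl | rfl
    · rw [edgePoint_zero, sub_zero, edgePoint_one] at hfold ⊢
      exact hD.glued_of_fold_hexVertex_eq hfold
    · rw [edgePoint_one, sub_self, edgePoint_zero] at hfold ⊢
      exact hD.glued_of_fold_hexVertex_eq hfold

lemma glued_of_face_eq (hD : D.Valid) {p q : Fin np}
    (hface : (D.placement p).face = (D.placement q).face) {w w' : ℂ} (hw : w ∈ hexagon)
    (hw' : w' ∈ hexagon) (hp : D.place p w ∈ D.solid) (h : D.place p w = D.place q w') :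
    (D.gluing hD).Glued ((D.placement p).hex, w) ((D.placement q).hex, w') := by
  rcases hD.eq_or_exists_edgePoint_of_place_eq hface hw hw' h with
    ⟨rfl, rfl⟩ | ⟨e, hacross, t, ht, rfl, rfl⟩
  · exact Relation.EqvGen.refl _
  · exact hD.glued_of_isAcross hacross ht hp

lemma exists_transfer_or_corner (hD : D.Valid) {p : Fin np} {l : Fin nf}
    (hl : l ≠ (D.placement p).face) {w : ℂ} (hw : w ∈ hexagon) (hp : D.place p w ∈ D.solid)
    (h0 : D.heightOn p l w = 0) :
    (∃ q, (D.placement q).face = l ∧ (D.placement q).hex = (D.placement p).hex ∧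
      D.place q w = D.place p w) ∨ ∃ e, w = hexVertex e := by
  rcases hD.transfer p l hl with ⟨q, hface, hhex, hagree⟩ | ⟨m, hm⟩
  · exact Or.inl ⟨q, hface, hhex, hD.place_eq_of_agreeOn hagree hw h0⟩
  · exact Or.inr (hm.exists_eq (hD.heightOn_hexVertex p l) (hD.heightOn_hexVertex p m) hw h0
      (place_mem_solid.1 hp m))

lemma glued_of_place_eq (hD : D.Valid) {p q : Fin np} {w w' : ℂ} (hw : w ∈ hexagon)
    (hw' : w' ∈ hexagon) (hp : D.place p w ∈ D.solid) (h : D.place p w = D.place q w') :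
    (D.gluing hD).Glued ((D.placement p).hex, w) ((D.placement q).hex, w') := by
  by_cases hface : (D.placement p).face = (D.placement q).face
  · exact hD.glued_of_face_eq hface hw hw' hp h
  have hq : D.place q w' ∈ D.solid := h ▸ hp
  rcases hD.exists_transfer_or_corner (Ne.symm hface) hw hp
    (by rw [heightOn_apply, h, ← heightOn_apply, hD.heightOn_self]) with
    ⟨p', hface', hhex, hplace⟩ | ⟨e, rfl⟩
  · exact hhex ▸ hD.glued_of_face_eq hface' hw hw' (hplace ▸ hp) (hplace.trans h)
  rcases hD.exists_transfer_or_corner hface hw' hq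
    (by rw [heightOn_apply, ← h, ← heightOn_apply, hD.heightOn_self]) with
    ⟨q', hface', hhex, hplace⟩ | ⟨e', rfl⟩
  · exact hhex ▸ hD.glued_of_face_eq hface'.symm hw hw' hp (h.trans hplace.symm)
  · exact hD.glued_of_fold_hexVertex_eq (by rw [hD.fold_eq hw hp, hD.fold_eq hw' hq, h])

lemma fold_eq_iff_glued (hD : D.Valid) {i j : Fin nh} {w w' : ℂ} (hw : w ∈ hexagon)
    (hw' : w' ∈ hexagon) : D.fold i w = D.fold j w' ↔ (D.gluing hD).Glued (i, w) (j, w') := by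
  refine ⟨fun h => ?_, fun h => hD.fold_eq_of_glued h⟩
  obtain ⟨p, rfl, hp⟩ := hD.exists_place_mem_solid i hw
  obtain ⟨q, rfl, hq⟩ := hD.exists_place_mem_solid j hw'
  rw [hD.fold_eq hw hp, hD.fold_eq hw' hq] at h
  exact hD.glued_of_place_eq hw hw' hp h

end Valid

end HexPlan

/-! ### Half-spaces -/

lemma frontier_setOf_forall_affineMap_nonneg {E ι : Type*} [NormedAddCommGroup E]
    [NormedSpace ℝ E] [FiniteDimensional ℝ E] [Finite ι] {φ : ι → E →ᵃ[ℝ] ℝ}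
    (hφ : ∀ i, (φ i).linear ≠ 0) :
    frontier {x | ∀ i, 0 ≤ φ i x} = {x | (∀ i, 0 ≤ φ i x) ∧ ∃ i, φ i x = 0} := by
  have hcont (i : ι) : Continuous (φ i) := (φ i).continuous_of_finiteDimensional
  have hopen (i : ι) : IsOpenMap (φ i) := AffineMap.isOpenMap_linear_iff.1
    ((φ i).linear.isOpenMap_of_finiteDimensional (LinearMap.surjective (hφ i)))
  have hinter : {x | ∀ i, 0 ≤ φ i x} = ⋂ i, φ i ⁻¹' Set.Ici 0 := by ext; simp
  have hclosed : IsClosed {x | ∀ i, 0 ≤ φ i x} := by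
    rw [hinter]
    exact isClosed_iInter fun i => isClosed_Ici.preimage (hcont i)
  rw [hclosed.frontier_eq, hinter, interior_iInter_of_finite]
  simp only [← (hopen _).preimage_interior_eq_interior_preimage (hcont _), interior_Ici]
  ext x
  simp only [Set.mem_sdiff, Set.mem_iInter, Set.mem_preimage, Set.mem_Ici, Set.mem_Ioi,
    Set.mem_ofPred_eq, not_forall, not_lt]
  exact and_congr_right fun hx => exists_congr fun i =>
    ⟨fun h => le_antisymm h (hx i), fun h => h.le⟩

lemma exists_affineMap_eq_of_finrank_eq {K V W : Type*} [Field K] [AddCommGroup V] [Module K V]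
    [AddCommGroup W] [Module K W]
    (hdim : Module.finrank K W = Module.finrank K V + 1) {f : V →ᵃ[K] W}
    (hf : Function.Injective f) {φ : W →ᵃ[K] K} (hφ : φ.linear ≠ 0) (hφf : ∀ v, φ (f v) = 0) {x : W}
    (hx : φ x = 0) : ∃ v, f v = x := by
  have : FiniteDimensional K W := Module.finite_of_finrank_pos (by lia)
  have hker : LinearMap.range f.linear = LinearMap.ker φ.linear := by
    refine Submodule.eq_of_le_of_finrank_eq ?_ ?_
    · rintro _ ⟨v, rfl⟩
      have hv : f.linear v = f v - f 0 := by simp [f.decomp']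
      rw [LinearMap.mem_ker, hv, ← vsub_eq_sub, AffineMap.linearMap_vsub, hφf, hφf, vsub_self]
    · have hrank := Module.Dual.finrank_ker_add_one_of_ne_zero hφ
      have hrange := LinearMap.finrank_range_of_inj (f.linear_injective_iff.2 hf)
      lia
  have hmem : x - f 0 ∈ LinearMap.range f.linear := by
    rw [hker, LinearMap.mem_ker, ← vsub_eq_sub, AffineMap.linearMap_vsub, hx, hφf, vsub_self]
  obtain ⟨v, hv⟩ := hmem
  exact ⟨v, by rw [f.decomp]; simp [hv]⟩

lemma map_centerMass {K E F ι : Type*} [Field K] [AddCommGroup E] [Module K E] [AddCommGroup F]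
    [Module K F] (φ : E →ᵃ[K] F) {s : Finset ι} {c : ι → K} (hc : ∑ i ∈ s, c i ≠ 0) (v : ι → E) :
    φ (s.centerMass c v) = s.centerMass c (φ ∘ v) := by
  have hφ (x : E) : φ x = φ.linear x + φ 0 := congrFun φ.decomp x
  simp only [Finset.centerMass, Function.comp_apply, hφ (v _), smul_add, Finset.sum_add_distrib,
    ← Finset.sum_smul, smul_smul, inv_mul_cancel₀ hc, one_smul]
  rw [hφ, map_smul, map_sum]
  simp only [map_smul]

/-! ### The hexagons cover the polyhedron -/

namespace HexPlan

variable {nf nh np : ℕ} {D : HexPlan nf nh np}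

/-- The interior of a facet, in its chart. -/
def openFacet (D : HexPlan nf nh np) (k : Fin nf) : Set ℂ :=
  {z | ∀ m, m ≠ k → 0 < D.height m (D.chart k z)}

/-- The part of the plane of a facet that is covered by placed hexagons, in the chart. -/
def covered (D : HexPlan nf nh np) (k : Fin nf) : Set ℂ :=
  ⋃ p ∈ {p | (D.placement p).face = k}, tile (D.placement p).center

lemma convex_openFacet (k : Fin nf) : Convex ℝ (D.openFacet k) := by
  have hinter : D.openFacet k =
      ⋂ (m) (_ : m ≠ k), ((D.height m).comp (D.chart k)) ⁻¹' Set.Ioi 0 := by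
    ext z
    simp [openFacet]
  rw [hinter]
  exact convex_iInter₂ fun m _ => (convex_Ioi (0 : ℝ)).affine_preimage _

lemma isClosed_covered (k : Fin nf) : IsClosed (D.covered k) :=
  (Set.toFinite _).isClosed_biUnion fun _ _ => isClosed_tile _

lemma openSegment_subset_openFacet {k : Fin nf} {z z₀ : ℂ} (hz₀ : z₀ ∈ D.openFacet k)
    (hz : D.chart k z ∈ D.solid) : openSegment ℝ z₀ z ⊆ D.openFacet k := by
  rintro _ ⟨a, b, ha, hb, hab, rfl⟩ m hm
  have hcomb := Convex.combo_affine_apply (f := (D.height m).comp (D.chart k))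
    (x := z₀) (y := z) hab
  rw [AffineMap.comp_apply] at hcomb
  rw [hcomb]
  exact add_pos_of_pos_of_nonneg (mul_pos ha (hz₀ m hm)) (mul_nonneg hb.le (hz m))

/-- The centres of the honeycomb containing the placement `p` at which no hexagon is placed. -/
def missing (D : HexPlan nf nh np) (p : Fin np) : Set (ℤ × ℤ) :=
  {c | IsHoneycombPeriod (c - (D.placement p).center) ∧
    ∀ q, (D.placement q).face = (D.placement p).face → (D.placement q).center ≠ c}

lemma mem_covered_or_exists_missing (D : HexPlan nf nh np) (p : Fin np) (z : ℂ) :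
    z ∈ D.covered (D.placement p).face ∨ ∃ c ∈ D.missing p, z ∈ tile c := by
  obtain ⟨a, ha, hza⟩ := exists_isHoneycombPeriod_mem_tile
    (z - eisenstein (D.placement p).center)
  have hz : z ∈ tile (a + (D.placement p).center) := by
    rwa [tile, Set.mem_ofPred_eq, map_add, add_comm, ← sub_sub]
  by_cases hq : ∃ q, (D.placement q).face = (D.placement p).face ∧
      (D.placement q).center = a + (D.placement p).center
  · obtain ⟨q, hface, hcenter⟩ := hq
    exact Or.inl (Set.mem_biUnion (x := q) hface (hcenter ▸ hz))
  · exact Or.inr ⟨_, ⟨by rwa [add_sub_cancel_right],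
      fun q hface hcenter => hq ⟨q, hface, hcenter⟩⟩, hz⟩

namespace Valid

lemma slope_pos_single (hD : D.Valid) (m : Fin nf) (t : Fin 3) :
    D.slope m (D.pos (Pi.single t 1)) = D.facet m t.succ := by
  simp [hD.slope_pos, Pi.single_apply]

lemma slope_ne_zero (hD : D.Valid) (m : Fin nf) : D.slope m ≠ 0 := by
  intro hzero
  have hcoeff (t : Fin 3) : D.facet m t.succ = 0 := by
    have h := hD.slope_pos_single m t
    rw [hzero, LinearMap.zero_apply] at h
    exact_mod_cast h.symm
  rcases hD.normal_ne_zero m with h | h | h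
  exacts [h (hcoeff 0), h (hcoeff 1), h (hcoeff 2)]

lemma height_linear_ne_zero (hD : D.Valid) (m : Fin nf) : (D.height m).linear ≠ 0 := by
  rw [height, AffineMap.add_linear, AffineMap.const_linear, add_zero]
  exact hD.slope_ne_zero m

lemma frontier_solid (hD : D.Valid) :
    frontier D.solid = {x | x ∈ D.solid ∧ ∃ k, D.height k x = 0} :=
  frontier_setOf_forall_affineMap_nonneg hD.height_linear_ne_zero

lemma exists_chart_eq (hD : D.Valid) (k : Fin nf) {x : E3} (hx : D.height k x = 0) :
    ∃ z, D.chart k z = x :=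
  exists_affineMap_eq_of_finrank_eq
    (by rw [Complex.finrank_real_complex, finrank_euclideanSpace_fin])
    (hD.isometry_chart k).injective (hD.height_linear_ne_zero k) (hD.height_chart_self k) hx

lemma cornerValue_self (hD : D.Valid) (p : Fin np) (e : Fin 6) :
    D.cornerValue p (D.placement p).face e = 0 := by
  have h := hD.heightOn_hexVertex p (D.placement p).face e
  rw [hD.heightOn_self] at h
  exact_mod_cast h.symm

lemma exists_heightOn_edgePoint_nonpos (hD : D.Valid) {p : Fin np} {e : Fin 6}
    (hout : D.EdgeOutside p e) {t : ℝ} (ht : t ∈ Set.Icc (0 : ℝ) 1) :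
    ∃ m, m ≠ (D.placement p).face ∧ D.heightOn p m (edgePoint e t) ≤ 0 := by
  obtain ⟨m, hstart, hend, hneg⟩ := hout
  refine ⟨m, ?_, ?_⟩
  · rintro rfl
    rw [hD.cornerValue_self, hD.cornerValue_self] at hneg
    exact hneg.elim (lt_irrefl _) (lt_irrefl _)
  · rw [hD.heightOn_edgePoint]
    exact add_nonpos
      (mul_nonpos_of_nonneg_of_nonpos (sub_nonneg.2 ht.2) (by exact_mod_cast hstart))
      (mul_nonpos_of_nonneg_of_nonpos ht.1 (by exact_mod_cast hend))

lemma openFacet_inter_covered_nonempty (hD : D.Valid) (k : Fin nf) :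
    (D.openFacet k ∩ D.covered k).Nonempty := by
  obtain ⟨hface, hc, hsum, hpos⟩ := hD.innerPoint_pos k
  set p := (D.innerPoint k).1
  have hsum' : (0 : ℝ) < ∑ e, ((D.innerPoint k).2 e : ℝ) := by exact_mod_cast hsum
  let w : ℂ := Finset.univ.centerMass (fun e => ((D.innerPoint k).2 e : ℝ)) hexVertex
  have hw : w ∈ hexagon := Finset.centerMass_mem_convexHull _ (fun e _ => by exact_mod_cast hc e)
    hsum' fun e _ => Set.mem_range_self e
  have hheight (m : Fin nf) (hm : m ≠ k) : 0 < D.heightOn p m w := by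
    rw [map_centerMass _ hsum'.ne', Finset.centerMass, smul_eq_mul]
    refine mul_pos (inv_pos.2 hsum') ?_
    simp only [Function.comp_apply, hD.heightOn_hexVertex, smul_eq_mul]
    exact_mod_cast hpos m hm
  refine ⟨D.motion p w, fun m hm => ?_, Set.mem_biUnion (x := p) hface (motion_mem_tile p hw)⟩
  rw [← hface]
  exact hheight m hm

lemma exists_placement_center_eq (hD : D.Valid) {p : Fin np} {z : ℂ}
    (hz : z ∈ D.openFacet (D.placement p).face) (hzp : z ∈ tile (D.placement p).center) {c : ℤ × ℤ}
    (hc : IsHoneycombPeriod (c - (D.placement p).center)) (hzc : z ∈ tile c) :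
    ∃ q, (D.placement q).face = (D.placement p).face ∧ (D.placement q).center = c := by
  rcases eq_or_exists_edgePoint_of_mem_tile hc hzp hzc with hcp | ⟨d, hcd, t, ht, hedge⟩
  · exact ⟨p, rfl, hcp.symm⟩
  rcases hD.edge p (d - (D.placement p).rot) with ⟨q, ⟨hface, hcenter⟩, -⟩ | hout
  · exact ⟨q, hface, by rw [hcenter, sub_add_cancel, hcd]⟩
  · obtain ⟨m, hm, hnonpos⟩ := hD.exists_heightOn_edgePoint_nonpos hout ht
    rw [heightOn_apply, place_apply, motion_edgePoint, sub_add_cancel, ← hedge, sub_add_cancel]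
      at hnonpos
    exact (hnonpos.not_gt (hz m hm)).elim

lemma openFacet_subset_covered (hD : D.Valid) (k : Fin nf) : D.openFacet k ⊆ D.covered k := by
  obtain ⟨z₀, hz₀, hz₀'⟩ := hD.openFacet_inter_covered_nonempty k
  obtain ⟨p₀, rfl, -⟩ := Set.mem_iUnion₂.1 hz₀'
  have hclosed : IsClosed (⋃ c : D.missing p₀, tile c) :=
    (locallyFinite_tile.comp_injective Subtype.val_injective).isClosed_iUnion
      fun c => isClosed_tile c
  have hunion : D.openFacet (D.placement p₀).face ⊆
      D.covered (D.placement p₀).face ∪ ⋃ c : D.missing p₀, tile c := by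
    intro z _
    rw [← Set.biUnion_eq_iUnion (D.missing p₀) fun c _ => tile c]
    exact (D.mem_covered_or_exists_missing p₀ z).imp_right fun ⟨c, hc, hz⟩ =>
      Set.mem_biUnion hc hz
  intro z hz
  by_contra hzc
  obtain ⟨y, hy, hyc, hyu⟩ := isPreconnected_closed_iff.1 (convex_openFacet _).isPreconnected
    _ _ (isClosed_covered _) hclosed hunion ⟨z₀, hz₀, hz₀'⟩
    ⟨z, hz, (hunion hz).resolve_left hzc⟩
  obtain ⟨p, hp, hyp⟩ := Set.mem_iUnion₂.1 hyc
  obtain ⟨⟨c, hc, hmissing⟩, hyc⟩ := Set.mem_iUnion.1 hyu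
  have hface : (D.placement p).face = (D.placement p₀).face := hp
  have hcp : IsHoneycombPeriod (c - (D.placement p).center) := by
    rw [← sub_sub_sub_cancel_right _ _ (D.placement p₀).center]
    exact hc.sub (hD.honeycomb p₀ p hface.symm)
  obtain ⟨q, hq, hqc⟩ := hD.exists_placement_center_eq (hface ▸ hy) hyp hcp hyc
  exact hmissing q (hq.trans hface) hqc

lemma exists_place_eq (hD : D.Valid) {k : Fin nf} {x : E3} (hx : x ∈ D.solid)
    (h0 : D.height k x = 0) : ∃ p, ∃ w ∈ hexagon, D.place p w = x := by
  obtain ⟨z, rfl⟩ := hD.exists_chart_eq k h0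
  obtain ⟨z₀, hz₀, -⟩ := hD.openFacet_inter_covered_nonempty k
  have hclosure : z ∈ closure (openSegment ℝ z₀ z) :=
    segment_subset_closure_openSegment (right_mem_segment ℝ z₀ z)
  have hz : z ∈ D.covered k := closure_minimal
    ((openSegment_subset_openFacet hz₀ hx).trans (hD.openFacet_subset_covered k))
    (isClosed_covered k) hclosure
  obtain ⟨p, rfl, hzp⟩ := Set.mem_iUnion₂.1 hz
  obtain ⟨w, hw, rfl⟩ := exists_motion_eq p hzp
  exact ⟨p, w, hw, rfl⟩

theorem yields (hD : D.Valid) : (D.gluing hD).Yields D.solid := by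
  refine ⟨D.fold, hD.isFolding_fold, ?_, fun i j z hz w hw => hD.fold_eq_iff_glued hz hw⟩
  rw [hD.frontier_solid]
  apply Set.Subset.antisymm
  · intro x hx
    obtain ⟨i, w, hw, rfl⟩ := Set.mem_iUnion.1 hx
    obtain ⟨p, rfl, hp⟩ := hD.exists_place_mem_solid i hw
    rw [hD.fold_eq hw hp]
    exact ⟨hp, _, hD.heightOn_self p w⟩
  · rintro x ⟨hx, k, h0⟩
    obtain ⟨p, w, hw, rfl⟩ := hD.exists_place_eq hx h0
    exact Set.mem_iUnion.2 ⟨(D.placement p).hex, w, hw, hD.fold_eq hw hx⟩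

end Valid

end HexPlan

/-! ### Faces of a polytope with given vertices -/

section Faces

variable {ι E : Type*} [AddCommGroup E] [Module ℝ E] {v : ι → E} {S : Finset ι}

/-- The points `v i` with `i ∈ S` are the points of the family `v` on a supporting hyperplane,
encoded by an affine functional that vanishes on it. The functional may be constant: the empty set
and the set of all indices are face sets. -/
def IsFaceSet (v : ι → E) (S : Finset ι) : Prop :=
  ∃ φ : E →ᵃ[ℝ] ℝ, (∀ i ∈ S, φ (v i) = 0) ∧ ∀ i ∉ S, 0 < φ (v i)

lemma nonneg_of_mem_convexHull {φ : E →ᵃ[ℝ] ℝ} {s : Set E} (hs : ∀ y ∈ s, 0 ≤ φ y) {x : E}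
    (hx : x ∈ convexHull ℝ s) : 0 ≤ φ x :=
  convexHull_min (t := φ ⁻¹' Set.Ici 0) hs ((convex_Ici 0).affine_preimage φ) hx

lemma convexHull_image_eq_of_isFaceSet {φ : E →ᵃ[ℝ] ℝ} (hzero : ∀ i ∈ S, φ (v i) = 0)
    (hpos : ∀ i ∉ S, 0 < φ (v i)) :
    convexHull ℝ (v '' S) = {x ∈ convexHull ℝ (Set.range v) | φ x = 0} := by
  have hnonneg : ∀ y ∈ Set.range v, 0 ≤ φ y := Set.forall_mem_range.2 fun i => by
    by_cases hi : i ∈ S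
    exacts [(hzero i hi).ge, (hpos i hi).le]
  have hface : {y ∈ Set.range v | φ y = 0} ⊆ v '' S := by
    rintro _ ⟨⟨i, rfl⟩, hi⟩
    exact ⟨i, not_not.1 fun h => (hpos i h).ne' hi, rfl⟩
  refine Set.Subset.antisymm (Set.subset_inter (convexHull_mono (Set.image_subset_range _ _)) ?_)
    fun x hx => convexHull_mono hface (mem_convexHull_setOf_eq_zero hnonneg hx.1 hx.2)
  exact convexHull_min (t := φ ⁻¹' {0}) (by rintro _ ⟨i, hi, rfl⟩; exact hzero i hi)
    ((convex_singleton 0).affine_preimage φ)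

lemma convexIndependent_of_isFaceSet_singleton (h : ∀ i, IsFaceSet v {i}) :
    ConvexIndependent ℝ v := by
  intro s i hi
  by_contra his
  obtain ⟨φ, hzero, hpos⟩ := h i
  have hsub : convexHull ℝ (v '' s) ⊆ φ ⁻¹' Set.Ioi 0 := by
    refine convexHull_min ?_ ((convex_Ioi 0).affine_preimage φ)
    rintro _ ⟨j, hj, rfl⟩
    exact hpos j fun hji => his (Finset.mem_singleton.1 hji ▸ hj)
  exact (hsub hi).ne' (hzero i (Finset.mem_singleton_self i))

lemma vectorSpan_convexHull (s : Set E) : vectorSpan ℝ (convexHull ℝ s) = vectorSpan ℝ s := by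
  rw [← direction_affineSpan, affineSpan_convexHull, direction_affineSpan]

lemma not_wbtw_of_convexIndependent (hv : ConvexIndependent ℝ v) {i j k : ι} (hij : i ≠ j)
    (hjk : j ≠ k) : ¬ Wbtw ℝ (v i) (v j) (v k) := by
  intro h
  have hmem : v j ∈ convexHull ℝ (v '' {i, k}) := by
    rw [Set.image_pair, convexHull_pair]
    exact mem_segment_iff_wbtw.2 h
  rcases hv _ j hmem with hji | hjk'
  exacts [hij hji.symm, hjk hjk']

lemma not_collinear_of_convexIndependent (hv : ConvexIndependent ℝ v) {i j k : ι} (hij : i ≠ j)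
    (hik : i ≠ k) (hjk : j ≠ k) : ¬ Collinear ℝ {v i, v j, v k} := by
  intro h
  rcases h.wbtw_or_wbtw_or_wbtw with h | h | h
  · exact not_wbtw_of_convexIndependent hv hij hjk h
  · exact not_wbtw_of_convexIndependent hv hjk hik.symm h
  · exact not_wbtw_of_convexIndependent hv hik.symm hij h

lemma finrank_vectorSpan_image_le (v : ι → E) {d : ℕ} (hS : S.card ≤ d + 1) :
    Module.finrank ℝ (vectorSpan ℝ (v '' S)) ≤ d := by
  classical
  rcases S.eq_empty_or_nonempty with rfl | hne
  · rw [Finset.coe_empty, Set.image_empty, vectorSpan_empty, finrank_bot]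
    exact Nat.zero_le d
  · obtain ⟨m, hm⟩ := Nat.exists_eq_succ_of_ne_zero hne.card_ne_zero
    have h := finrank_vectorSpan_image_finset_le ℝ v S hm
    rw [Finset.coe_image] at h
    lia

lemma finrank_vectorSpan_image_pos (hv : ConvexIndependent ℝ v) (hS : 2 ≤ S.card) :
    0 < Module.finrank ℝ (vectorSpan ℝ (v '' S)) := by
  obtain ⟨i, hi, j, hj, hij⟩ := Finset.one_lt_card.1 hS
  have := finiteDimensional_vectorSpan_of_finite ℝ (S.finite_toSet.image v)
  refine Module.finrank_pos_iff_exists_ne_zero.2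
    ⟨⟨_, vsub_mem_vectorSpan ℝ ⟨i, hi, rfl⟩ ⟨j, hj, rfl⟩⟩, fun h => ?_⟩
  exact hv.injective.ne hij (vsub_eq_zero_iff_eq.1 (congrArg Subtype.val h))

lemma two_le_finrank_vectorSpan_image (hv : ConvexIndependent ℝ v) (hS : 3 ≤ S.card) :
    2 ≤ Module.finrank ℝ (vectorSpan ℝ (v '' S)) := by
  obtain ⟨i, j, k, hi, hj, hk, hij, hik, hjk⟩ := Finset.two_lt_card_iff.1 hS
  have := finiteDimensional_vectorSpan_of_finite ℝ (S.finite_toSet.image v)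
  by_contra! h
  refine not_collinear_of_convexIndependent hv hij hik hjk
    ((collinear_iff_finrank_le_one.2 (Nat.le_of_lt_succ h)).subset ?_)
  rintro x (rfl | rfl | rfl)
  exacts [⟨i, hi, rfl⟩, ⟨j, hj, rfl⟩, ⟨k, hk, rfl⟩]

lemma finrank_vectorSpan_image_eq_one_iff (hv : ConvexIndependent ℝ v) :
    Module.finrank ℝ (vectorSpan ℝ (v '' S)) = 1 ↔ S.card = 2 := by
  have hzero := finrank_vectorSpan_image_le (S := S) v (d := 0)
  have hone := finrank_vectorSpan_image_le (S := S) v (d := 1)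
  have hpos := finrank_vectorSpan_image_pos (S := S) hv
  have htwo := two_le_finrank_vectorSpan_image (S := S) hv
  lia

lemma IsFaceSet.finrank_vectorSpan_lt [Fintype ι] [FiniteDimensional ℝ E] (h : IsFaceSet v S)
    (hS : S ≠ Finset.univ) (hne : S.Nonempty) :
    Module.finrank ℝ (vectorSpan ℝ (v '' S)) < Module.finrank ℝ E := by
  obtain ⟨φ, hzero, hpos⟩ := h
  obtain ⟨i₀, hi₀⟩ := hne
  obtain ⟨i, hi⟩ : ∃ i, i ∉ S := by simpa [Finset.eq_univ_iff_forall] using hS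
  have hlinear : φ.linear ≠ 0 := by
    intro hφ
    have hsub := φ.linearMap_vsub (v i) (v i₀)
    rw [hφ, LinearMap.zero_apply, hzero i₀ hi₀, vsub_eq_sub, sub_zero] at hsub
    exact (hpos i hi).ne hsub
  have hle : vectorSpan ℝ (v '' S) ≤ LinearMap.ker φ.linear := by
    rw [vectorSpan, Submodule.span_le]
    rintro _ ⟨_, ⟨a, ha, rfl⟩, _, ⟨b, hb, rfl⟩, rfl⟩
    exact (φ.linearMap_vsub _ _).trans (by rw [hzero a ha, hzero b hb, vsub_self])
  rw [← Module.Dual.finrank_ker_add_one_of_ne_zero hlinear]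
  exact Nat.lt_succ_of_le (Submodule.finrank_mono hle)

lemma isFaceSet_comp [DecidableEq ι] (σ : Equiv.Perm ι) :
    IsFaceSet (v ∘ σ) S ↔ IsFaceSet v (S.image σ) := by
  refine exists_congr fun φ => and_congr (by simp) ⟨fun h i hi => ?_, fun h i hi => ?_⟩
  · obtain ⟨j, rfl⟩ := σ.surjective i
    exact h j fun hj => hi (Finset.mem_image_of_mem σ hj)
  · exact h (σ i) (by rwa [σ.injective.mem_finset_image])

end Faces

section ExposedFaces

variable {ι E : Type*} [NormedAddCommGroup E] [NormedSpace ℝ E] {v : ι → E} {S : Finset ι}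

lemma IsFaceSet.isExposed [FiniteDimensional ℝ E] (h : IsFaceSet v S) :
    IsExposed ℝ (convexHull ℝ (Set.range v)) (convexHull ℝ (v '' S)) := by
  obtain ⟨φ, hzero, hpos⟩ := h
  have hle (x y : E) : -φ.linear y ≤ -φ.linear x ↔ φ x ≤ φ y := by
    rw [φ.decomp]
    simp
  have hnonneg : ∀ y ∈ convexHull ℝ (Set.range v), 0 ≤ φ y := fun y hy =>
    nonneg_of_mem_convexHull (Set.forall_mem_range.2 fun i => by
      by_cases hi : i ∈ S
      exacts [(hzero i hi).ge, (hpos i hi).le]) hy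
  rw [convexHull_image_eq_of_isFaceSet hzero hpos]
  rintro ⟨x₀, hx₀, hφ₀⟩
  refine ⟨LinearMap.toContinuousLinearMap (-φ.linear),
    Set.ext fun x => and_congr_right fun hx => ?_⟩
  simp only [LinearMap.coe_toContinuousLinearMap', LinearMap.neg_apply, hle]
  exact ⟨fun hφ y hy => hφ ▸ hnonneg y hy,
    fun hmin => le_antisymm (hφ₀ ▸ hmin x₀ hx₀) (hnonneg x hx)⟩

lemma isFaceSet_singleton [Finite ι] (hv : ConvexIndependent ℝ v) (i : ι) : IsFaceSet v {i} := by
  have hnot : v i ∉ convexHull ℝ (v '' {i}ᶜ) := fun h => hv _ i h rfl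
  obtain ⟨f, u, hi, hu⟩ := geometric_hahn_banach_point_closed (convex_convexHull ℝ _)
    ((Set.toFinite (v '' {i}ᶜ)).isCompact_convexHull (𝕜 := ℝ)).isClosed hnot
  refine ⟨(f : E →ₗ[ℝ] ℝ).toAffineMap - AffineMap.const ℝ E (f (v i)), fun j hj => ?_,
    fun j hj => ?_⟩
  · rw [Finset.mem_singleton.1 hj]
    exact sub_self _
  · refine sub_pos.2 (hi.trans (hu _ (subset_convexHull ℝ _ ⟨j, ?_, rfl⟩)))
    exact fun hji => hj (Finset.mem_singleton.2 hji)

lemma isFaceSet_of_isExposed (hv : ConvexIndependent ℝ v) (hS : S.Nonempty)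
    (h : IsExposed ℝ (convexHull ℝ (Set.range v)) (convexHull ℝ (v '' S))) : IsFaceSet v S := by
  have hmem (i : ι) : v i ∈ convexHull ℝ (Set.range v) := subset_convexHull ℝ _ ⟨i, rfl⟩
  obtain ⟨i₀, hi₀⟩ := hS
  obtain ⟨l, hl⟩ := h ⟨_, subset_convexHull ℝ _ ⟨i₀, hi₀, rfl⟩⟩
  have hmax (i : ι) : i ∈ S ↔ ∀ y ∈ convexHull ℝ (Set.range v), l y ≤ l (v i) := by
    rw [← Finset.mem_coe, ← hv.mem_convexHull_iff, hl]
    exact and_iff_right (hmem i)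
  have hmax₀ := (hmax i₀).1 hi₀
  refine ⟨AffineMap.const ℝ E (l (v i₀)) - (l : E →ₗ[ℝ] ℝ).toAffineMap, fun i hi => ?_,
    fun i hi => ?_⟩
  · exact sub_eq_zero.2 (le_antisymm ((hmax i).1 hi _ (hmem i₀)) (hmax₀ _ (hmem i)))
  · refine sub_pos.2 ((hmax₀ _ (hmem i)).lt_of_ne fun heq => hi ((hmax i).2 fun y hy => ?_))
    exact (hmax₀ y hy).trans_eq heq.symm

lemma extremePoints_convexHull_range [Finite ι] [FiniteDimensional ℝ E]
    (hv : ConvexIndependent ℝ v) : (convexHull ℝ (Set.range v)).extremePoints ℝ = Set.range v := by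
  refine Set.Subset.antisymm extremePoints_convexHull_subset (Set.range_subset_iff.2 fun i => ?_)
  have hexposed := (isFaceSet_singleton hv i).isExposed
  rw [Finset.coe_singleton, Set.image_singleton, convexHull_singleton] at hexposed
  exact isExtreme_singleton.1 hexposed.isExtreme

lemma extremePoints_convexHull_image [Finite ι] [FiniteDimensional ℝ E]
    (hv : ConvexIndependent ℝ v) (s : Set ι) :
    (convexHull ℝ (v '' s)).extremePoints ℝ = v '' s := by
  rw [Set.image_eq_range]
  exact extremePoints_convexHull_range (hv.subtype s)

end ExposedFaces

section Space

variable {n : ℕ} {v : Fin n → E3} {S : Finset (Fin n)}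

lemma isFaceOfDim_iff (hv : ConvexIndependent ℝ v) {d : ℕ} :
    IsFaceOfDim (convexHull ℝ (Set.range v)) d (convexHull ℝ (v '' S)) ↔
      S.Nonempty ∧ IsFaceSet v S ∧ Module.finrank ℝ (vectorSpan ℝ (v '' S)) = d := by
  rw [IsFaceOfDim, vectorSpan_convexHull, convexHull_nonempty_iff, Set.image_nonempty,
    Finset.coe_nonempty]
  exact and_congr_right fun hS =>
    and_congr_left' ⟨isFaceSet_of_isExposed hv hS, IsFaceSet.isExposed⟩

lemma isFaceOfDim_one_iff (hv : ConvexIndependent ℝ v) :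
    IsFaceOfDim (convexHull ℝ (Set.range v)) 1 (convexHull ℝ (v '' S)) ↔
      S.card = 2 ∧ IsFaceSet v S := by
  rw [isFaceOfDim_iff hv, finrank_vectorSpan_image_eq_one_iff hv]
  exact ⟨fun h => ⟨h.2.2, h.2.1⟩, fun h => ⟨Finset.card_pos.1 (by lia), h.2, h.1⟩⟩

lemma isFaceOfDim_two_iff (hv : ConvexIndependent ℝ v) (hspan : affineSpan ℝ (Set.range v) = ⊤) :
    IsFaceOfDim (convexHull ℝ (Set.range v)) 2 (convexHull ℝ (v '' S)) ↔
      3 ≤ S.card ∧ S ≠ Finset.univ ∧ IsFaceSet v S := by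
  rw [isFaceOfDim_iff hv]
  constructor
  · rintro ⟨-, hface, hdim⟩
    refine ⟨?_, ?_, hface⟩
    · by_contra! hcard
      have := finrank_vectorSpan_image_le v (S := S) (d := 1) (by lia)
      lia
    · rintro rfl
      rw [Finset.coe_univ, Set.image_univ, ← direction_affineSpan, hspan,
        AffineSubspace.direction_top, finrank_top, finrank_euclideanSpace_fin] at hdim
      lia
  · rintro ⟨hcard, hne, hface⟩
    have hS : S.Nonempty := Finset.card_pos.1 (by lia)
    have hlt := hface.finrank_vectorSpan_lt hne hS
    rw [finrank_euclideanSpace_fin] at hlt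
    exact ⟨hS, hface, (Nat.le_of_lt_succ hlt).antisymm (two_le_finrank_vectorSpan_image hv hcard)⟩

lemma hasType_of_isFaceSet (hv : ConvexIndependent ℝ v) (hspan : affineSpan ℝ (Set.range v) = ⊤)
    {T : CombType n} (hedges : ∀ S, S ∈ T.edges ↔ S.card = 2 ∧ IsFaceSet v S)
    (hfaces : ∀ S, S ∈ T.faces ↔ 3 ≤ S.card ∧ S ≠ Finset.univ ∧ IsFaceSet v S) :
    HasType (convexHull ℝ (Set.range v)) T :=
  ⟨v, hv.injective, (extremePoints_convexHull_range hv).symm,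
    fun S => (hedges S).trans (isFaceOfDim_one_iff hv).symm,
    fun S => (hfaces S).trans (isFaceOfDim_two_iff hv hspan).symm⟩

end Space

/-! ### Face sets and facets -/

/-- With `a m i` the value of the `m`-th facet functional at the `i`-th vertex: the set `S` contains
every vertex that lies on all the facets through `S`. -/
def IsFacetClosed {κ ι R : Type*} [Zero R] (a : κ → ι → R) (S : Finset ι) : Prop :=
  ∀ i, (∀ m, (∀ j ∈ S, a m j = 0) → a m i = 0) → i ∈ S

instance {κ ι R : Type*} [Zero R] [Fintype κ] [Fintype ι] [DecidableEq ι] [DecidableEq R]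
    (a : κ → ι → R) (S : Finset ι) : Decidable (IsFacetClosed a S) := by
  unfold IsFacetClosed
  infer_instance

section Facets

variable {ι κ E : Type*} [AddCommGroup E] [Module ℝ E] {v : ι → E} {S : Finset ι}
  {φ : κ → E →ᵃ[ℝ] ℝ}

lemma isFaceSet_of_isFacetClosed [Finite κ] (hφ : ∀ m i, 0 ≤ φ m (v i))
    (h : IsFacetClosed (fun m i => φ m (v i)) S) : IsFaceSet v S := by
  classical
  have := Fintype.ofFinite κ
  let M : Finset κ := {m | ∀ j ∈ S, φ m (v j) = 0}
  have hsum (x : E) : (∑ m ∈ M, φ m) x = ∑ m ∈ M, φ m x := by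
    induction M using Finset.induction_on with
    | empty => rfl
    | insert m M hm ih => rw [Finset.sum_insert hm, Finset.sum_insert hm, AffineMap.coe_add,
      Pi.add_apply, ih]
  refine ⟨∑ m ∈ M, φ m, fun i hi => ?_, fun i hi => ?_⟩
  · rw [hsum]
    exact Finset.sum_eq_zero fun m hm => (Finset.mem_filter.1 hm).2 i hi
  · obtain ⟨m, hm, hne⟩ : ∃ m ∈ M, φ m (v i) ≠ 0 := by
      by_contra! hall
      exact hi (h i fun m hm => hall m (Finset.mem_filter.2 ⟨Finset.mem_univ m, hm⟩))
    rw [hsum]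
    exact Finset.sum_pos' (fun m _ => hφ m i) ⟨m, hm, (hφ m i).lt_of_ne hne.symm⟩

lemma exists_pos_forall_nonneg_lineMap_neg [Finite κ] {b x : E} (hb : ∀ m, 0 ≤ φ m b)
    (hx : ∀ m, φ m b = 0 → φ m x = 0) :
    ∃ ε > (0 : ℝ), ∀ m, 0 ≤ φ m (AffineMap.lineMap b x (-ε)) := by
  have hnear (m : κ) : ∀ᶠ ε : ℝ in nhdsWithin 0 (Set.Ioi 0),
      0 ≤ φ m (AffineMap.lineMap b x (-ε)) := by
    simp only [AffineMap.apply_lineMap, AffineMap.lineMap_apply_ring']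
    rcases (hb m).eq_or_lt' with hzero | hpos
    · simp [hzero, hx m hzero]
    · have hcont : Continuous fun ε : ℝ => -ε * (φ m x - φ m b) + φ m b := by fun_prop
      have hlim := (hcont.tendsto 0).mono_left (nhdsWithin_le_nhds (s := Set.Ioi (0 : ℝ)))
      rw [neg_zero, zero_mul, zero_add] at hlim
      exact (hlim.eventually (lt_mem_nhds hpos)).mono fun ε hε => hε.le
  obtain ⟨ε, hε, hpos⟩ := ((Filter.eventually_all.2 hnear).and self_mem_nhdsWithin).exists
  exact ⟨ε, hpos, hε⟩

/-- If some vertex outside `S` were on all the facets through `S`, then moving away from it,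
starting at the barycentre of `S`, would stay in the polytope but leave the half-space that defines
the face. -/
lemma isFacetClosed_of_isFaceSet [Finite κ] (hφ : ∀ m i, 0 ≤ φ m (v i))
    (hhull : {x | ∀ m, 0 ≤ φ m x} ⊆ convexHull ℝ (Set.range v)) (hS : S.Nonempty)
    (h : IsFaceSet v S) : IsFacetClosed (fun m i => φ m (v i)) S := by
  obtain ⟨ψ, hzero, hpos⟩ := h
  intro i hi
  by_contra hiS
  have hcard : (∑ _j ∈ S, 1 : ℝ) ≠ 0 := by simpa using hS.ne_empty
  set b : E := S.centerMass (fun _ => (1 : ℝ)) v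
  have hφb (χ : E →ᵃ[ℝ] ℝ) : χ b = (S.card : ℝ)⁻¹ * ∑ j ∈ S, χ (v j) := by
    rw [map_centerMass χ hcard]
    simp [Finset.centerMass]
  have hψb : ψ b = 0 := by rw [hφb, Finset.sum_eq_zero hzero, mul_zero]
  have hface (m : κ) (hm : φ m b = 0) : φ m (v i) = 0 := by
    refine hi m ((Finset.sum_eq_zero_iff_of_nonneg fun j _ => hφ m j).1 ?_)
    rw [hφb] at hm
    exact (mul_eq_zero.1 hm).resolve_left (by simpa using hS.ne_empty)
  obtain ⟨ε, hε, hmem⟩ := exists_pos_forall_nonneg_lineMap_neg (fun m => by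
    rw [hφb]
    exact mul_nonneg (by positivity) (Finset.sum_nonneg fun j _ => hφ m j)) hface
  have hnonneg := nonneg_of_mem_convexHull (φ := ψ) (Set.forall_mem_range.2 fun j => by
    by_cases hj : j ∈ S
    exacts [(hzero j hj).ge, (hpos j hj).le]) (hhull hmem)
  rw [AffineMap.apply_lineMap, AffineMap.lineMap_apply_ring', hψb, sub_zero, add_zero,
    neg_mul] at hnonneg
  exact (mul_pos hε (hpos i hiS)).not_ge (neg_nonneg.1 hnonneg)

lemma isFaceSet_iff_isFacetClosed [Finite κ] (hφ : ∀ m i, 0 ≤ φ m (v i))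
    (hhull : {x | ∀ m, 0 ≤ φ m x} ⊆ convexHull ℝ (Set.range v)) (hS : S.Nonempty) :
    IsFaceSet v S ↔ IsFacetClosed (fun m i => φ m (v i)) S :=
  ⟨isFacetClosed_of_isFaceSet hφ hhull hS, isFaceSet_of_isFacetClosed hφ⟩

end Facets

/-! ### Triangulations -/

/-- A triangulation of a polyhedron with `n` vertices by successive cuts along planes. Each leaf is
a tetrahedron with vertices `t`; the four facet functionals of the tetrahedron are named by their
positions `src` in the list of all facets of the polyhedron and all cuts made so far, and the
factors `κ` scale them so that they take the value `C` at the opposite vertex. -/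
inductive CutTree (n : ℕ)
  | leaf (t : Fin 4 → Fin n) (C : ℤ) (κ : Fin 4 → ℤ) (src : Fin 4 → ℕ)
  | cut (g : Fin 4 → ℤ) (a b : CutTree n)

namespace CutTree

variable {n : ℕ} {vert : Fin n → Fin 3 → ℤ}

/-- The tetrahedra of the tree cover the region where the functionals of the list `F` are
nonnegative. The two conditions on sums say that the scaled functionals of a leaf, divided by `C`,
are the barycentric coordinates with respect to its vertices. -/
def Fills (vert : Fin n → Fin 3 → ℤ) : CutTree n → List (Fin 4 → ℤ) → Prop
  | leaf t C κ src, F => 0 < C ∧ (∀ j, 0 ≤ κ j) ∧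
      (∀ a : Fin 4, ∑ j, κ j * F.getD (src j) 0 a = if a = 0 then C else 0) ∧
      ∀ (s : Fin 3) (a : Fin 4), ∑ j, κ j * F.getD (src j) 0 a * vert (t j) s =
        if a = s.succ then C else 0
  | cut g a b, F => a.Fills vert (F ++ [g]) ∧ b.Fills vert (F ++ [-g])

instance decidableFills (vert : Fin n → Fin 3 → ℤ) :
    ∀ (T : CutTree n) (F : List (Fin 4 → ℤ)), Decidable (T.Fills vert F)
  | leaf _ _ _ _, _ => by unfold Fills; infer_instance
  | cut _ a b, _ =>
    have := decidableFills vert a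
    have := decidableFills vert b
    by unfold Fills; infer_instance

/-- The value of an integral affine functional at a real point. -/
def realEval (c : Fin 4 → ℤ) (x : Fin 3 → ℝ) : ℝ :=
  ∑ a, (c a : ℝ) * (Fin.cons 1 x : Fin 4 → ℝ) a

lemma realEval_neg (c : Fin 4 → ℤ) (x : Fin 3 → ℝ) : realEval (-c) x = -realEval c x := by
  simp [realEval]

lemma sum_mul_realEval {κ : Type*} [Fintype κ] (c : κ → Fin 4 → ℤ) (w : κ → ℝ) {C : ℝ}
    {a₀ : Fin 4} (h : ∀ a, ∑ j, w j * c j a = if a = a₀ then C else 0) (x : Fin 3 → ℝ) :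
    ∑ j, w j * realEval (c j) x = C * (Fin.cons 1 x : Fin 4 → ℝ) a₀ := by
  simp only [realEval, Finset.mul_sum, ← mul_assoc]
  rw [Finset.sum_comm]
  simp only [← Finset.sum_mul, h, ite_mul, zero_mul, Finset.sum_ite_eq', Finset.mem_univ, if_true]

lemma mem_convexHull_of_fills_leaf {t : Fin 4 → Fin n} {C : ℤ} {κ : Fin 4 → ℤ} {src : Fin 4 → ℕ}
    {F : List (Fin 4 → ℤ)} (h : (leaf t C κ src).Fills vert F) {x : Fin 3 → ℝ}
    (hF : ∀ c ∈ F, 0 ≤ realEval c x) :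
    x ∈ convexHull ℝ (Set.range fun i s => (vert i s : ℝ)) := by
  obtain ⟨hC, hκ, hone, hcoord⟩ := h
  have hC' : (0 : ℝ) < C := by exact_mod_cast hC
  let f (j : Fin 4) : Fin 4 → ℤ := F.getD (src j) 0
  have hf (j : Fin 4) : 0 ≤ realEval (f j) x := by
    rcases hj : F[src j]? with _ | c
    · simp [f, List.getD_eq_getElem?_getD, hj, realEval]
    · simpa [f, List.getD_eq_getElem?_getD, hj] using hF c (List.mem_of_getElem? hj)
  have hw (j : Fin 4) : 0 ≤ κ j * realEval (f j) x :=
    mul_nonneg (by exact_mod_cast hκ j) (hf j)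
  have hsum : ∑ j, κ j * realEval (f j) x = C := by
    rw [sum_mul_realEval f _ (C := C) (a₀ := 0) fun a => by exact_mod_cast hone a, Fin.cons_zero,
      mul_one]
  have hcenter : Finset.univ.centerMass (fun j => κ j * realEval (f j) x)
      (fun j s => (vert (t j) s : ℝ)) = x := by
    ext s
    have hs := sum_mul_realEval f (fun j => κ j * vert (t j) s) (C := C) (a₀ := s.succ)
      (fun a => (Finset.sum_congr rfl fun j _ => mul_right_comm _ _ _).trans
        (by exact_mod_cast hcoord s a)) x
    rw [Fin.cons_succ] at hs
    rw [Finset.centerMass, hsum, Pi.smul_apply, Finset.sum_apply, smul_eq_mul,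
      inv_mul_eq_iff_eq_mul₀ hC'.ne', ← hs]
    exact Finset.sum_congr rfl fun j _ => mul_right_comm _ _ _
  rw [← hcenter]
  exact Finset.centerMass_mem_convexHull _ (fun j _ => hw j) (hsum ▸ hC') fun j _ => ⟨t j, rfl⟩

lemma mem_convexHull_of_fills {x : Fin 3 → ℝ} {T : CutTree n} {F : List (Fin 4 → ℤ)}
    (h : T.Fills vert F) (hF : ∀ c ∈ F, 0 ≤ realEval c x) :
    x ∈ convexHull ℝ (Set.range fun i s => (vert i s : ℝ)) := by
  induction T generalizing F with
  | leaf => exact mem_convexHull_of_fills_leaf h hF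
  | cut g a b iha ihb =>
    rcases le_total 0 (realEval g x) with hg | hg
    · exact iha h.1 (List.forall_mem_append.2 ⟨hF, List.forall_mem_singleton.2 hg⟩)
    · refine ihb h.2 (List.forall_mem_append.2 ⟨hF, List.forall_mem_singleton.2 ?_⟩)
      rwa [realEval_neg, neg_nonneg]

end CutTree

/-! ### The polyhedron of a plan -/

namespace HexPlan

variable {nf nh np n : ℕ} {D : HexPlan nf nh np} {vert : Fin n → Fin 3 → ℤ}

/-- The conditions, all of them decidable, under which the solid of a plan is a polyhedron of the
combinatorial type `T` with the given vertices, in lattice coordinates. -/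
structure IsPolyhedron (D : HexPlan nf nh np) (vert : Fin n → Fin 3 → ℤ) (tree : CutTree n)
    (T : CombType n) : Prop where
  vert_nonneg : ∀ m i, 0 ≤ evalAffine (D.facet m) (vert i)
  exists_pos : ∀ m, ∃ i, 0 < evalAffine (D.facet m) (vert i)
  fills : tree.Fills vert (List.ofFn D.facet)
  isFacetClosed_singleton : ∀ i, IsFacetClosed (fun m j => evalAffine (D.facet m) (vert j)) {i}
  edges : ∀ S, S ∈ T.edges ↔
    S.card = 2 ∧ IsFacetClosed (fun m j => evalAffine (D.facet m) (vert j)) S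
  faces : ∀ S, S ∈ T.faces ↔
    3 ≤ S.card ∧ S ≠ Finset.univ ∧ IsFacetClosed (fun m j => evalAffine (D.facet m) (vert j)) S

namespace Valid

lemma solid_eq (hD : D.Valid) (hvert : ∀ m i, 0 ≤ evalAffine (D.facet m) (vert i))
    {T : CutTree n} (hT : T.Fills vert (List.ofFn D.facet)) :
    D.solid = convexHull ℝ (Set.range fun i => D.latticePos (vert i)) := by
  apply Set.Subset.antisymm
  · intro y hy
    obtain ⟨x, rfl⟩ : ∃ x, D.pos x = y := by
      refine ⟨fun t => y t / D.len t, ?_⟩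
      ext t
      rw [pos_apply, mul_div_cancel₀ _ (hD.len_pos t).ne']
    have hx : x ∈ convexHull ℝ (Set.range fun i t => (vert i t : ℝ)) := by
      refine CutTree.mem_convexHull_of_fills hT (List.forall_mem_ofFn_iff.2 fun m => ?_)
      have hm := hy m
      rwa [height_apply, hD.slope_pos, add_comm, ← mul_one (D.facet m 0 : ℝ)] at hm
    have hpos := Set.mem_image_of_mem D.pos hx
    rwa [LinearMap.image_convexHull, ← Set.range_comp] at hpos
  · intro x hx m
    refine nonneg_of_mem_convexHull (Set.forall_mem_range.2 fun i => ?_) hx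
    rw [hD.height_latticePos]
    exact_mod_cast hvert m i

lemma interior_solid_nonempty (hD : D.Valid)
    (hvert : ∀ m i, 0 ≤ evalAffine (D.facet m) (vert i))
    (hpos : ∀ m, ∃ i, 0 < evalAffine (D.facet m) (vert i)) : (interior D.solid).Nonempty := by
  suffices h : ∃ b : E3, ∀ m, 0 < D.height m b by
    obtain ⟨b, hb⟩ := h
    refine ⟨b, by_contra fun hint => ?_⟩
    obtain ⟨-, m, hm⟩ := hD.frontier_solid.subset ⟨subset_closure fun m => (hb m).le, hint⟩
    exact (hb m).ne' hm
  rcases isEmpty_or_nonempty (Fin n) with hn | hn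
  · exact ⟨0, fun m => isEmptyElim (hpos m).choose⟩
  have hcard : (0 : ℝ) < ∑ _i : Fin n, 1 := by
    rw [Finset.sum_const, nsmul_one]
    exact_mod_cast Fintype.card_pos
  refine ⟨Finset.univ.centerMass (fun _ => (1 : ℝ)) fun i => D.latticePos (vert i), fun m => ?_⟩
  rw [map_centerMass _ hcard.ne', Finset.centerMass]
  obtain ⟨i, hi⟩ := hpos m
  refine mul_pos (inv_pos.2 hcard) (Finset.sum_pos' (fun i _ => ?_) ⟨i, Finset.mem_univ i, ?_⟩)
  all_goals
    rw [one_smul, Function.comp_apply, hD.height_latticePos]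
  · exact_mod_cast hvert m i
  · exact_mod_cast hi

lemma isFaceSet_iff_isFacetClosed (hD : D.Valid) {tree : CutTree n} {T : CombType n}
    (hP : D.IsPolyhedron vert tree T) {S : Finset (Fin n)} (hS : S.Nonempty) :
    IsFaceSet (fun i => D.latticePos (vert i)) S ↔
      IsFacetClosed (fun m i => evalAffine (D.facet m) (vert i)) S := by
  have hheight (m : Fin nf) (i : Fin n) := hD.height_latticePos m (vert i)
  rw [HexGlue.isFaceSet_iff_isFacetClosed (φ := D.height) (fun m i => ?_)
    (hD.solid_eq hP.vert_nonneg hP.fills).subset hS]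
  · simp only [IsFacetClosed, hheight, Int.cast_eq_zero]
  · rw [hheight]
    exact_mod_cast hP.vert_nonneg m i

theorem isHexGlued_and_hasType (hD : D.Valid) {tree : CutTree n} {T : CombType n}
    (hP : D.IsPolyhedron vert tree T) :
    IsHexGlued (convexHull ℝ (Set.range fun i => D.latticePos (vert i))) ∧
      HasType (convexHull ℝ (Set.range fun i => D.latticePos (vert i))) T := by
  have hinterior := hD.interior_solid_nonempty hP.vert_nonneg hP.exists_pos
  have hyields := hD.yields
  rw [hD.solid_eq hP.vert_nonneg hP.fills] at hinterior hyields
  have hindep : ConvexIndependent ℝ fun i => D.latticePos (vert i) :=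
    convexIndependent_of_isFaceSet_singleton fun i =>
      (hD.isFaceSet_iff_isFacetClosed hP (Finset.singleton_nonempty i)).2
        (hP.isFacetClosed_singleton i)
  refine ⟨⟨⟨⟨_, Set.finite_range _, rfl⟩, hinterior⟩, nh, D.gluing hD, hyields⟩,
    hasType_of_isFaceSet hindep (affineSpan_eq_top_of_nonempty_interior hinterior)
      (fun S => (hP.edges S).trans (and_congr_right fun h => ?_))
      fun S => (hP.faces S).trans (and_congr_right fun h => and_congr_right fun _ => ?_)⟩
  all_goals exact (hD.isFaceSet_iff_isFacetClosed hP (Finset.card_pos.1 (by lia))).symm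

end Valid

end HexPlan

/-! ### Six plans -/

/-- Two hexagons folded to a tetrahedron. -/
def tetrahedronPlan : HexPlan 4 2 10 where
  weight := ![3, 1, 3]
  den := 16
  facet := ![![0, 0, 0, 1], ![0, 0, 1, -1], ![0, 1, -1, 0], ![4, -1, 0, 0]]
  base := ![![2, 2, 0], ![2, -1, -1], ![2, 2, 0], ![4, 2, -2]]
  dirX := ![![0, 4, 0], ![0, -2, -2], ![1, 1, 2], ![0, 4, 0]]
  dirY := ![![2, 2, 0], ![2, -1, -1], ![2, 2, 0], ![0, 2, 2]]
  partner := Function.uncurry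
    ![![(1, 1), (1, 0), (1, 5), (0, 4), (0, 3), (1, 4)],
      ![(0, 1), (0, 0), (1, 3), (1, 2), (0, 5), (0, 2)]]
  placement :=
    ![⟨0, 0, 0, (0, 0), 0⟩, ⟨3, 0, 0, (0, 0), 0⟩, ⟨1, 0, 0, (0, 0), 0⟩, ⟨2, 0, 0, (0, 0), 0⟩,
      ⟨1, 0, 2, (-1, -1), 3⟩, ⟨1, 1, 0, (-2, 1), 5⟩, ⟨3, 1, 4, (-1, 2), 5⟩, ⟨2, 1, 4, (2, -1), 5⟩,
      ⟨0, 1, 4, (-1, 2), 6⟩, ⟨2, 1, 2, (1, 1), 6⟩]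
  home := ![![3, 0, 0, 2, 0, 4], ![5, 6, 9, 5, 7, 5]]
  innerPoint :=
    ![(0, ![0, 1, 0, 1, 0, 0]), (4, ![0, 0, 0, 0, 0, 1]), (7, ![0, 0, 0, 0, 1, 0]),
      (6, ![1, 0, 1, 0, 0, 0])]

/-- The vertices of the solid of `tetrahedronPlan`. -/
def tetrahedronVertex : Fin 4 → Fin 3 → ℤ :=
  ![![0, 0, 0], ![4, 0, 0], ![4, 4, 0], ![4, 4, 4]]

/-- A triangulation of the solid of `tetrahedronPlan`. -/
def tetrahedronCuts : CutTree 4 :=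
  .leaf ![0, 1, 2, 3] 4 ![1, 1, 1, 1] ![3, 2, 1, 0]

theorem tetrahedronPlan_valid : tetrahedronPlan.Valid := by constructor <;> decide +kernel

theorem tetrahedronPlan_isPolyhedron :
    tetrahedronPlan.IsPolyhedron tetrahedronVertex tetrahedronCuts tetrahedron := by
  constructor <;> decide +kernel

/-- Three hexagons folded to a triangular bipyramid. -/
def bipyramidPlan : HexPlan 6 3 18 where
  weight := ![7, 1, 20]
  den := 448
  facet :=
    ![![0, 0, 1, -1], ![168, -7, -3, -32], ![0, 7, -3, -4], ![0, 0, 1, 1], ![168, -7, -3, 32],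
      ![0, 7, -3, 4]]
  base := ![![8, 0, 0], ![10, -10, 4], ![-2, -10, 4], ![8, 0, 0], ![10, -10, -4], ![-2, -10, -4]]
  dirX := ![![-8, 0, 0], ![-7, -5, 2], ![2, 10, -4], ![-8, 0, 0], ![-7, -5, -2], ![2, 10, 4]]
  dirY := ![![-4, -4, -4], ![-1, -19, 2], ![-4, -4, -4], ![-4, 4, -4], ![-6, 14, 0], ![6, 14, 0]]
  partner := Function.uncurry
    ![![(1, 3), (0, 2), (0, 1), (1, 2), (2, 3), (2, 2)],
      ![(2, 5), (2, 4), (0, 3), (0, 0), (2, 1), (2, 0)],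
      ![(1, 5), (1, 4), (0, 5), (0, 4), (1, 1), (1, 0)]]
  placement :=
    ![⟨0, 0, 0, (-1, -1), 0⟩, ⟨3, 0, 0, (-1, -1), 0⟩, ⟨1, 0, 0, (-1, -1), 0⟩, ⟨4, 0, 2, (-2, 1), 2⟩,
      ⟨3, 0, 2, (-2, 1), 3⟩, ⟨0, 0, 2, (-2, 1), 4⟩, ⟨0, 1, 0, (0, 0), 6⟩, ⟨3, 1, 0, (0, 0), 6⟩,
      ⟨1, 1, 0, (0, 0), 6⟩, ⟨2, 1, 0, (0, 0), 6⟩, ⟨4, 1, 0, (0, 0), 7⟩, ⟨5, 1, 0, (0, 0), 7⟩,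
      ⟨1, 2, 0, (1, -2), 12⟩, ⟨2, 2, 2, (2, -1), 12⟩, ⟨5, 2, 4, (1, 1), 13⟩, ⟨0, 2, 2, (2, -1), 13⟩,
      ⟨3, 2, 4, (1, 1), 14⟩, ⟨4, 2, 0, (-1, 2), 14⟩]
  home := ![![2, 0, 0, 4, 3, 2], ![6, 7, 10, 6, 8, 6], ![13, 12, 12, 12, 17, 14]]
  innerPoint :=
    ![(6, ![0, 0, 0, 1, 0, 1]), (8, ![0, 0, 0, 0, 1, 0]), (13, ![1, 0, 1, 0, 0, 0]),
      (7, ![0, 1, 0, 1, 0, 0]), (3, ![0, 0, 0, 0, 1, 0]), (14, ![1, 0, 0, 0, 1, 0])]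

/-- The vertices of the solid of `bipyramidPlan`. -/
def bipyramidVertex : Fin 5 → Fin 3 → ℤ :=
  ![![4, 4, 4], ![4, 4, -4], ![24, 0, 0], ![0, 0, 0], ![12, 28, 0]]

/-- A triangulation of the solid of `bipyramidPlan`. -/
def bipyramidCuts : CutTree 5 :=
  .cut ![0, 0, 0, 1]
    (.leaf ![0, 2, 3, 4] 168 ![42, 1, 1, 6] ![6, 2, 1, 0])
    (.leaf ![1, 2, 3, 4] 168 ![42, 1, 1, 6] ![6, 5, 4, 3])

theorem bipyramidPlan_valid : bipyramidPlan.Valid := by constructor <;> decide +kernel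

theorem bipyramidPlan_isPolyhedron :
    bipyramidPlan.IsPolyhedron bipyramidVertex bipyramidCuts triangularBipyramid := by
  constructor <;> decide +kernel

/-- Ten hexagons folded to a right pyramid over a rectangle. -/
def pyramidPlan : HexPlan 5 10 30 where
  weight := ![1, 3, 24]
  den := 2700
  facet := ![![0, 0, 0, 1], ![45, 0, -1, -1], ![45, 1, 0, -1], ![45, 0, 1, -1], ![45, -1, 0, -1]]
  base := ![![0, -30, 0], ![0, 70, -25], ![-54, -30, -9], ![0, -50, -5], ![54, -30, -9]]
  dirX := ![![45, -15, 0], ![45, 5, -5], ![-9, -15, -9], ![45, 5, 5], ![-9, -15, 9]]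
  dirY := ![![0, -30, 0], ![0, 10, -10], ![0, -30, 0], ![0, 10, 10], ![0, -30, 0]]
  partner := Function.uncurry
    ![![(2, 3), (8, 4), (4, 1), (1, 2), (1, 1), (3, 2)],
      ![(3, 3), (0, 4), (0, 3), (4, 0), (6, 1), (3, 4)],
      ![(9, 3), (8, 0), (8, 5), (0, 0), (3, 1), (9, 4)],
      ![(9, 5), (2, 4), (0, 5), (1, 0), (1, 5), (6, 0)],
      ![(1, 3), (0, 2), (8, 3), (7, 4), (5, 1), (6, 2)],
      ![(6, 3), (4, 4), (7, 3), (5, 4), (5, 3), (7, 2)],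
      ![(3, 5), (1, 4), (4, 5), (5, 0), (7, 1), (9, 0)],
      ![(9, 1), (6, 4), (5, 5), (5, 2), (4, 3), (8, 2)],
      ![(2, 1), (9, 2), (7, 5), (4, 2), (0, 1), (2, 2)],
      ![(6, 5), (7, 0), (8, 1), (2, 0), (2, 5), (3, 0)]]
  placement :=
    ![⟨0, 0, 0, (-1, -1), 0⟩, ⟨2, 0, 0, (-1, -1), 0⟩, ⟨0, 1, 0, (0, -3), 2⟩, ⟨1, 1, 0, (0, -3), 2⟩,
      ⟨4, 1, 2, (2, -4), 3⟩, ⟨2, 1, 4, (-2, -2), 3⟩, ⟨0, 2, 0, (0, 0), 6⟩, ⟨3, 2, 0, (0, 0), 6⟩,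
      ⟨2, 2, 0, (0, 0), 6⟩, ⟨4, 2, 0, (0, 0), 6⟩, ⟨0, 3, 0, (1, -2), 10⟩, ⟨4, 3, 0, (1, -2), 10⟩,
      ⟨1, 4, 0, (-1, -4), 12⟩, ⟨2, 4, 4, (-3, 0), 12⟩, ⟨1, 5, 0, (0, -6), 14⟩,
      ⟨4, 5, 2, (5, -4), 14⟩, ⟨2, 5, 4, (-5, 1), 14⟩, ⟨3, 5, 4, (1, 4), 15⟩, ⟨3, 5, 2, (-1, 5), 16⟩,
      ⟨1, 6, 0, (1, -5), 19⟩, ⟨4, 6, 2, (3, -3), 19⟩, ⟨2, 7, 0, (-4, 2), 21⟩, ⟨3, 7, 4, (0, 3), 21⟩,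
      ⟨4, 7, 2, (4, -2), 22⟩, ⟨2, 8, 0, (-2, 1), 24⟩, ⟨0, 8, 0, (-2, 1), 24⟩,
      ⟨3, 8, 4, (-1, 2), 24⟩, ⟨3, 9, 0, (1, 1), 27⟩, ⟨4, 9, 4, (2, -1), 27⟩, ⟨0, 9, 4, (2, -1), 28⟩]
  home :=
    ![![0, 0, 1, 1, 0, 0], ![2, 2, 2, 5, 3, 4], ![6, 7, 6, 6, 6, 6], ![11, 10, 10, 10, 10, 11],
      ![12, 13, 13, 13, 13, 12], ![15, 14, 16, 18, 14, 17], ![20, 20, 19, 19, 20, 20],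
      ![22, 23, 23, 22, 21, 21], ![24, 26, 26, 24, 24, 24], ![28, 28, 27, 27, 27, 28]]
  innerPoint :=
    ![(0, ![0, 0, 0, 0, 0, 1]), (12, ![0, 0, 0, 0, 0, 1]), (21, ![0, 0, 0, 0, 0, 1]),
      (17, ![0, 0, 0, 0, 0, 1]), (4, ![0, 0, 0, 0, 0, 1])]

/-- The vertices of the solid of `pyramidPlan`. -/
def pyramidVertex : Fin 5 → Fin 3 → ℤ :=
  ![![0, 0, 45], ![45, 45, 0], ![-45, 45, 0], ![-45, -45, 0], ![45, -45, 0]]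

/-- A triangulation of the solid of `pyramidPlan`. -/
def pyramidCuts : CutTree 5 :=
  .cut ![0, -1, 1, 0]
    (.leaf ![0, 1, 2, 3] 90 ![2, 1, 1, 1] ![0, 2, 5, 1])
    (.leaf ![0, 1, 3, 4] 90 ![2, 1, 1, 1] ![0, 3, 4, 5])

theorem pyramidPlan_valid : pyramidPlan.Valid := by constructor <;> decide +kernel

theorem pyramidPlan_isPolyhedron :
    pyramidPlan.IsPolyhedron pyramidVertex pyramidCuts squarePyramid := by
  constructor <;> decide +kernel

/-- Four hexagons folded to a regular octahedron. -/
def octahedronPlan : HexPlan 8 4 16 where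
  weight := ![1, 1, 1]
  den := 6
  facet :=
    ![![3, -1, -1, -1], ![3, -1, -1, 1], ![3, -1, 1, -1], ![3, -1, 1, 1], ![3, 1, -1, -1],
      ![3, 1, -1, 1], ![3, 1, 1, -1], ![3, 1, 1, 1]]
  base :=
    ![![1, 1, 1], ![2, 2, 1], ![2, 1, 2], ![4, 2, -1], ![1, 2, 2], ![2, 4, -1], ![-1, 2, 4],
      ![-2, 4, -5]]
  dirX :=
    ![![2, -1, -1], ![1, -2, -1], ![1, -1, -2], ![-1, -2, 1], ![2, 1, 1], ![1, -1, -2], ![1, 1, 2],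
      ![2, -1, -1]]
  dirY :=
    ![![1, 1, -2], ![-1, -1, -2], ![2, 1, -1], ![-2, -1, -1], ![1, 2, -1], ![-1, -2, -1],
      ![-1, 2, 1], ![1, -2, 1]]
  partner := Function.uncurry
    ![![(2, 3), (1, 4), (1, 3), (3, 2), (3, 1), (2, 4)],
      ![(2, 1), (3, 4), (3, 3), (0, 2), (0, 1), (2, 2)],
      ![(3, 5), (1, 0), (1, 5), (0, 0), (0, 5), (3, 0)],
      ![(2, 5), (0, 4), (0, 3), (1, 2), (1, 1), (2, 0)]]
  placement :=
    ![⟨0, 0, 0, (0, 0), 0⟩, ⟨1, 0, 0, (0, 0), 0⟩, ⟨4, 0, 0, (0, 0), 0⟩, ⟨2, 0, 0, (0, 0), 0⟩,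
      ⟨1, 1, 0, (-1, 2), 4⟩, ⟨5, 1, 0, (-1, 2), 4⟩, ⟨4, 1, 2, (-2, 1), 5⟩, ⟨7, 1, 0, (-1, 2), 5⟩,
      ⟨1, 2, 0, (1, 1), 8⟩, ⟨3, 2, 0, (1, 1), 8⟩, ⟨2, 2, 4, (2, -1), 9⟩, ⟨7, 2, 2, (0, 3), 9⟩,
      ⟨2, 3, 0, (1, -2), 12⟩, ⟨6, 3, 4, (-1, -1), 12⟩, ⟨7, 3, 0, (-2, 4), 13⟩,
      ⟨4, 3, 4, (-1, -1), 13⟩]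
  home :=
    ![![0, 1, 0, 2, 0, 3], ![4, 7, 5, 6, 4, 4], ![9, 11, 8, 8, 8, 10], ![12, 12, 12, 15, 13, 14]]
  innerPoint :=
    ![(0, ![0, 0, 0, 1, 0, 1]), (4, ![0, 0, 0, 0, 0, 1]), (3, ![0, 0, 0, 0, 0, 1]),
      (9, ![0, 0, 0, 1, 0, 1]), (2, ![0, 0, 0, 1, 0, 0]), (5, ![0, 0, 0, 1, 0, 1]),
      (13, ![0, 0, 0, 1, 0, 1]), (14, ![0, 0, 0, 0, 0, 1])]

/-- The vertices of the solid of `octahedronPlan`. -/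
def octahedronVertex : Fin 6 → Fin 3 → ℤ :=
  ![![3, 0, 0], ![-3, 0, 0], ![0, 3, 0], ![0, -3, 0], ![0, 0, 3], ![0, 0, -3]]

/-- A triangulation of the solid of `octahedronPlan`. -/
def octahedronCuts : CutTree 6 :=
  .cut ![0, 0, 1, 0]
    (.cut ![0, 0, 0, 1]
      (.leaf ![0, 1, 2, 4] 6 ![1, 1, 2, 2] ![4, 0, 8, 9])
      (.leaf ![0, 1, 2, 5] 6 ![1, 1, 2, 2] ![5, 1, 8, 9]))
    (.cut ![0, 0, 0, 1]
      (.leaf ![0, 1, 3, 4] 6 ![1, 1, 2, 2] ![6, 2, 8, 9])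
      (.leaf ![0, 1, 3, 5] 6 ![1, 1, 2, 2] ![7, 3, 8, 9]))

theorem octahedronPlan_valid : octahedronPlan.Valid := by constructor <;> decide +kernel

theorem octahedronPlan_isPolyhedron :
    octahedronPlan.IsPolyhedron octahedronVertex octahedronCuts octahedron := by
  constructor <;> decide +kernel

/-- Eleven hexagons folded to a triangular bipyramid with a further stacked vertex. -/
def stackedPlan : HexPlan 8 11 38 where
  weight := ![1, 1, 507]
  den := 8112
  facet :=
    ![![3042, -12, -5, -507], ![3042, -12, -5, 507], ![0, -5, 12, 0], ![234, 0, -1, -39],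
      ![234, 0, -1, 39], ![0, 5, 12, 0], ![3042, 12, -5, -507], ![3042, 12, -5, 507]]
  base :=
    ![![150, 147, 1], ![222, 177, 1], ![216, 90, 4], ![156, 156, 2], ![156, 312, 2], ![216, -90, 4],
      ![126, 201, 7], ![-378, 411, 7]]
  dirX :=
    ![![6, 87, -1], ![-66, 57, -1], ![72, 30, 2], ![0, 78, -2], ![0, -78, -2], ![72, -30, 2],
      ![-6, 87, -1], ![66, 57, -1]]
  dirY :=
    ![![-66, 57, 1], ![6, 87, 1], ![0, 0, 4], ![-78, 39, -1], ![-78, -39, -1], ![0, 0, 4],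
      ![-72, 30, -2], ![72, -30, -2]]
  partner := Function.uncurry
    ![![(8, 3), (6, 4), (6, 3), (5, 0), (2, 3), (1, 2)],
      ![(3, 1), (8, 4), (0, 5), (2, 2), (2, 1), (3, 2)],
      ![(3, 3), (1, 4), (1, 3), (0, 4), (5, 5), (4, 2)],
      ![(8, 5), (1, 0), (1, 5), (2, 0), (4, 1), (9, 4)],
      ![(9, 5), (3, 4), (2, 5), (5, 4), (5, 3), (10, 4)],
      ![(0, 3), (6, 2), (10, 5), (4, 4), (4, 3), (2, 4)],
      ![(7, 3), (10, 0), (5, 1), (0, 2), (0, 1), (8, 2)],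
      ![(9, 1), (10, 2), (10, 1), (6, 0), (8, 1), (9, 2)],
      ![(9, 3), (7, 4), (6, 5), (0, 0), (1, 1), (3, 0)],
      ![(10, 3), (7, 0), (7, 5), (8, 0), (3, 5), (4, 0)],
      ![(6, 1), (7, 2), (7, 1), (9, 0), (4, 5), (5, 2)]]
  placement :=
    ![⟨0, 0, 0, (-2, 1), 0⟩, ⟨3, 0, 0, (-2, 1), 0⟩, ⟨2, 0, 0, (-2, 1), 0⟩, ⟨5, 0, 0, (-2, 1), 2⟩,
      ⟨0, 1, 0, (0, 0), 4⟩, ⟨3, 1, 0, (0, 0), 4⟩, ⟨2, 1, 0, (0, 0), 4⟩, ⟨1, 1, 0, (0, 0), 4⟩,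
      ⟨1, 2, 0, (1, -2), 8⟩, ⟨2, 2, 4, (-1, -1), 8⟩, ⟨0, 2, 4, (-1, -1), 9⟩, ⟨1, 3, 0, (2, -1), 11⟩,
      ⟨4, 3, 2, (1, 1), 11⟩, ⟨3, 3, 2, (1, 1), 12⟩, ⟨1, 4, 0, (3, -3), 14⟩, ⟨2, 4, 4, (-2, -2), 14⟩,
      ⟨4, 4, 2, (2, 2), 14⟩, ⟨7, 4, 4, (-2, 7), 16⟩, ⟨5, 4, 2, (-4, -1), 17⟩,
      ⟨2, 5, 0, (-3, 0), 19⟩, ⟨5, 5, 0, (-3, 0), 19⟩, ⟨1, 5, 2, (2, -4), 19⟩,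
      ⟨7, 5, 2, (-4, 8), 20⟩, ⟨3, 6, 0, (-3, 3), 23⟩, ⟨6, 6, 0, (-3, 3), 23⟩,
      ⟨5, 6, 2, (-4, 2), 24⟩, ⟨2, 6, 2, (-4, 2), 25⟩, ⟨3, 7, 0, (-2, 4), 27⟩,
      ⟨6, 7, 0, (-2, 4), 27⟩, ⟨5, 7, 2, (-6, 3), 28⟩, ⟨7, 7, 0, (-2, 4), 28⟩,
      ⟨3, 8, 0, (-1, 2), 31⟩, ⟨3, 9, 0, (0, 3), 32⟩, ⟨4, 9, 0, (0, 3), 32⟩, ⟨7, 9, 2, (-1, 5), 33⟩,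
      ⟨5, 10, 0, (-5, 1), 35⟩, ⟨6, 10, 4, (-4, 5), 35⟩, ⟨7, 10, 2, (-3, 6), 35⟩]
  home :=
    ![![0, 1, 0, 2, 2, 0], ![4, 5, 4, 4, 4, 7], ![8, 8, 8, 9, 9, 8], ![12, 13, 11, 11, 11, 12],
      ![16, 16, 14, 14, 14, 17], ![19, 19, 20, 20, 19, 19], ![23, 24, 25, 25, 23, 23],
      ![27, 30, 28, 28, 27, 27], ![31, 31, 31, 31, 31, 31], ![33, 34, 32, 32, 32, 33],
      ![35, 35, 35, 37, 37, 35]]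
  innerPoint :=
    ![(4, ![0, 0, 0, 1, 0, 1]), (7, ![0, 0, 0, 0, 0, 1]), (2, ![0, 0, 0, 0, 1, 0]),
      (23, ![0, 0, 0, 0, 0, 1]), (12, ![0, 0, 0, 0, 0, 1]), (20, ![0, 0, 1, 0, 0, 0]),
      (28, ![0, 0, 0, 1, 0, 1]), (37, ![0, 0, 0, 1, 0, 0])]

/-- The vertices of the solid of `stackedPlan`. -/
def stackedVertex : Fin 6 → Fin 3 → ℤ :=
  ![![156, 234, 0], ![-216, 90, 0], ![0, 0, 6], ![0, 0, -6], ![-156, 234, 0], ![216, 90, 0]]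

/-- A triangulation of the solid of `stackedPlan`. -/
def stackedCuts : CutTree 6 :=
  .cut ![0, 3, -2, 0]
    (.leaf ![5, 0, 2, 3] 6084 ![13, 3, 1, 1] ![8, 2, 1, 0])
    (.cut ![0, 3, 2, 0]
      (.leaf ![0, 2, 3, 4] 936 ![1, 2, 2, 1] ![9, 4, 3, 8])
      (.leaf ![1, 2, 3, 4] 6084 ![13, 1, 1, 3] ![9, 7, 6, 5]))

theorem stackedPlan_valid : stackedPlan.Valid := by constructor <;> decide +kernel

theorem stackedPlan_isPolyhedron :
    stackedPlan.IsPolyhedron stackedVertex stackedCuts stackedBipyramid := by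
  constructor <;> decide +kernel

/-- Three hexagons folded to a triangular prism. -/
def prismPlan : HexPlan 5 3 15 where
  weight := ![3, 9, 4]
  den := 144
  facet := ![![0, 0, 0, 1], ![6, 0, 0, -1], ![0, 0, 1, 0], ![0, 1, -1, 0], ![12, -1, -1, 0]]
  base := ![![0, 4, 0], ![18, 10, 6], ![0, 0, -6], ![3, 3, 3], ![6, 6, -6]]
  dirX := ![![0, 4, 0], ![-6, 2, 0], ![0, 0, -6], ![3, 3, 3], ![-3, 3, 3]]
  dirY := ![![6, 2, 0], ![-6, -2, 0], ![6, 0, -3], ![3, 3, -3], ![0, 0, 6]]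
  partner := Function.uncurry
    ![![(1, 3), (1, 2), (1, 1), (2, 4), (2, 3), (2, 2)],
      ![(2, 5), (0, 2), (0, 1), (0, 0), (2, 1), (2, 0)],
      ![(1, 5), (1, 4), (0, 5), (0, 4), (0, 3), (1, 0)]]
  placement :=
    ![⟨0, 0, 0, (-2, 1), 0⟩, ⟨2, 0, 0, (-2, 1), 0⟩, ⟨4, 0, 4, (-3, 3), 1⟩, ⟨1, 0, 2, (-2, 4), 1⟩,
      ⟨3, 0, 2, (-1, -1), 1⟩, ⟨0, 1, 0, (-1, 2), 5⟩, ⟨4, 1, 0, (-1, 2), 5⟩, ⟨3, 1, 4, (1, 1), 6⟩,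
      ⟨1, 1, 0, (-1, 2), 6⟩, ⟨2, 1, 2, (-3, 3), 6⟩, ⟨0, 2, 0, (0, 0), 10⟩, ⟨3, 2, 0, (0, 0), 10⟩,
      ⟨1, 2, 4, (0, 3), 11⟩, ⟨4, 2, 2, (1, 1), 11⟩, ⟨2, 2, 4, (-1, -1), 11⟩]
  home := ![![0, 0, 1, 3, 1, 0], ![6, 8, 6, 5, 5, 5], ![11, 10, 10, 10, 11, 12]]
  innerPoint :=
    ![(5, ![0, 0, 0, 0, 1, 0]), (12, ![0, 0, 0, 0, 0, 1]), (1, ![0, 0, 0, 1, 0, 1]),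
      (11, ![0, 0, 0, 1, 0, 1]), (6, ![0, 0, 1, 0, 0, 1])]

/-- The vertices of the solid of `prismPlan`. -/
def prismVertex : Fin 6 → Fin 3 → ℤ :=
  ![![0, 0, 0], ![12, 0, 0], ![6, 6, 0], ![0, 0, 6], ![12, 0, 6], ![6, 6, 6]]

/-- A triangulation of the solid of `prismPlan`. -/
def prismCuts : CutTree 6 :=
  .cut ![0, 0, 1, -1]
    (.leaf ![0, 1, 2, 5] 12 ![1, 1, 2, 2] ![4, 3, 5, 0])
    (.cut ![0, 1, 1, -2]
      (.leaf ![0, 1, 4, 5] 12 ![1, 1, 2, 2] ![4, 6, 5, 2])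
      (.leaf ![0, 3, 4, 5] 12 ![2, 1, 1, 2] ![1, 6, 3, 2]))

theorem prismPlan_valid : prismPlan.Valid := by constructor <;> decide +kernel

theorem prismPlan_isPolyhedron :
    prismPlan.IsPolyhedron prismVertex prismCuts triangularPrism := by
  constructor <;> decide +kernel

/-! ### Special shapes -/

lemma HexPlan.latticePos_eq {nf nh np : ℕ} (D : HexPlan nf nh np) (x : Fin 3 → ℤ) :
    D.latticePos x = !₂[D.len 0 * x 0, D.len 1 * x 1, D.len 2 * x 2] := by
  ext t
  fin_cases t <;> rfl

lemma isRightRectangularPyramid_pyramidPlan :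
    IsRightRectangularPyramid
      (convexHull ℝ (Set.range fun i => pyramidPlan.latticePos (pyramidVertex i))) := by
  have hlen := pyramidPlan_valid.len_pos
  refine ⟨IsometryEquiv.refl _, pyramidPlan.len 0 * 45, pyramidPlan.len 1 * 45,
    pyramidPlan.len 2 * 45, mul_pos (hlen 0) (by norm_num), mul_pos (hlen 1) (by norm_num),
    mul_pos (hlen 2) (by norm_num), (congrArg _ ?_).trans (Set.image_id _).symm⟩
  ext x
  simp [pyramidVertex, HexPlan.latticePos_eq, Fin.exists_fin_succ, eq_comm (b := x)]
  tauto

lemma isRegularOctahedron_octahedronPlan :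
    IsRegularOctahedron
      (convexHull ℝ (Set.range fun i => octahedronPlan.latticePos (octahedronVertex i))) := by
  have hlen (t : Fin 3) : octahedronPlan.len t = octahedronPlan.len 0 := by
    fin_cases t <;> rfl
  refine ⟨IsometryEquiv.refl _, octahedronPlan.len 0 * 3,
    mul_pos (octahedronPlan_valid.len_pos 0) (by norm_num),
    (congrArg _ ?_).trans (Set.image_id _).symm⟩
  ext x
  simp [octahedronVertex, HexPlan.latticePos_eq, hlen 1, hlen 2, Fin.exists_fin_succ,
    eq_comm (b := x)]

lemma affineIndependent_prismPlan :
    AffineIndependent ℝ ![prismPlan.latticePos (prismVertex 0),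
      prismPlan.latticePos (prismVertex 1), prismPlan.latticePos (prismVertex 2),
      prismPlan.latticePos (prismVertex 3)] := by
  have hlen (t : Fin 3) : prismPlan.len t ≠ 0 := (prismPlan_valid.len_pos t).ne'
  rw [affineIndependent_iff_of_fintype]
  intro w hw hsum
  rw [Finset.weightedVSub_eq_linear_combination _ hw] at hsum
  have hcoord (t : Fin 3) := congrArg (fun x : E3 => x t) hsum
  have h2 : w 2 = 0 := by
    simpa [Fin.sum_univ_four, HexPlan.latticePos_eq, prismVertex, hlen] using hcoord 1
  have h3 : w 3 = 0 := by
    simpa [Fin.sum_univ_four, HexPlan.latticePos_eq, prismVertex, hlen] using hcoord 2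
  have h1 : w 1 = 0 := by
    simpa [Fin.sum_univ_four, HexPlan.latticePos_eq, prismVertex, hlen, h2] using hcoord 0
  have h0 : w 0 = 0 := by
    simpa [Fin.sum_univ_four, h1, h2, h3] using hw
  exact Fin.forall_fin_succ.2 ⟨h0, Fin.forall_fin_succ.2 ⟨h1, Fin.forall_fin_two.2 ⟨h2, h3⟩⟩⟩

lemma prismPlan_latticePos_add (i : Fin 3) :
    prismPlan.latticePos (prismVertex (i.castLE (by lia))) + prismPlan.latticePos (prismVertex 3) =
      prismPlan.latticePos (prismVertex (i.natAdd 3)) := by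
  ext t
  fin_cases i <;> fin_cases t <;> simp [HexPlan.latticePos_eq, prismVertex]

lemma isTriangularPrism_prismPlan :
    IsTriangularPrism
      (convexHull ℝ (Set.range fun i => prismPlan.latticePos (prismVertex i))) := by
  have hadd := prismPlan_latticePos_add
  have h0 := hadd 0
  have h1 := hadd 1
  have h2 := hadd 2
  simp only [Fin.isValue, Fin.castLE_zero, Fin.reduceCastLE, Fin.reduceNatAdd] at h0 h1 h2
  refine ⟨prismPlan.latticePos (prismVertex 0), prismPlan.latticePos (prismVertex 1),
    prismPlan.latticePos (prismVertex 2), prismPlan.latticePos (prismVertex 3), ?_, ?_⟩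
  · rw [h0]
    exact affineIndependent_prismPlan
  · rw [h0, h1, h2]
    congr 1
    ext x
    simp [Fin.exists_fin_succ, eq_comm (b := x)]

/-! ### Gale duality -/

section PositiveDependence

variable {ι κ W W' : Type*} [AddCommGroup W] [Module ℝ W] [AddCommGroup W'] [Module ℝ W']
  {a : ι → W} {T : Finset ι}

/-- The vectors `a i` with `i ∈ T` satisfy a linear relation with positive coefficients. -/
def IsPositivelyDependent (a : ι → W) (T : Finset ι) : Prop :=
  ∃ w : ι → ℝ, (∀ i ∈ T, 0 < w i) ∧ ∑ i ∈ T, w i • a i = 0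

lemma IsPositivelyDependent.map (h : IsPositivelyDependent a T) (f : W →ₗ[ℝ] W') :
    IsPositivelyDependent (f ∘ a) T := by
  obtain ⟨w, hw, hsum⟩ := h
  refine ⟨w, hw, ?_⟩
  simp only [Function.comp_apply, ← map_smul, ← map_sum, hsum, map_zero]

lemma IsPositivelyDependent.image [DecidableEq ι] {t : κ → ι} {T : Finset κ}
    (h : IsPositivelyDependent (a ∘ t) T) : IsPositivelyDependent a (T.image t) := by
  obtain ⟨w, hw, hsum⟩ := h
  refine ⟨fun i => ∑ k ∈ T with t k = i, w k, fun i hi => ?_, ?_⟩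
  · obtain ⟨k, hk, rfl⟩ := Finset.mem_image.1 hi
    exact Finset.sum_pos (fun l hl => hw l (Finset.mem_filter.1 hl).1)
      ⟨k, Finset.mem_filter.2 ⟨hk, rfl⟩⟩
  · rw [← hsum, ← Finset.sum_fiberwise_of_maps_to fun k hk => Finset.mem_image_of_mem t hk]
    refine Finset.sum_congr rfl fun i _ => ?_
    rw [Finset.sum_smul]
    exact Finset.sum_congr rfl fun k hk => by
      rw [Function.comp_apply, (Finset.mem_filter.1 hk).2]

lemma isPositivelyDependent_pair [DecidableEq ι] {i j : ι} {x y : ℝ} (hx : 0 < x) (hy : 0 < y)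
    (h : x • a i + y • a j = 0) : IsPositivelyDependent a {i, j} := by
  have himage : Finset.univ.image ![i, j] = {i, j} := by simp [Fin.univ_succ]
  rw [← himage]
  exact .image ⟨![x, y], by simp [hx, hy], by simpa using h⟩

lemma isPositivelyDependent_triple [DecidableEq ι] {i j k : ι} {x y z : ℝ} (hx : 0 < x)
    (hy : 0 < y) (hz : 0 < z) (h : x • a i + y • a j + z • a k = 0) :
    IsPositivelyDependent a {i, j, k} := by
  have himage : Finset.univ.image ![i, j, k] = {i, j, k} := by simp [Fin.univ_succ]
  rw [← himage]
  exact .image ⟨![x, y, z], by simp [Fin.forall_fin_succ, hx, hy, hz],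
    by simpa [Fin.sum_univ_three] using h⟩

lemma isPositivelyDependent_of_forall_mem
    (h : ∀ i ∈ T, ∃ U ⊆ T, i ∈ U ∧ IsPositivelyDependent a U) : IsPositivelyDependent a T := by
  classical
  choose! U hUT hmem w hw hsum using h
  refine ⟨fun i => ∑ l ∈ T, if i ∈ U l then w l i else 0, fun i hi => ?_, ?_⟩
  · refine Finset.sum_pos' (fun l hl => ?_) ⟨i, hi, ?_⟩
    · split_ifs with hil
      exacts [(hw l hl i hil).le, le_rfl]
    · rw [if_pos (hmem i hi)]
      exact hw i hi i (hmem i hi)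
  · simp only [Finset.sum_smul, ite_smul, zero_smul]
    rw [Finset.sum_comm]
    refine Finset.sum_eq_zero fun l hl => ?_
    rw [Finset.sum_ite_mem, Finset.inter_eq_right.2 (hUT l hl), hsum l hl]

lemma IsPositivelyDependent.eq_zero_of_nonneg (h : IsPositivelyDependent a T) {φ : W →ₗ[ℝ] ℝ}
    (hφ : ∀ i ∈ T, 0 ≤ φ (a i)) : ∀ i ∈ T, φ (a i) = 0 := by
  obtain ⟨w, hw, hsum⟩ := h
  have hzero : ∑ i ∈ T, w i * φ (a i) = 0 := by
    simpa only [map_sum, map_smul, smul_eq_mul, map_zero] using congrArg φ hsum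
  intro i hi
  have hi0 := (Finset.sum_eq_zero_iff_of_nonneg fun j hj =>
    mul_nonneg (hw j hj).le (hφ j hj)).1 hzero i hi
  exact (mul_eq_zero.1 hi0).resolve_left (hw i hi).ne'

end PositiveDependence

section GaleDual

variable {ι E W W' : Type*} [Fintype ι] [AddCommGroup E] [Module ℝ E] [AddCommGroup W]
  [Module ℝ W] [AddCommGroup W'] [Module ℝ W'] {a : ι → W} {v : ι → E}

/-- The vectors `a` are a Gale dual of the points `v`: the linear relations between them are the
families of values of affine functionals at the points `v`. -/
def IsGaleDual (a : ι → W) (v : ι → E) : Prop :=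
  ∀ w : ι → ℝ, ∑ i, w i • a i = 0 ↔ ∃ φ : E →ᵃ[ℝ] ℝ, ∀ i, φ (v i) = w i

lemma exists_isGaleDual [FiniteDimensional ℝ E] [FiniteDimensional ℝ W]
    (hspan : affineSpan ℝ (Set.range v) = ⊤)
    (hdim : Module.finrank ℝ W + Module.finrank ℝ E + 1 = Fintype.card ι) :
    ∃ a : ι → W, IsGaleDual a v := by
  classical
  let values : (E →ᵃ[ℝ] ℝ) →ₗ[ℝ] ι → ℝ :=
    { toFun := fun φ i => φ (v i), map_add' := fun _ _ => rfl, map_smul' := fun _ _ => rfl }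
  have hinj : Function.Injective values := fun φ ψ h => by
    refine AffineMap.ext_on hspan ?_
    rintro _ ⟨i, rfl⟩
    exact congrFun h i
  have hrank : Module.finrank ℝ ((ι → ℝ) ⧸ LinearMap.range values) = Module.finrank ℝ W := by
    have hsum := (LinearMap.range values).finrank_quotient_add_finrank
    rw [LinearMap.finrank_range_of_inj hinj, AffineMap.finrank_eq, Module.finrank_self, mul_one,
      Module.finrank_fintype_fun_eq_card] at hsum
    lia
  let e := LinearEquiv.ofFinrankEq _ _ hrank
  let f : (ι → ℝ) →ₗ[ℝ] W := e.toLinearMap ∘ₗ (LinearMap.range values).mkQ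
  refine ⟨fun i => f fun j => if i = j then 1 else 0, fun w => ?_⟩
  rw [← LinearMap.pi_apply_eq_sum_univ]
  calc f w = 0 ↔ (LinearMap.range values).mkQ w = 0 := e.map_eq_zero_iff
    _ ↔ ∃ φ, values φ = w := by rw [Submodule.mkQ_apply, Submodule.Quotient.mk_eq_zero]; rfl
    _ ↔ ∃ φ : E →ᵃ[ℝ] ℝ, ∀ i, φ (v i) = w i := exists_congr fun _ => funext_iff

namespace IsGaleDual

lemma map (h : IsGaleDual a v) {f : W →ₗ[ℝ] W'} (hf : Function.Injective f) :
    IsGaleDual (f ∘ a) v := fun w => by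
  rw [← h w, ← map_eq_zero_iff f hf, map_sum]
  simp only [Function.comp_apply, map_smul]

lemma comp (h : IsGaleDual a v) (σ : Equiv.Perm ι) : IsGaleDual (a ∘ σ) (v ∘ σ) := fun w => by
  have hsum := Equiv.sum_comp σ fun i => (w ∘ σ.symm) i • a i
  simp only [Function.comp_apply, Equiv.symm_apply_apply] at hsum
  simp only [Function.comp_apply, hsum, h _]
  refine exists_congr fun φ => ⟨fun hφ i => ?_, fun hφ i => ?_⟩
  · rw [hφ, Equiv.symm_apply_apply]
  · rw [← hφ, Equiv.apply_symm_apply]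

lemma isFaceSet_iff [DecidableEq ι] (h : IsGaleDual a v) {S : Finset ι} :
    IsFaceSet v S ↔ IsPositivelyDependent a Sᶜ := by
  constructor
  · rintro ⟨φ, hzero, hpos⟩
    refine ⟨fun i => φ (v i), fun i hi => hpos i (Finset.mem_compl.1 hi), ?_⟩
    rw [← (h _).2 ⟨φ, fun _ => rfl⟩]
    refine Finset.sum_subset (Finset.subset_univ _) fun i _ hi => ?_
    exact smul_eq_zero_of_left (hzero i (by simpa using hi)) _
  · rintro ⟨w, hw, hsum⟩
    obtain ⟨φ, hφ⟩ := (h fun i => if i ∈ Sᶜ then w i else 0).1 (by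
      simp only [ite_smul, zero_smul]
      rw [Finset.sum_ite_mem, Finset.univ_inter, hsum])
    refine ⟨φ, fun i hi => ?_, fun i hi => ?_⟩
    · rw [hφ, if_neg (by simpa using hi)]
    · rw [hφ, if_pos (Finset.mem_compl.2 hi)]
      exact hw i (Finset.mem_compl.2 hi)

end IsGaleDual

end GaleDual

/-! ### Positive dependence in dimensions one and two -/

section Signs

variable {ι : Type*} {ε : ι → Bool} {T : Finset ι}

/-- The set contains elements of both signs, encoded as `true` and `false`. -/
def BothSigns (ε : ι → Bool) (T : Finset ι) : Prop :=
  (∃ i ∈ T, ε i = true) ∧ ∃ i ∈ T, ε i = false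

instance : DecidablePred (BothSigns ε) := fun _ =>
  inferInstanceAs (Decidable (_ ∧ _))

lemma isPositivelyDependent_iff_bothSigns {c : ι → ℝ} (hc : ∀ i, c i ≠ 0) (hT : T.Nonempty) :
    IsPositivelyDependent c T ↔ BothSigns (fun i => decide (0 < c i)) T := by
  classical
  simp only [BothSigns, decide_eq_true_eq, decide_eq_false_iff_not]
  constructor
  · intro h
    obtain ⟨i, hi⟩ := hT
    constructor
    · by_contra! hneg
      exact hc i (neg_eq_zero.1 (h.eq_zero_of_nonneg (φ := -LinearMap.id)
        (fun j hj => neg_nonneg.2 (hneg j hj)) i hi))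
    · by_contra! hpos
      exact hc i (h.eq_zero_of_nonneg (φ := LinearMap.id) (fun j hj => (hpos j hj).le) i hi)
  · rintro ⟨⟨i, hi, hipos⟩, k, hk, hkneg⟩
    have hpair {p q : ι} (hp : 0 < c p) (hq : ¬ 0 < c q) : IsPositivelyDependent c {p, q} :=
      isPositivelyDependent_pair (neg_pos.2 ((not_lt.1 hq).lt_of_ne (hc q))) hp
        (by simp only [smul_eq_mul]; ring)
    refine isPositivelyDependent_of_forall_mem fun l hl => ?_
    by_cases hlpos : 0 < c l
    · exact ⟨{l, k}, by grind, by simp, hpair hlpos hkneg⟩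
    · exact ⟨{i, l}, by grind, by simp, hpair hipos hlpos⟩

variable [LinearOrder ι]

/-- The signs along the set change at least twice. -/
def Alternates (ε : ι → Bool) (T : Finset ι) : Prop :=
  ∃ j ∈ T, ∃ i ∈ T, i < j ∧ ε i ≠ ε j ∧ ∃ k ∈ T, j < k ∧ ε j ≠ ε k

instance : DecidablePred (Alternates ε) := fun T =>
  inferInstanceAs (Decidable (∃ j ∈ T, ∃ i ∈ T, _))

lemma Alternates.exists_triple (h : Alternates ε T) {l : ι} (hl : l ∈ T) :
    ∃ i ∈ T, ∃ j ∈ T, ∃ k ∈ T, i < j ∧ j < k ∧ ε i ≠ ε j ∧ ε j ≠ ε k ∧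
      (l = i ∨ l = j ∨ l = k) := by
  obtain ⟨j, hj, i, hi, hij, hεij, k, hk, hjk, hεjk⟩ := h
  by_cases hεl : ε l = ε j
  · rcases lt_trichotomy l i with hli | rfl | hil
    · exact ⟨l, hl, i, hi, j, hj, hli, hij, by rw [hεl]; exact hεij.symm, hεij, .inl rfl⟩
    · exact absurd hεl hεij
    · rcases lt_trichotomy l k with hlk | rfl | hkl
      · exact ⟨i, hi, l, hl, k, hk, hil, hlk, by rwa [hεl], by rwa [hεl], .inr (.inl rfl)⟩
      · exact absurd hεl.symm hεjk
      · exact ⟨j, hj, k, hk, l, hl, hjk, hkl, hεjk, by rw [hεl]; exact hεjk.symm, .inr (.inr rfl)⟩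
  · rcases lt_trichotomy l j with hlj | rfl | hjl
    · exact ⟨l, hl, j, hj, k, hk, hlj, hjk, hεl, hεjk, .inl rfl⟩
    · exact absurd rfl hεl
    · exact ⟨i, hi, j, hj, l, hl, hij, hjl, hεij, Ne.symm hεl, .inr (.inr rfl)⟩

lemma exists_forall_lt_of_not_alternates (hT : T.Nonempty) (h : ¬ Alternates ε T) :
    ∃ b, ∀ p ∈ T, ∀ q ∈ T, ε p = b → ε q ≠ b → p < q := by
  refine ⟨ε (T.min' hT), fun p hp q hq hεp hεq => ?_⟩
  by_contra! hqp
  have hlt : q < p := hqp.lt_of_ne (by rintro rfl; exact hεq hεp)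
  have hmin : T.min' hT < q := (T.min'_le q hq).lt_of_ne (by rintro heq; exact hεq (heq ▸ rfl))
  exact h ⟨q, hq, _, T.min'_mem hT, hmin, hεq.symm, p, hp, hlt, by rwa [hεp]⟩

end Signs

section Plane

variable {ι : Type*} [LinearOrder ι] {β s : ι → ℝ} {T : Finset ι}

lemma mul_neg_iff_decide_ne {x y : ℝ} (hx : x ≠ 0) (hy : y ≠ 0) :
    x * y < 0 ↔ decide (0 < x) ≠ decide (0 < y) := by
  rw [mul_neg_iff, Ne, decide_eq_decide]
  grind

lemma isPositivelyDependent_of_alternates (hs : Monotone s) (hβ : ∀ i, β i ≠ 0)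
    (hpar : ∀ i j, s i = s j → 0 < β i * β j) (h : Alternates (fun i => decide (0 < β i)) T) :
    IsPositivelyDependent (fun i => β i • ((1 : ℝ), s i)) T := by
  have hlt {i j : ι} (hij : i < j) (hneg : β i * β j < 0) : s i < s j :=
    (hs hij.le).lt_of_ne fun heq => hneg.not_gt (hpar i j heq)
  refine isPositivelyDependent_of_forall_mem fun l hl => ?_
  obtain ⟨i, hi, j, hj, k, hk, hij, hjk, hεij, hεjk, hmem⟩ := h.exists_triple hl
  refine ⟨{i, j, k}, by grind, by simpa using hmem, ?_⟩
  have hβij : β i * β j < 0 := (mul_neg_iff_decide_ne (hβ i) (hβ j)).2 hεij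
  have hβjk : β j * β k < 0 := (mul_neg_iff_decide_ne (hβ j) (hβ k)).2 hεjk
  have hβik : 0 < β i * β k := by
    refine pos_of_mul_pos_left (b := β j ^ 2) ?_ (sq_nonneg _)
    calc 0 < (β i * β j) * (β j * β k) := mul_pos_of_neg_of_neg hβij hβjk
      _ = β i * β k * β j ^ 2 := by ring
  have hsij := sub_pos.2 (hlt hij hβij)
  have hsjk := sub_pos.2 (hlt hjk hβjk)
  refine isPositivelyDependent_triple (x := -(β j * β k) * (s k - s j))
    (y := β i * β k * (s k - s i)) (z := -(β i * β j) * (s j - s i))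
    (mul_pos (neg_pos.2 hβjk) hsjk) (mul_pos hβik (by linarith))
    (mul_pos (neg_pos.2 hβij) hsij) ?_
  ext <;> simp <;> ring

lemma not_isPositivelyDependent_of_forall_lt (hs : Monotone s) (hβ : ∀ i, β i ≠ 0)
    (hpar : ∀ i j, s i = s j → 0 < β i * β j) (hT : T.Nonempty)
    (hlt : ∀ p ∈ T, ∀ q ∈ T, 0 < β p → β q < 0 → p < q) :
    ¬ IsPositivelyDependent (fun i => β i • ((1 : ℝ), s i)) T := by
  intro h
  have hfst : IsPositivelyDependent β T := by
    simpa [Function.comp_def] using h.map (LinearMap.fst ℝ ℝ ℝ)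
  obtain ⟨⟨p₀, hp₀, hpos₀⟩, q, hq, hqneg⟩ := (isPositivelyDependent_iff_bothSigns hβ hT).1 hfst
  obtain ⟨p, hp, hmax⟩ := (T.filter (0 < β ·)).exists_max_image s
    ⟨p₀, Finset.mem_filter.2 ⟨hp₀, of_decide_eq_true hpos₀⟩⟩
  obtain ⟨hpT, hpos⟩ := Finset.mem_filter.1 hp
  have hslt {i : ι} (hi : i ∈ T) (hneg : β i < 0) : s p < s i :=
    (hs (hlt p hpT i hi hpos hneg).le).lt_of_ne fun heq =>
      (hpar p i heq).not_gt (mul_neg_of_pos_of_neg hpos hneg)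
  -- The functional `(x, y) ↦ s p * x - y` vanishes on the positive vector of largest slope.
  let φ : ℝ × ℝ →ₗ[ℝ] ℝ := s p • LinearMap.fst ℝ ℝ ℝ - LinearMap.snd ℝ ℝ ℝ
  have hφ (i : ι) : φ (β i • (1, s i)) = β i * (s p - s i) := by
    simp only [φ, map_smul, LinearMap.sub_apply, LinearMap.smul_apply, LinearMap.fst_apply,
      LinearMap.snd_apply, smul_eq_mul, mul_one]
  have hq0 : β q < 0 := (not_lt.1 (of_decide_eq_false hqneg)).lt_of_ne (hβ q)
  refine (h.eq_zero_of_nonneg (φ := φ) (fun i hi => ?_) q hq).not_gt ?_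
  · rw [hφ]
    rcases (hβ i).lt_or_gt with hi0 | hi0
    · exact (mul_pos_of_neg_of_neg hi0 (sub_neg.2 (hslt hi hi0))).le
    · exact mul_nonneg hi0.le (sub_nonneg.2 (hmax i (Finset.mem_filter.2 ⟨hi, hi0⟩)))
  · rw [hφ]
    exact mul_pos_of_neg_of_neg hq0 (sub_neg.2 (hslt hq hq0))

lemma isPositivelyDependent_iff_alternates (hs : Monotone s) (hβ : ∀ i, β i ≠ 0)
    (hpar : ∀ i j, s i = s j → 0 < β i * β j) (hT : T.Nonempty) :
    IsPositivelyDependent (fun i => β i • ((1 : ℝ), s i)) T ↔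
      Alternates (fun i => decide (0 < β i)) T := by
  refine ⟨fun h => ?_, isPositivelyDependent_of_alternates hs hβ hpar⟩
  by_contra halt
  obtain ⟨b, hb⟩ := exists_forall_lt_of_not_alternates hT halt
  cases b with
  | true =>
    exact not_isPositivelyDependent_of_forall_lt hs hβ hpar hT
      (fun p hp q hq hp0 hq0 => hb p hp q hq (by simpa using hp0) (by simpa using hq0.le)) h
  | false =>
    refine not_isPositivelyDependent_of_forall_lt (β := -β) hs (fun i => neg_ne_zero.2 (hβ i))
      (fun i j hij => by simpa using hpar i j hij) hT (fun p hp q hq hp0 hq0 => ?_) ?_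
    · rw [Pi.neg_apply, Left.neg_pos_iff] at hp0
      rw [Pi.neg_apply, Left.neg_neg_iff] at hq0
      exact hb p hp q hq (by simpa using hp0.le) (by simpa using hq0)
    · simpa [Function.comp_def] using h.map (-LinearMap.id)

end Plane

/-! ### Simplicial polyhedra with at most six vertices -/

section Simplicial

variable {n : ℕ} {v : Fin n → E3}

/-- The points `v` are the vertices of a full-dimensional polytope all of whose proper faces are
simplices. -/
structure IsSimplicialPosition (v : Fin n → E3) : Prop where
  convexIndependent : ConvexIndependent ℝ v
  span : affineSpan ℝ (Set.range v) = ⊤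
  card_le : ∀ S : Finset (Fin n), IsFaceSet v S → S ≠ Finset.univ → S.card ≤ 3

lemma exists_convexIndependent_range_eq {P : Set E3} (hP : IsConvexPolyhedron P) :
    ∃ v : Fin (P.extremePoints ℝ).ncard → E3,
      ConvexIndependent ℝ v ∧ P = convexHull ℝ (Set.range v) := by
  obtain ⟨⟨s, hs, rfl⟩, -⟩ := hP
  have hfin : ((convexHull ℝ s).extremePoints ℝ).Finite :=
    hs.subset extremePoints_convexHull_subset
  have hhull : convexHull ℝ ((convexHull ℝ s).extremePoints ℝ) = convexHull ℝ s := by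
    rw [← (hfin.isCompact_convexHull (𝕜 := ℝ)).isClosed.closure_eq]
    exact closure_convexHull_extremePoints (hs.isCompact_convexHull (𝕜 := ℝ))
      (convex_convexHull ℝ s)
  have := hfin.to_subtype
  let e := Finite.equivFinOfCardEq (Nat.card_coe_set_eq ((convexHull ℝ s).extremePoints ℝ))
  refine ⟨Subtype.val ∘ e.symm, ?_, ?_⟩
  · exact (convex_convexHull ℝ s).convexIndependent_extremePoints.comp_embedding e.symm.toEmbedding
  · rw [e.symm.surjective.range_comp, Subtype.range_coe, hhull]

lemma exists_isSimplicialPosition {P : Set E3} (hP : IsConvexPolyhedron P) (hs : IsSimplicial P) :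
    ∃ v : Fin (P.extremePoints ℝ).ncard → E3,
      IsSimplicialPosition v ∧ P = convexHull ℝ (Set.range v) := by
  obtain ⟨v, hv, hPv⟩ := exists_convexIndependent_range_eq hP
  have hspan : affineSpan ℝ (Set.range v) = ⊤ :=
    affineSpan_eq_top_of_nonempty_interior (s := Set.range v) (hPv ▸ hP.2)
  refine ⟨v, ⟨hv, hspan, fun S hS hne => ?_⟩, hPv⟩
  by_contra! hcard
  have hface := (isFaceOfDim_two_iff hv hspan).2 ⟨hcard.le, hne, hS⟩
  rw [← hPv] at hface
  have htriangle := hs _ hface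
  rw [extremePoints_convexHull_image hv, Set.ncard_image_of_injective _ hv.injective,
    Set.ncard_coe_finset] at htriangle
  lia

namespace IsSimplicialPosition

lemma four_le (hv : IsSimplicialPosition v) : 4 ≤ n := by
  by_contra! h
  have hdim := finrank_vectorSpan_image_le v (S := Finset.univ) (d := 2)
    (by rw [Finset.card_univ, Fintype.card_fin]; lia)
  rw [Finset.coe_univ, Set.image_univ, ← direction_affineSpan, hv.span,
    AffineSubspace.direction_top, finrank_top, finrank_euclideanSpace_fin] at hdim
  lia

lemma comp (hv : IsSimplicialPosition v) (σ : Equiv.Perm (Fin n)) :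
    IsSimplicialPosition (v ∘ σ) where
  convexIndependent := hv.convexIndependent.comp_embedding σ.toEmbedding
  span := by rw [σ.surjective.range_comp, hv.span]
  card_le S hS hne := by
    rw [← Finset.card_image_of_injective S σ.injective]
    refine hv.card_le _ ((isFaceSet_comp σ).1 hS) fun h => hne ?_
    rwa [← Finset.image_univ_equiv σ, (Finset.image_injective σ.injective).eq_iff] at h

lemma hasType (hv : IsSimplicialPosition v) {T : CombType n}
    (hedges : ∀ S, S ∈ T.edges ↔ S.card = 2 ∧ IsFaceSet v S)
    (hfaces : ∀ S, S ∈ T.faces ↔ S.card = 3 ∧ IsFaceSet v S) :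
    HasType (convexHull ℝ (Set.range v)) T := by
  refine hasType_of_isFaceSet hv.convexIndependent hv.span hedges fun S => (hfaces S).trans ?_
  refine ⟨fun ⟨hcard, hS⟩ => ⟨hcard.ge, ?_, hS⟩, fun ⟨hcard, hne, hS⟩ =>
    ⟨(hv.card_le S hS hne).antisymm hcard, hS⟩⟩
  rintro rfl
  rw [Finset.card_univ, Fintype.card_fin] at hcard
  exact absurd hv.four_le (by lia)

variable {W : Type*} [AddCommGroup W] [Module ℝ W] {a : Fin n → W}

lemma not_isPositivelyDependent (hv : IsSimplicialPosition v) (ha : IsGaleDual a v)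
    {T : Finset (Fin n)} (hT : T.Nonempty) (hcard : T.card + 3 < n) :
    ¬ IsPositivelyDependent a T := fun h => by
  have hle := hv.card_le Tᶜ (ha.isFaceSet_iff.2 (by rwa [compl_compl]))
    ((Finset.compl_ne_univ_iff_nonempty T).2 hT)
  rw [Finset.card_compl, Fintype.card_fin] at hle
  lia

lemma ne_zero_of_isGaleDual (hv : IsSimplicialPosition v) (ha : IsGaleDual a v) (hn : 4 < n)
    (i : Fin n) : a i ≠ 0 := fun hi =>
  hv.not_isPositivelyDependent ha (T := {i}) (Finset.singleton_nonempty i)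
    (by rw [Finset.card_singleton]; exact hn) ⟨1, fun _ _ => one_pos, by simp [hi]⟩

lemma isPositivelyDependent_compl_singleton (hv : IsSimplicialPosition v) (ha : IsGaleDual a v)
    (i : Fin n) : IsPositivelyDependent a {i}ᶜ :=
  ha.isFaceSet_iff.1 (isFaceSet_singleton hv.convexIndependent i)

end IsSimplicialPosition

/-- The relabelling `q` identifies the type `T` with the one whose edges and faces are the sets of
two and three vertices with complement in `F`. -/
def Relabels (T : CombType n) (F : Finset (Fin n) → Prop) (q : Fin n → Fin n) : Prop :=
  Function.Injective q ∧ (∀ S, S ∈ T.edges ↔ S.card = 2 ∧ F (S.image q)ᶜ) ∧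
    ∀ S, S ∈ T.faces ↔ S.card = 3 ∧ F (S.image q)ᶜ

instance (T : CombType n) (F : Finset (Fin n) → Prop) [DecidablePred F] (q : Fin n → Fin n) :
    Decidable (Relabels T F q) :=
  inferInstanceAs (Decidable (_ ∧ _))

lemma IsSimplicialPosition.hasType_of_relabels {W : Type*} [AddCommGroup W] [Module ℝ W]
    {a : Fin n → W} (hv : IsSimplicialPosition v) (ha : IsGaleDual a v)
    {F : Finset (Fin n) → Prop} (hF : ∀ T, T.Nonempty → (IsPositivelyDependent a T ↔ F T))
    {T : CombType n} {q : Fin n → Fin n} (hq : Relabels T F q) :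
    HasType (convexHull ℝ (Set.range v)) T := by
  obtain ⟨hinj, hedges, hfaces⟩ := hq
  let σ := Equiv.ofBijective q (Finite.injective_iff_bijective.1 hinj)
  have hface {S : Finset (Fin n)} (hS : S.card ≤ 3) :
      F (S.image q)ᶜ ↔ IsFaceSet (v ∘ σ) S := by
    have hne : (S.image q)ᶜ.Nonempty := by
      rw [← Finset.card_pos, Finset.card_compl, Finset.card_image_of_injective S hinj,
        Fintype.card_fin]
      have := hv.four_le
      lia
    rw [isFaceSet_comp, ha.isFaceSet_iff]
    exact (hF _ hne).symm
  rw [← σ.surjective.range_comp]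
  exact (hv.comp σ).hasType
    (fun S => (hedges S).trans (and_congr_right fun h => hface (by lia)))
    fun S => (hfaces S).trans (and_congr_right fun h => hface h.le)

lemma IsSimplicialPosition.hasType_tetrahedron {v : Fin 4 → E3} (hv : IsSimplicialPosition v) :
    HasType (convexHull ℝ (Set.range v)) tetrahedron := by
  obtain ⟨a, ha⟩ := exists_isGaleDual (W := Fin 0 → ℝ) hv.span (by simp)
  have hall (T : Finset (Fin 4)) : IsPositivelyDependent a T :=
    ⟨1, fun _ _ => one_pos, Subsingleton.elim _ _⟩
  exact hv.hasType_of_relabels ha (F := fun _ => True) (q := id)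
    (fun T _ => iff_true_intro (hall T)) (by decide +kernel)

lemma exists_relabels_triangularBipyramid : ∀ ε : Fin 5 → Bool, (∀ i, BothSigns ε {i}ᶜ) →
    ∃ q : Equiv.Perm (Fin 5), Relabels triangularBipyramid (BothSigns ε) q := by
  decide +kernel

lemma IsSimplicialPosition.hasType_triangularBipyramid {v : Fin 5 → E3}
    (hv : IsSimplicialPosition v) :
    HasType (convexHull ℝ (Set.range v)) triangularBipyramid := by
  obtain ⟨a, ha⟩ := exists_isGaleDual (W := ℝ) hv.span (by simp)
  have ha0 := hv.ne_zero_of_isGaleDual ha (by lia)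
  have hsigns (T : Finset (Fin 5)) (hT : T.Nonempty) := isPositivelyDependent_iff_bothSigns ha0 hT
  obtain ⟨q, hq⟩ := exists_relabels_triangularBipyramid (fun i => decide (0 < a i)) fun i =>
    (hsigns _ (by simp [← Finset.card_pos, Finset.card_compl])).1
      (hv.isPositivelyDependent_compl_singleton ha i)
  exact hv.hasType_of_relabels ha hsigns hq

lemma IsGaleDual.exists_slopes {a : Fin n → ℝ × ℝ} (ha : IsGaleDual a v) (ha0 : ∀ i, a i ≠ 0) :
    ∃ (σ : Equiv.Perm (Fin n)) (β s : Fin n → ℝ), Monotone s ∧ (∀ i, β i ≠ 0) ∧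
      IsGaleDual (fun i => β i • ((1 : ℝ), s i)) (v ∘ σ) := by
  -- Only finitely many shears take one of the vectors to the vertical axis.
  obtain ⟨t, ht⟩ := Infinite.exists_notMem_finset (Finset.univ.image fun i => -(a i).2 / (a i).1)
  have hβ (i : Fin n) : (a i).2 + t * (a i).1 ≠ 0 := fun h => by
    rcases eq_or_ne (a i).1 0 with h1 | h1
    · exact ha0 i (Prod.ext h1 (by simpa [h1] using h))
    · exact ht (Finset.mem_image.2 ⟨i, Finset.mem_univ i, by rw [div_eq_iff h1]; linarith⟩)
  let shear : ℝ × ℝ →ₗ[ℝ] ℝ × ℝ :=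
    (LinearMap.snd ℝ ℝ ℝ + t • LinearMap.fst ℝ ℝ ℝ).prod (LinearMap.fst ℝ ℝ ℝ)
  have hshear : Function.Injective shear := fun x y h => by
    have hfst : x.1 = y.1 := congrArg Prod.snd h
    have hsnd : x.2 + t * x.1 = y.2 + t * y.1 := congrArg Prod.fst h
    exact Prod.ext hfst (by simpa [hfst] using hsnd)
  let s : Fin n → ℝ := fun i => (a i).1 / ((a i).2 + t * (a i).1)
  let σ := Tuple.sort s
  refine ⟨σ, fun i => (a (σ i)).2 + t * (a (σ i)).1, s ∘ σ, Tuple.monotone_sort s,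
    fun i => hβ _, ?_⟩
  convert (ha.map hshear).comp σ using 2 with i
  simp [shear, s, mul_div_cancel₀ _ (hβ (σ i))]

/-- The relabellings listed were found by a search over all permutations, which would be too long
for a proof by evaluation. -/
lemma exists_relabels_octahedron_or_stackedBipyramid : ∀ ε : Fin 6 → Bool,
    (∀ i, Alternates ε {i}ᶜ) →
    (∃ q ∈ [![0, 1, 2, 3, 4, 5], ![0, 5, 1, 2, 3, 4]], Relabels octahedron (Alternates ε) q) ∨
      ∃ q ∈ [![0, 2, 3, 4, 1, 5], ![0, 4, 2, 3, 5, 1], ![1, 3, 4, 5, 2, 0], ![2, 4, 0, 5, 3, 1],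
        ![3, 5, 0, 1, 4, 2], ![4, 0, 1, 2, 5, 3]], Relabels stackedBipyramid (Alternates ε) q := by
  decide +kernel

lemma IsSimplicialPosition.hasType_octahedron_or_stackedBipyramid {v : Fin 6 → E3}
    (hv : IsSimplicialPosition v) : HasType (convexHull ℝ (Set.range v)) octahedron ∨
      HasType (convexHull ℝ (Set.range v)) stackedBipyramid := by
  obtain ⟨a, ha⟩ := exists_isGaleDual (W := ℝ × ℝ) hv.span (by simp)
  have ha0 := hv.ne_zero_of_isGaleDual ha (by lia)
  obtain ⟨σ, β, s, hs, hβ, hdual⟩ := ha.exists_slopes ha0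
  have hpar (i j : Fin 6) (hij : s i = s j) : 0 < β i * β j := by
    by_contra! hle
    have hneg := hle.lt_of_ne (mul_ne_zero (hβ i) (hβ j))
    have hpair : IsPositivelyDependent (fun l => β l • ((1 : ℝ), s l)) {i, j} :=
      isPositivelyDependent_pair (pow_pos (abs_pos.2 (hβ j)) 2) (neg_pos.2 hneg)
        (by rw [hij, smul_smul, smul_smul, ← add_smul, sq_abs]; ring_nf; exact zero_smul _ _)
    exact (hv.comp σ).not_isPositivelyDependent hdual (Finset.insert_nonempty i _)
      (by have := Finset.card_le_two (a := i) (b := j); lia) hpair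
  have hsigns (T : Finset (Fin 6)) (hT : T.Nonempty) :=
    isPositivelyDependent_iff_alternates hs hβ hpar hT
  rw [← σ.surjective.range_comp]
  rcases exists_relabels_octahedron_or_stackedBipyramid (fun i => decide (0 < β i)) fun i =>
    (hsigns _ (by simp [← Finset.card_pos, Finset.card_compl])).1
      ((hv.comp σ).isPositivelyDependent_compl_singleton hdual i) with ⟨q, -, hq⟩ | ⟨q, -, hq⟩
  · exact .inl ((hv.comp σ).hasType_of_relabels hdual hsigns hq)
  · exact .inr ((hv.comp σ).hasType_of_relabels hdual hsigns hq)

lemma hasType_of_isSimplicial {P : Set E3} (hP : IsConvexPolyhedron P) (hs : IsSimplicial P)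
    (h6 : (P.extremePoints ℝ).ncard ≤ 6) : HasType P tetrahedron ∨ HasType P triangularBipyramid ∨
      HasType P octahedron ∨ HasType P stackedBipyramid := by
  obtain ⟨v, hv, hPv⟩ := exists_isSimplicialPosition hP hs
  have h4 := hv.four_le
  rw [hPv]
  generalize (P.extremePoints ℝ).ncard = n at v h4 h6
  obtain rfl | rfl | rfl : n = 4 ∨ n = 5 ∨ n = 6 := by lia
  · exact .inl hv.hasType_tetrahedron
  · exact .inr (.inl hv.hasType_triangularBipyramid)
  · exact .inr (.inr hv.hasType_octahedron_or_stackedBipyramid)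

end Simplicial

end HexGlue

open HexGlue in
theorem mainTheorem3 :
    (∃ P : Set E3, IsHexGlued P ∧ HasType P tetrahedron) ∧
    (∃ P : Set E3, IsHexGlued P ∧ HasType P triangularBipyramid) ∧
    (∃ P : Set E3, IsHexGlued P ∧ HasType P squarePyramid ∧ IsRightRectangularPyramid P) ∧
    (∃ P : Set E3, IsHexGlued P ∧ HasType P octahedron ∧ IsRegularOctahedron P) ∧
    (∃ P : Set E3, IsHexGlued P ∧ HasType P stackedBipyramid) ∧
    (∃ P : Set E3, IsHexGlued P ∧ HasType P triangularPrism ∧ IsTriangularPrism P) ∧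
    (∀ P : Set E3, IsConvexPolyhedron P → IsSimplicial P → (P.extremePoints ℝ).ncard ≤ 6 →
      HasType P tetrahedron ∨ HasType P triangularBipyramid ∨ HasType P octahedron ∨
        HasType P stackedBipyramid) := by
  have pyramid := pyramidPlan_valid.isHexGlued_and_hasType pyramidPlan_isPolyhedron
  have octa := octahedronPlan_valid.isHexGlued_and_hasType octahedronPlan_isPolyhedron
  have prism := prismPlan_valid.isHexGlued_and_hasType prismPlan_isPolyhedron
  exact ⟨⟨_, tetrahedronPlan_valid.isHexGlued_and_hasType tetrahedronPlan_isPolyhedron⟩,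
    ⟨_, bipyramidPlan_valid.isHexGlued_and_hasType bipyramidPlan_isPolyhedron⟩,
    ⟨_, pyramid.1, pyramid.2, isRightRectangularPyramid_pyramidPlan⟩,
    ⟨_, octa.1, octa.2, isRegularOctahedron_octahedronPlan⟩,
    ⟨_, stackedPlan_valid.isHexGlued_and_hasType stackedPlan_isPolyhedron⟩,
    ⟨_, prism.1, prism.2, isTriangularPrism_prismPlan⟩,
    fun _ hP hs h6 => hasType_of_isSimplicial hP hs h6⟩
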